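/- Let $X$ be a complex surface, i.e. a (not necessarily connected or compact) complex manifold of dimension $2$, with structure sheaf $\mathcal O_X$ of holomorphic functions, and let $\pi$ be a holomorphic Poisson structure on $X$: a holomorphic section of $\wedge^2 T_X$ whose bracket $\{f,g\}=\langle\pi,\mathrm df\wedge \mathrm dg\rangle$ satisfies the Jacobi identity. Let $\mathcal D_X$ be the sheaf of holomorphic differential operators. For $k=0,1,2$ let $\mathcal M_\pi^k$ be the right $\mathcal D_X$-module of differential operators $\mathcal O_X\to\wedge^kT_X$, with $\mathcal D_X$ acting by precomposition. Composition with the Lichnerowicz differential $\mathrm d_\pi=[\pi,-]$ makes $$\mathcal M_\pi^0\to\mathcal M_\pi^1\to\mathcal M_\pi^2$$ a complex of right $\mathcal D_X$-modules with coherent cohomology modules $\mathcal H^k(\mathcal M_\pi)$. The characteristic variety of $(X,\pi)$ is $$\mathrm{Char}(X,\pi)=\bigcup_{k}\mathrm{Char}\big(\mathcal H^k(\mathcal M_\pi)\big)\subset T^*X,$$ where the characteristic variety of a coherent $\mathcal D_X$-module is the support of its associated graded module with respect to a good filtration. The Poisson surface $(X,\pi)$ is called *holonomic* if $\mathrm{Char}(X,\pi)$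 is a Lagrangian subvariety of $T^*X$, that is, a closed analytic subset whose tangent space at every regular point is Lagrangian (equal to its own orthogonal for the canonical symplectic form; the empty set is allowed). It is called *log symplectic* if $\pi$ is nonzero on a dense subset of $X$ and its zero scheme $Y\subset X$, given in local coordinates $(w,z)$ by the ideal $(f)$ where $\pi=f\,\partial_w\wedge\partial_z$, is reduced (possibly empty). Then $(X,\pi)$ is holonomic if and only if it is log symplectic. -/

import Mathlib

open scoped Manifold ContDiff Topology

noncomputable section

namespace PoissonSurface

/-! ## Differential operators on modules over a commutative algebra -/

section DiffOperators

variable {R : Type*} [CommRing R] [Algebra ℂ R]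
variable {M : Type*} [AddCommGroup M] [Module ℂ M] [Module R M] [IsScalarTower ℂ R M]
variable {N : Type*} [AddCommGroup N] [Module ℂ N] [Module R N] [IsScalarTower ℂ R N]
variable {L : Type*} [AddCommGroup L] [Module ℂ L] [Module R L] [IsScalarTower ℂ R L]

/-- The commutator `[P, a] : x ↦ P (a x) - a (P x)` of a `ℂ`-linear map with a scalar `a ∈ R`. -/
def comm (a : R) (P : M →ₗ[ℂ] N) : M →ₗ[ℂ] N :=
  P ∘ₗ Algebra.lsmul ℂ ℂ M a - Algebra.lsmul ℂ ℂ N a ∘ₗ P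

@[simp] lemma comm_apply (a : R) (P : M →ₗ[ℂ] N) (x : M) :
    comm a P x = P (a • x) - a • P x := rfl

/-- `HasOrder R m P`: the `ℂ`-linear map `P` is a differential operator of order at most `m`
over the `ℂ`-algebra `R` (Grothendieck's definition by iterated commutators). -/
def HasOrder (R : Type*) [CommRing R] [Algebra ℂ R]
    {M : Type*} [AddCommGroup M] [Module ℂ M] [Module R M] [IsScalarTower ℂ R M]
    {N : Type*} [AddCommGroup N] [Module ℂ N] [Module R N] [IsScalarTower ℂ R N] :
    ℕ → (M →ₗ[ℂ] N) → Prop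
  | 0, P => ∀ a : R, comm a P = 0
  | m + 1, P => ∀ a : R, HasOrder R m (comm a P)

lemma hasOrder_zero (m : ℕ) : HasOrder R m (0 : M →ₗ[ℂ] N) := by
  have h (a : R) : comm a (0 : M →ₗ[ℂ] N) = 0 := by ext; simp
  induction m with
  | zero => exact h
  | succ m ih => intro a; rw [h]; exact ih

lemma HasOrder.succ {m : ℕ} {P : M →ₗ[ℂ] N} (h : HasOrder R m P) : HasOrder R (m + 1) P := by
  induction m generalizing P with
  | zero => intro a; rw [h a]; exact hasOrder_zero 0
  | succ m ih => intro a; exact ih (h a)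

lemma HasOrder.mono {m n : ℕ} (hmn : m ≤ n) {P : M →ₗ[ℂ] N} (h : HasOrder R m P) :
    HasOrder R n P := by
  induction hmn with
  | refl => exact h
  | step _ ih => exact ih.succ

lemma HasOrder.add {m : ℕ} {P Q : M →ₗ[ℂ] N} (hP : HasOrder R m P) (hQ : HasOrder R m Q) :
    HasOrder R m (P + Q) := by
  have h (a : R) (P Q : M →ₗ[ℂ] N) : comm a (P + Q) = comm a P + comm a Q := by
    ext; simp; abel
  induction m generalizing P Q with
  | zero => intro a; rw [h, hP a, hQ a, add_zero]
  | succ m ih => intro a; rw [h]; exact ih (hP a) (hQ a)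

lemma HasOrder.smul {m : ℕ} {P : M →ₗ[ℂ] N} (c : ℂ) (hP : HasOrder R m P) :
    HasOrder R m (c • P) := by
  have h (a : R) (P : M →ₗ[ℂ] N) : comm a (c • P) = c • comm a P := by
    ext; simp [smul_sub, smul_comm c a]
  induction m generalizing P with
  | zero => intro a; rw [h, hP a, smul_zero]
  | succ m ih => intro a; rw [h]; exact ih (hP a)

lemma HasOrder.comp {m n : ℕ} {P : N →ₗ[ℂ] L} {Q : M →ₗ[ℂ] N}
    (hP : HasOrder R m P) (hQ : HasOrder R n Q) : HasOrder R (m + n) (P ∘ₗ Q) := by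
  have h (a : R) (P : N →ₗ[ℂ] L) (Q : M →ₗ[ℂ] N) :
      comm a (P ∘ₗ Q) = P ∘ₗ comm a Q + comm a P ∘ₗ Q := by
    ext; simp
  induction hs : m + n generalizing m n P Q with
  | zero =>
    obtain ⟨rfl, rfl⟩ : m = 0 ∧ n = 0 := by omega
    intro a
    rw [h, hP a, hQ a, LinearMap.comp_zero, LinearMap.zero_comp, add_zero]
  | succ s ih =>
    intro a
    rw [h]
    refine HasOrder.add ?_ ?_
    · cases n with
      | zero => rw [hQ a, LinearMap.comp_zero]; exact hasOrder_zero s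
      | succ n => exact ih hP (hQ a) (by omega)
    · cases m with
      | zero => rw [hP a, LinearMap.zero_comp]; exact hasOrder_zero s
      | succ m => exact ih (hP a) hQ (by omega)

/-- The differential operators `R → R`, as a subalgebra of the linear endomorphisms. -/
def diffOpAlgebra (R : Type*) [CommRing R] [Algebra ℂ R] : Subalgebra ℂ (Module.End ℂ R) where
  carrier := {P | ∃ m, HasOrder R m P}
  mul_mem' := by
    rintro P Q ⟨m, hP⟩ ⟨n, hQ⟩
    exact ⟨m + n, hP.comp hQ⟩
  add_mem' := by
    rintro P Q ⟨m, hP⟩ ⟨n, hQ⟩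
    exact ⟨max m n, (hP.mono (le_max_left _ _)).add (hQ.mono (le_max_right _ _))⟩
  algebraMap_mem' := by
    intro c
    refine ⟨0, fun a => ?_⟩
    ext x
    simp

/-- The ring `D` of differential operators `R → R`. -/
def DRing (R : Type*) [CommRing R] [Algebra ℂ R] : Type _ := ↥(diffOpAlgebra R)

instance : Ring (DRing R) := inferInstanceAs (Ring ↥(diffOpAlgebra R))

/-- The underlying linear map of an element of `D`. -/
def DRing.toLin (P : DRing R) : R →ₗ[ℂ] R := P.1

/-- The differential operators `R → T`, as a subspace of the linear maps. -/
def diffOpsSubmodule (R : Type*) [CommRing R] [Algebra ℂ R]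
    (T : Type*) [AddCommGroup T] [Module ℂ T] [Module R T] [IsScalarTower ℂ R T] :
    Submodule ℂ (R →ₗ[ℂ] T) where
  carrier := {P | ∃ m, HasOrder R m P}
  zero_mem' := ⟨0, hasOrder_zero 0⟩
  add_mem' := by
    rintro P Q ⟨m, hP⟩ ⟨n, hQ⟩
    exact ⟨max m n, (hP.mono (le_max_left _ _)).add (hQ.mono (le_max_right _ _))⟩
  smul_mem' := by
    rintro c P ⟨m, hP⟩
    exact ⟨m, hP.smul c⟩

/-- The space of differential operators `R → T`. -/
def DiffOps (R : Type*) [CommRing R] [Algebra ℂ R]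
    (T : Type*) [AddCommGroup T] [Module ℂ T] [Module R T] [IsScalarTower ℂ R T] : Type _ :=
  ↥(diffOpsSubmodule R T)

instance : AddCommGroup (DiffOps R M) := inferInstanceAs (AddCommGroup ↥(diffOpsSubmodule R M))

/-- The underlying linear map of a differential operator. -/
def DiffOps.toLin (φ : DiffOps R M) : R →ₗ[ℂ] M := φ.1

/-- `DiffOps R T` is a right `D`-module by precomposition: `φ · P = φ ∘ P`. -/
instance : Module (DRing R)ᵐᵒᵖ (DiffOps R M) where
  smul P φ := ⟨φ.1 ∘ₗ P.unop.1, by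
    obtain ⟨m, hm⟩ := φ.2
    obtain ⟨n, hn⟩ := P.unop.2
    exact ⟨m + n, hm.comp hn⟩⟩
  one_smul _ := rfl
  mul_smul _ _ _ := rfl
  smul_zero P := Subtype.ext (LinearMap.zero_comp P.unop.1)
  smul_add P φ ψ := Subtype.ext (LinearMap.add_comp P.unop.1 ψ.1 φ.1)
  add_smul P Q φ := Subtype.ext (LinearMap.comp_add P.unop.1 Q.unop.1 φ.1)
  zero_smul φ := Subtype.ext (LinearMap.comp_zero φ.1)

/-- Composition `φ ↦ δ ∘ φ` with a differential operator `δ : M → N`, a map of right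
`D`-modules. -/
def DiffOps.postcomp (δ : M →ₗ[ℂ] N) (hδ : ∃ m, HasOrder R m δ) :
    DiffOps R M →ₗ[(DRing R)ᵐᵒᵖ] DiffOps R N where
  toFun φ := ⟨δ ∘ₗ φ.1, by
    obtain ⟨m, hm⟩ := hδ
    obtain ⟨n, hn⟩ := φ.2
    exact ⟨m + n, hm.comp hn⟩⟩
  map_add' φ ψ := Subtype.ext (LinearMap.comp_add φ.1 ψ.1 δ)
  map_smul' _ _ := rfl

end DiffOperators

/-! ## Polyvector fields, the Lichnerowicz complex and its complex of `D`-modules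

`R` plays the role of the local ring of germs of holomorphic functions on a surface. -/

section Lichnerowicz

variable (R : Type*) [CommRing R] [Algebra ℂ R]

/-- Vector fields: `ℂ`-linear derivations of `R`. -/
abbrev Vec : Type _ := Derivation ℂ R R

/-- Skew-symmetric biderivations `B : R × R → R`, as a submodule of all biderivations. -/
def bivecSubmodule : Submodule R (Derivation ℂ R (Vec R)) where
  carrier := {B | ∀ a : R, B a a = 0}
  zero_mem' := fun _ => rfl
  add_mem' := by
    intro B C hB hC a
    simp [hB a, hC a]
  smul_mem' := by
    intro c B hB a
    simp [hB a]

/-- Bivector fields: skew-symmetric biderivations `B : R × R → R`. -/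
def Bivec : Type _ := ↥(bivecSubmodule R)

instance : AddCommGroup (Bivec R) := inferInstanceAs (AddCommGroup ↥(bivecSubmodule R))
instance : Module R (Bivec R) := inferInstanceAs (Module R ↥(bivecSubmodule R))
instance : Module ℂ (Bivec R) := inferInstanceAs (Module ℂ ↥(bivecSubmodule R))
instance : IsScalarTower ℂ R (Bivec R) :=
  inferInstanceAs (IsScalarTower ℂ R ↥(bivecSubmodule R))

variable {R}

@[ext] lemma Bivec.ext {B C : Bivec R} (h : ∀ a b, B.1 a b = C.1 a b) : B = C :=
  Subtype.ext (Derivation.ext fun a => Derivation.ext fun b => h a b)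

@[simp] lemma Bivec.add_val (B C : Bivec R) : (B + C).1 = B.1 + C.1 := rfl
@[simp] lemma Bivec.sub_val (B C : Bivec R) : (B - C).1 = B.1 - C.1 := rfl
@[simp] lemma Bivec.zero_val : (0 : Bivec R).1 = 0 := rfl
@[simp] lemma Bivec.smul_val (c : R) (B : Bivec R) : (c • B).1 = c • B.1 := rfl
@[simp] lemma Bivec.csmul_val (c : ℂ) (B : Bivec R) : (c • B).1 = c • B.1 := rfl

lemma Bivec.skew (B : Bivec R) (a b : R) : B.1 a b = - B.1 b a := by
  have h := B.2 (a + b)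
  simp only [map_add, Derivation.add_apply] at h
  have ha : B.1 a a = 0 := B.2 a
  have hb : B.1 b b = 0 := B.2 b
  rw [ha, hb] at h
  linear_combination h

/-- `[π, g] ∈ Vec` for a function `g`: the vector field `a ↦ {a, g}`. -/
def lich0 (B : Bivec R) : R →ₗ[ℂ] Vec R := -(B.1 : R →ₗ[ℂ] Vec R)

lemma lich0_apply (B : Bivec R) (g a : R) : lich0 B g a = B.1 a g := by
  rw [Bivec.skew B a g]; rfl

/-- `[π, V] ∈ Bivec` for a vector field `V`: the biderivation
`(a, b) ↦ {a, V b} + {V a, b} - V {a, b}`. -/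
def lich1Aux (B : Bivec R) (V : Vec R) : Derivation ℂ R (Vec R) :=
  Derivation.mk'
    { toFun := fun a => ⁅B.1 a, V⁆ + B.1 (V a)
      map_add' := by
        intro a b
        ext c
        simp only [map_add, Derivation.add_apply, Derivation.commutator_apply]
        ring
      map_smul' := by
        intro c a
        ext b
        have h : B.1 (c • a) = c • B.1 a := B.1.map_smul c a
        have h' : V (c • a) = c • V a := V.map_smul c a
        have h'' : B.1 (c • V a) = c • B.1 (V a) := B.1.map_smul c (V a)
        have h3 : V (c • B.1 a b) = c • V (B.1 a b) := V.map_smul c _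
        simp only [h, h', h'', h3, Derivation.add_apply, Derivation.commutator_apply,
          Derivation.smul_apply, RingHom.id_apply, smul_add, smul_sub] }
    (by
      intro a b
      ext c
      simp only [LinearMap.coe_mk, AddHom.coe_mk, Derivation.leibniz, map_add,
        Derivation.add_apply, Derivation.commutator_apply, Derivation.smul_apply, smul_eq_mul]
      ring)

lemma lich1Aux_apply (B : Bivec R) (V : Vec R) (a b : R) :
    lich1Aux B V a b = B.1 a (V b) + B.1 (V a) b - V (B.1 a b) := by
  have h : lich1Aux B V a b = (B.1 a (V b) - V (B.1 a b)) + B.1 (V a) b := rfl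
  rw [h]; ring

/-- The differential `V ↦ [π, V]` from vector fields to bivector fields. -/
def lich1 (B : Bivec R) : Vec R →ₗ[ℂ] Bivec R where
  toFun V := ⟨lich1Aux B V, by
    intro a
    have h : B.1 a a = 0 := B.2 a
    rw [lich1Aux_apply, h, B.skew (V a) a, map_zero]
    ring⟩
  map_add' V W := by
    refine Bivec.ext fun a b => ?_
    change lich1Aux B (V + W) a b = lich1Aux B V a b + lich1Aux B W a b
    simp only [Derivation.add_apply, lich1Aux_apply, map_add]
    ring
  map_smul' c V := by
    refine Bivec.ext fun a b => ?_
    change lich1Aux B (c • V) a b = c • lich1Aux B V a b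
    have h : B.1 a (c • V b) = c • B.1 a (V b) := (B.1 a).map_smul c (V b)
    have h' : B.1 (c • V a) = c • B.1 (V a) := B.1.map_smul c (V a)
    simp only [Derivation.smul_apply, lich1Aux_apply, h, h', smul_add, smul_sub]

lemma lich0_order (B : Bivec R) : ∃ m, HasOrder R m (lich0 B) := by
  refine ⟨1, fun a b => ?_⟩
  ext g c
  simp only [comm_apply, LinearMap.zero_apply, Derivation.zero_apply, Derivation.sub_apply,
    Derivation.smul_apply, lich0_apply, Derivation.leibniz, smul_eq_mul]
  ring

lemma lich1_order (B : Bivec R) : ∃ m, HasOrder R m (lich1 B) := by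
  have key (V : Vec R) (x y : R) :
      (lich1 B V).1 x y = B.1 x (V y) + B.1 (V x) y - V (B.1 x y) := lich1Aux_apply B V x y
  refine ⟨1, fun a b => ?_⟩
  apply LinearMap.ext
  intro V
  ext x y
  simp only [comm_apply, LinearMap.zero_apply, Bivec.zero_val, Derivation.zero_apply,
    Bivec.sub_val, Bivec.smul_val, Derivation.sub_apply,
    Derivation.smul_apply, key, Derivation.leibniz, Derivation.add_apply, smul_eq_mul]
  ring

/-- The map `M⁰ → M¹` of the complex of right `D`-modules, where `Mᵏ` is the module of
differential operators from functions to `k`-vector fields. -/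
def dM0 (B : Bivec R) : DiffOps R R →ₗ[(DRing R)ᵐᵒᵖ] DiffOps R (Vec R) :=
  DiffOps.postcomp (lich0 B) (lich0_order B)

/-- The map `M¹ → M²` of the complex of right `D`-modules. On a surface `Mᵏ = 0` for `k > 2`. -/
def dM1 (B : Bivec R) : DiffOps R (Vec R) →ₗ[(DRing R)ᵐᵒᵖ] DiffOps R (Bivec R) :=
  DiffOps.postcomp (lich1 B) (lich1_order B)

/-- The cohomology module in degree `0`. -/
abbrev H0 (B : Bivec R) : Type _ := ↥(LinearMap.ker (dM0 B))

/-- The cohomology module in degree `1`: cocycles modulo coboundaries. -/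
abbrev H1 (B : Bivec R) : Type _ :=
  ↥(LinearMap.ker (dM1 B)) ⧸ (LinearMap.range (dM0 B)).comap (LinearMap.ker (dM1 B)).subtype

/-- The cohomology module in degree `2`. -/
abbrev H2 (B : Bivec R) : Type _ := DiffOps R (Bivec R) ⧸ LinearMap.range (dM1 B)

end Lichnerowicz

/-! ## Characteristic varieties of right `D`-modules -/

section Characteristic

variable {R : Type*} [CommRing R] [Algebra ℂ R]

/-- The order filtration of `D`, indexed by all integers (`F_m D = 0` for `m < 0`). -/
def orderFil (R : Type*) [CommRing R] [Algebra ℂ R] (m : ℤ) : Set (DRing R) :=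
  {P | P = 0 ∨ ∃ k : ℕ, (k : ℤ) ≤ m ∧ HasOrder R k P.toLin}

variable {N : Type*} [AddCommGroup N] [Module (DRing R)ᵐᵒᵖ N]

/-- A good filtration of a right `D`-module `N`: an exhaustive filtration such that, for some
finite family `n i ∈ N` with degrees `k i`, one has `F_j N = ∑ i, n i · F_{j - k i} D` for all
`j`; in other words, `gr N` is finitely generated over `gr D`. -/
structure IsGoodFiltration (F : ℤ → Set N) : Prop where
  exhaustive : ∀ x, ∃ j, x ∈ F j
  generated : ∃ (r : ℕ) (n : Fin r → N) (k : Fin r → ℤ), ∀ j x,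
    x ∈ F j ↔ ∃ P : Fin r → DRing R, (∀ i, P i ∈ orderFil R (j - k i)) ∧
      x = ∑ i, MulOpposite.op (P i) • n i

/-- Let `ev` be evaluation at a point `p` and `g` a function with `g(p) = 0`. The value at the
covector `dg(p)` of the symbol of degree `m` of an operator `P` of order at most `m`. -/
def symbolAt (ev : R →ₐ[ℂ] ℂ) (g : R) (m : ℕ) (P : DRing R) : ℂ :=
  ev (P.toLin (g ^ m)) / (m.factorial : ℂ)

/-- The covector `dg(p)` lies in the support of `gr N` over `gr D`, for the filtration `F`:
there is a homogeneous element of `gr N`, the class of some `x ∈ F_j N`, all of whose homogeneous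
annihilators in `gr D`, that is, the symbols of the `P ∈ F_m D` with `x · P ∈ F_{j+m-1} N`,
vanish at `dg(p)`. (Annihilators of homogeneous elements are homogeneous ideals, so this says that
the localization of `gr N` at the point `dg(p)` is nonzero.) -/
def InSupport (ev : R →ₐ[ℂ] ℂ) (g : R) (F : ℤ → Set N) : Prop :=
  ∃ (j : ℤ) (x : N), x ∈ F j ∧ ∀ (m : ℕ) (P : DRing R), HasOrder R m P.toLin →
    MulOpposite.op P • x ∈ F (j + m - 1) → symbolAt ev g m P = 0

/-- The covector `dg(p)` lies in the characteristic variety of `N`: it lies in the support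
of `gr N` for a good filtration of `N`. -/
def InChar (ev : R →ₐ[ℂ] ℂ) (g : R) (N : Type*) [AddCommGroup N]
    [Module (DRing R)ᵐᵒᵖ N] : Prop :=
  ∃ F : ℤ → Set N, IsGoodFiltration (R := R) F ∧ InSupport ev g F

end Characteristic

/-! ## Complex surfaces: germs of holomorphic functions -/

/-- The model space of complex surfaces. -/
abbrev C2 : Type := EuclideanSpace ℂ (Fin 2)

section Germs

variable {X : Type*} [TopologicalSpace X] [ChartedSpace C2 X]

/-- `f` is holomorphic in a neighbourhood of `p`. -/
def HolAt (f : X → ℂ) (p : X) : Prop :=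
  ∀ᶠ x in 𝓝 p, MDifferentiableAt 𝓘(ℂ, C2) 𝓘(ℂ, ℂ) f x

/-- The functions that are holomorphic near `p`. -/
def holAlg (p : X) : Subalgebra ℂ (X → ℂ) where
  carrier := {f | HolAt f p}
  mul_mem' := by
    intro f g hf hg
    filter_upwards [hf, hg] with x hx hy
    exact hx.mul hy
  add_mem' := by
    intro f g hf hg
    filter_upwards [hf, hg] with x hx hy
    exact hx.add hy
  algebraMap_mem' := by
    intro c
    exact Filter.Eventually.of_forall fun x => mdifferentiableAt_const

/-- The functions that vanish identically near `p`. -/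
def nullIdeal (p : X) : Ideal (holAlg p) where
  carrier := {f | ∀ᶠ x in 𝓝 p, f.1 x = 0}
  zero_mem' := Filter.Eventually.of_forall fun _ => rfl
  add_mem' := by
    intro f g hf hg
    filter_upwards [hf, hg] with x hx hy
    change f.1 x + g.1 x = 0
    rw [hx, hy, add_zero]
  smul_mem' := by
    intro c f hf
    filter_upwards [hf] with x hx
    change c.1 x * f.1 x = 0
    rw [hx, mul_zero]

/-- The local ring `𝒪_p` of germs at `p` of holomorphic functions. -/
def Stalk (p : X) : Type _ := holAlg p ⧸ nullIdeal p

instance (p : X) : CommRing (Stalk p) := inferInstanceAs (CommRing (holAlg p ⧸ nullIdeal p))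

instance (p : X) : Algebra ℂ (Stalk p) := inferInstanceAs (Algebra ℂ (holAlg p ⧸ nullIdeal p))

/-- The germ at `p` of a function that is holomorphic near `p`. -/
def germ {p : X} (f : X → ℂ) (hf : HolAt f p) : Stalk p :=
  Ideal.Quotient.mk (nullIdeal p) ⟨f, hf⟩

lemma germ_eq_iff {p : X} {f g : X → ℂ} (hf : HolAt f p) (hg : HolAt g p) :
    germ f hf = germ g hg ↔ ∀ᶠ x in 𝓝 p, f x = g x := by
  refine (Ideal.Quotient.eq (I := nullIdeal p) (x := ⟨f, hf⟩) (y := ⟨g, hg⟩)).trans ?_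
  change (∀ᶠ x in 𝓝 p, f x - g x = 0) ↔ _
  simp only [sub_eq_zero]

lemma exists_germ {p : X} (a : Stalk p) : ∃ (f : X → ℂ) (hf : HolAt f p), germ f hf = a := by
  obtain ⟨⟨f, hf⟩, rfl⟩ := Ideal.Quotient.mk_surjective a
  exact ⟨f, hf, rfl⟩

lemma HolAt.add {p : X} {f g : X → ℂ} (hf : HolAt f p) (hg : HolAt g p) : HolAt (f + g) p :=
  (holAlg p).add_mem hf hg

lemma HolAt.mul {p : X} {f g : X → ℂ} (hf : HolAt f p) (hg : HolAt g p) : HolAt (f * g) p :=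
  (holAlg p).mul_mem hf hg

lemma HolAt.smul {p : X} {f : X → ℂ} (c : ℂ) (hf : HolAt f p) : HolAt (c • f) p :=
  (holAlg p).smul_mem hf c

lemma HolAt.neg {p : X} {f : X → ℂ} (hf : HolAt f p) : HolAt (-f) p :=
  (holAlg p).neg_mem hf

lemma HolAt.zero {p : X} : HolAt (0 : X → ℂ) p := (holAlg p).zero_mem

lemma germ_add {p : X} {f g : X → ℂ} (hf : HolAt f p) (hg : HolAt g p) :
    germ f hf + germ g hg = germ (f + g) (hf.add hg) := rfl

lemma germ_mul {p : X} {f g : X → ℂ} (hf : HolAt f p) (hg : HolAt g p) :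
    germ f hf * germ g hg = germ (f * g) (hf.mul hg) := rfl

lemma germ_smul {p : X} {f : X → ℂ} (c : ℂ) (hf : HolAt f p) :
    c • germ f hf = germ (c • f) (hf.smul c) := rfl

lemma germ_neg {p : X} {f : X → ℂ} (hf : HolAt f p) :
    -germ f hf = germ (-f) hf.neg := rfl

lemma germ_zero {p : X} : (0 : Stalk p) = germ 0 HolAt.zero := rfl

/-- Evaluation of germs at `p`. -/
def evalAt (p : X) : Stalk p →ₐ[ℂ] ℂ :=
  Ideal.Quotient.liftₐ (nullIdeal p)
    ((Pi.evalAlgHom ℂ (fun _ : X => ℂ) p).comp (holAlg p).val)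
    (fun f hf => by
      have h : ∀ᶠ x in 𝓝 p, f.1 x = 0 := hf
      exact h.self_of_nhds)

lemma evalAt_germ {p : X} (f : X → ℂ) (hf : HolAt f p) : evalAt p (germ f hf) = f p := rfl

/-- The (holomorphic) cotangent space at `x`. -/
abbrev Cotangent (x : X) : Type := TangentSpace 𝓘(ℂ, C2) x →L[ℂ] ℂ

/-- The differential of a function at a point, as a covector. -/
def dAt (f : X → ℂ) (x : X) : Cotangent x := mfderiv 𝓘(ℂ, C2) 𝓘(ℂ, ℂ) f x

lemma dAt_congr {p : X} {f g : X → ℂ} (h : ∀ᶠ x in 𝓝 p, f x = g x) :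
    ∀ᶠ x in 𝓝 p, dAt f x = dAt g x := by
  filter_upwards [eventually_eventually_nhds.2 h] with x hx
  exact Filter.EventuallyEq.mfderiv_eq hx

lemma dAt_add {f g : X → ℂ} {x : X} (hf : MDifferentiableAt 𝓘(ℂ, C2) 𝓘(ℂ, ℂ) f x)
    (hg : MDifferentiableAt 𝓘(ℂ, C2) 𝓘(ℂ, ℂ) g x) : dAt (f + g) x = dAt f x + dAt g x :=
  mfderiv_add hf hg

lemma dAt_smul {f : X → ℂ} {x : X} (c : ℂ) (hf : MDifferentiableAt 𝓘(ℂ, C2) 𝓘(ℂ, ℂ) f x) :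
    dAt (c • f) x = c • dAt f x :=
  const_smul_mfderiv hf c

lemma dAt_mul {f g : X → ℂ} {x : X} (hf : MDifferentiableAt 𝓘(ℂ, C2) 𝓘(ℂ, ℂ) f x)
    (hg : MDifferentiableAt 𝓘(ℂ, C2) 𝓘(ℂ, ℂ) g x) :
    dAt (f * g) x = f x • dAt g x + g x • dAt f x :=
  (hf.hasMFDerivAt.mul hg.hasMFDerivAt).mfderiv

end Germs

/-! ## Poisson structures on complex surfaces -/

/-- A holomorphic Poisson structure on a complex surface: a holomorphic bivector field `π`, given
at each point as an alternating bilinear form on the cotangent space, whose bracket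
`{f, g} = π(df, dg)` on locally defined holomorphic functions satisfies the Jacobi identity. -/
structure PoissonStructure (X : Type*) [TopologicalSpace X] [ChartedSpace C2 X] where
  /-- the bivector at a point -/
  bivector : ∀ x : X, Cotangent x →ₗ[ℂ] Cotangent x →ₗ[ℂ] ℂ
  alternating : ∀ (x : X) (α : Cotangent x), bivector x α α = 0
  holomorphic : ∀ (p : X) (f g : X → ℂ), HolAt f p → HolAt g p →
    HolAt (fun x => bivector x (dAt f x) (dAt g x)) p
  jacobi : ∀ (p : X) (f g h : X → ℂ), HolAt f p → HolAt g p → HolAt h p →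
    bivector p (dAt f p) (dAt (fun x => bivector x (dAt g x) (dAt h x)) p) +
    bivector p (dAt g p) (dAt (fun x => bivector x (dAt h x) (dAt f x)) p) +
    bivector p (dAt h p) (dAt (fun x => bivector x (dAt f x) (dAt g x)) p) = 0

namespace PoissonStructure

variable {X : Type*} [TopologicalSpace X] [ChartedSpace C2 X] (π : PoissonStructure X)

/-- The Poisson bracket `{f, g} = π(df, dg)` of two (locally defined) functions. -/
def bracket (f g : X → ℂ) : X → ℂ := fun x => π.bivector x (dAt f x) (dAt g x)

lemma holAt_bracket {p : X} {f g : X → ℂ} (hf : HolAt f p) (hg : HolAt g p) :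
    HolAt (π.bracket f g) p :=
  π.holomorphic p f g hf hg

/-- The Poisson bracket of two germs, computed on representatives. -/
def germBracket {p : X} (a b : Stalk p) : Stalk p :=
  germ (π.bracket (exists_germ a).choose (exists_germ b).choose)
    (π.holAt_bracket (exists_germ a).choose_spec.choose (exists_germ b).choose_spec.choose)

lemma germBracket_germ {p : X} {f g : X → ℂ} (hf : HolAt f p) (hg : HolAt g p) :
    π.germBracket (germ f hf) (germ g hg) = germ (π.bracket f g) (π.holAt_bracket hf hg) := by
  have h1 := (germ_eq_iff _ _).1 (exists_germ (germ f hf)).choose_spec.choose_spec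
  have h2 := (germ_eq_iff _ _).1 (exists_germ (germ g hg)).choose_spec.choose_spec
  refine (germ_eq_iff _ _).2 ?_
  filter_upwards [dAt_congr h1, dAt_congr h2] with x hx hy
  simp only [bracket, hx, hy]

lemma germBracket_add_right {p : X} (a b c : Stalk p) :
    π.germBracket a (b + c) = π.germBracket a b + π.germBracket a c := by
  obtain ⟨f, hf, rfl⟩ := exists_germ a
  obtain ⟨g, hg, rfl⟩ := exists_germ b
  obtain ⟨h, hh, rfl⟩ := exists_germ c
  rw [germ_add, germBracket_germ, germBracket_germ, germBracket_germ, germ_add, germ_eq_iff]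
  filter_upwards [hg, hh] with x hx hy
  simp only [bracket, Pi.add_apply]
  rw [dAt_add hx hy, map_add]

lemma germBracket_smul_right {p : X} (t : ℂ) (a b : Stalk p) :
    π.germBracket a (t • b) = t • π.germBracket a b := by
  obtain ⟨f, hf, rfl⟩ := exists_germ a
  obtain ⟨g, hg, rfl⟩ := exists_germ b
  rw [germ_smul, germBracket_germ, germBracket_germ, germ_smul, germ_eq_iff]
  filter_upwards [hg] with x hx
  simp only [bracket, Pi.smul_apply]
  rw [dAt_smul t hx, map_smul]

lemma germBracket_mul_right {p : X} (a b c : Stalk p) :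
    π.germBracket a (b * c) = b * π.germBracket a c + c * π.germBracket a b := by
  obtain ⟨f, hf, rfl⟩ := exists_germ a
  obtain ⟨g, hg, rfl⟩ := exists_germ b
  obtain ⟨h, hh, rfl⟩ := exists_germ c
  rw [germ_mul, germBracket_germ, germBracket_germ, germBracket_germ, germ_mul, germ_mul,
    germ_add, germ_eq_iff]
  filter_upwards [hg, hh] with x hx hy
  simp only [bracket, Pi.add_apply, Pi.mul_apply]
  rw [dAt_mul hx hy, map_add, map_smul, map_smul, smul_eq_mul, smul_eq_mul]

lemma germBracket_self {p : X} (a : Stalk p) : π.germBracket a a = 0 := by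
  obtain ⟨f, hf, rfl⟩ := exists_germ a
  rw [germBracket_germ, germ_zero, germ_eq_iff]
  exact Filter.Eventually.of_forall fun x => π.alternating x _

lemma germBracket_skew {p : X} (a b : Stalk p) : π.germBracket a b = -π.germBracket b a := by
  obtain ⟨f, hf, rfl⟩ := exists_germ a
  obtain ⟨g, hg, rfl⟩ := exists_germ b
  rw [germBracket_germ, germBracket_germ, germ_neg, germ_eq_iff]
  refine Filter.Eventually.of_forall fun x => ?_
  have h := π.alternating x (dAt f x + dAt g x)
  simp only [map_add, LinearMap.add_apply, π.alternating] at h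
  simp only [bracket, Pi.neg_apply]
  linear_combination h

/-- The Hamiltonian derivation `b ↦ {a, b}` of `𝒪_p`. -/
def germAd {p : X} (a : Stalk p) : Vec (Stalk p) :=
  Derivation.mk'
    { toFun := fun b => π.germBracket a b
      map_add' := π.germBracket_add_right a
      map_smul' := fun t b => π.germBracket_smul_right t a b }
    (fun b c => π.germBracket_mul_right a b c)

/-- The germ at `p` of the bivector field `π`: the biderivation `(a, b) ↦ {a, b}` of `𝒪_p`. -/
def germAt (p : X) : Bivec (Stalk p) :=
  ⟨Derivation.mk'
    { toFun := fun a => π.germAd a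
      map_add' := by
        intro a b
        ext c
        change π.germBracket (a + b) c = π.germBracket a c + π.germBracket b c
        rw [π.germBracket_skew, π.germBracket_add_right, π.germBracket_skew a c,
          π.germBracket_skew b c]
        ring
      map_smul' := by
        intro t a
        ext c
        change π.germBracket (t • a) c = t • π.germBracket a c
        rw [π.germBracket_skew, π.germBracket_smul_right, π.germBracket_skew a c, smul_neg] }
    (by
      intro a b
      ext c
      change π.germBracket (a * b) c = a * π.germBracket b c + b * π.germBracket a c
      rw [π.germBracket_skew, π.germBracket_mul_right, π.germBracket_skew a c,
        π.germBracket_skew b c]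
      ring), fun a => π.germBracket_self a⟩

lemma germAt_germ {p : X} {f g : X → ℂ} (hf : HolAt f p) (hg : HolAt g p) :
    (π.germAt p).1 (germ f hf) (germ g hg) = germ (π.bracket f g) (π.holAt_bracket hf hg) :=
  π.germBracket_germ hf hg

/-- The characteristic variety of `(X, π)`, a subset of the cotangent bundle of `X`: the union of
the characteristic varieties of the cohomology modules of the complex of right `D`-modules attached
to the Lichnerowicz complex. It is computed on stalks; a covector `ξ` at `p` is represented as
the differential at `p` of a germ `g` with `g(p) = 0`. -/
def charVariety : Set (Σ x : X, Cotangent x) :=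
  {v | ∃ (g : X → ℂ) (hg : HolAt g v.1), g v.1 = 0 ∧ dAt g v.1 = v.2 ∧
    (InChar (evalAt v.1) (germ g hg) (H0 (π.germAt v.1)) ∨
     InChar (evalAt v.1) (germ g hg) (H1 (π.germAt v.1)) ∨
     InChar (evalAt v.1) (germ g hg) (H2 (π.germAt v.1)))}

end PoissonStructure

/-! ## Lagrangian subvarieties of the cotangent bundle -/

/-- The cotangent bundle of `C2`, the model of the cotangent bundle of a surface. -/
abbrev TstarC2 : Type := C2 × (C2 →L[ℂ] ℂ)

/-- The canonical symplectic form on the cotangent bundle of `C2`. -/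
def canonicalForm (u v : TstarC2) : ℂ := u.2 v.1 - v.2 u.1

/-- `S` is a closed analytic subset of the open set `Ω`. -/
def IsAnalyticSubset (Ω S : Set TstarC2) : Prop :=
  S ⊆ Ω ∧ ∀ x ∈ Ω, ∃ W : Set TstarC2, IsOpen W ∧ x ∈ W ∧ W ⊆ Ω ∧
    ∃ (r : ℕ) (h : Fin r → TstarC2 → ℂ), (∀ i, DifferentiableOn ℂ (h i) W) ∧
      ∀ y ∈ W, y ∈ S ↔ ∀ i, h i y = 0

/-- `x` is a regular point of `S` (near `x`, the set `S` is a complex submanifold, straightened by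
a local biholomorphism `Φ`) at which the tangent space is `T`. -/
def IsRegularPoint (S : Set TstarC2) (x : TstarC2) (T : Submodule ℂ TstarC2) : Prop :=
  x ∈ S ∧ ∃ (Φ : OpenPartialHomeomorph TstarC2 TstarC2) (T' : Submodule ℂ TstarC2),
    x ∈ Φ.source ∧ DifferentiableOn ℂ Φ Φ.source ∧ DifferentiableOn ℂ Φ.symm Φ.target ∧
    (∀ y ∈ Φ.source, y ∈ S ↔ Φ y ∈ T') ∧
    T = T'.comap (fderiv ℂ Φ x : TstarC2 →ₗ[ℂ] TstarC2)

/-- `S` is a Lagrangian subvariety of the open set `Ω`: a closed analytic subset whose tangent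
space at each regular point is Lagrangian, i.e. equal to its own symplectic orthogonal. -/
def IsLagrangianIn (Ω S : Set TstarC2) : Prop :=
  IsAnalyticSubset Ω S ∧ ∀ (x : TstarC2) (T : Submodule ℂ TstarC2), IsRegularPoint S x T →
    ∀ u : TstarC2, u ∈ T ↔ ∀ v ∈ T, canonicalForm u v = 0

section Surfaces

variable {X : Type*} [TopologicalSpace X] [ChartedSpace C2 X]

/-- The part of `S ⊆ T*X` over the domain of a chart `e`, in the coordinates on `T*X`
induced by `e`. -/
def inChart (S : Set (Σ x : X, Cotangent x)) (e : OpenPartialHomeomorph X C2) : Set TstarC2 :=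
  {v | v.1 ∈ e.target ∧
    (⟨e.symm v.1, v.2.comp (mfderiv 𝓘(ℂ, C2) 𝓘(ℂ, C2) e (e.symm v.1))⟩ :
      Σ x : X, Cotangent x) ∈ S}

/-- `S` is a Lagrangian subvariety of `T*X`. -/
def IsLagrangian (S : Set (Σ x : X, Cotangent x)) : Prop :=
  ∀ e ∈ atlas C2 X, IsLagrangianIn (e.target ×ˢ Set.univ) (inChart S e)

/-- A Poisson surface is holonomic if its characteristic variety is Lagrangian. -/
def PoissonStructure.IsHolonomic (π : PoissonStructure X) : Prop :=
  IsLagrangian π.charVariety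

/-- The ideal at `p` of the zero scheme `Y` of `π`: the ideal of `𝒪_p` generated by all
`π(df, dg) = {f, g}`, i.e. by the coefficient of `π` in a local frame of `Λ²T`. -/
def PoissonStructure.zeroIdeal (π : PoissonStructure X) (p : X) : Ideal (Stalk p) :=
  Ideal.span {c | ∃ a b : Stalk p, c = (π.germAt p).1 a b}

/-- The local ring `𝒪_{Y,p} = 𝒪_p / I` of the zero scheme `Y` of `π`. -/
abbrev PoissonStructure.ZeroStalk (π : PoissonStructure X) (p : X) : Type _ :=
  Stalk p ⧸ π.zeroIdeal p

/-- `π` is log symplectic: it is generically nondegenerate (nonzero on a dense set), so that its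
zero locus `Y` is empty or a curve, and the scheme `Y` is reduced. -/
def PoissonStructure.IsLogSymplectic (π : PoissonStructure X) : Prop :=
  Dense {x : X | π.bivector x ≠ 0} ∧ ∀ p : X, IsReduced (π.ZeroStalk p)

end Surfaces

end PoissonSurface

end

noncomputable section

namespace PoissonSurface

/-! ## The order filtration on differential operators -/

section Order

variable {R : Type*} [CommRing R] [Algebra ℂ R]
variable {M : Type*} [AddCommGroup M] [Module ℂ M] [Module R M] [IsScalarTower ℂ R M]
variable {N : Type*} [AddCommGroup N] [Module ℂ N] [Module R N] [IsScalarTower ℂ R N]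
variable {L : Type*} [AddCommGroup L] [Module ℂ L] [Module R L] [IsScalarTower ℂ R L]

/-! In local coordinates `π = f ∂_w ∧ ∂_z`, and the complex becomes `D → D² → D` with maps `Q ↦ (f
∂_z Q, -f ∂_w Q)` and `(S, T) ↦ A S + B T`, where `A = f ∂_w - f_w` and `B = f ∂_z - f_z`. Its
degree two cohomology is the cyclic module `D / (A D + B D)`. The right ideal contains `A`, `B` and
`A ∂_z - B ∂_w = f_z ∂_w - f_w ∂_z`, with symbols `f ξ`, `f ζ` and `f_z ξ - f_w ζ`. Their common
zeros are the zero section together with, over the curve `f = 0`, the covectors `η` with `df ∧ η =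
0`.

Log symplectic implies holonomic. Let `f ≠ 0` with `𝒪/(f)` reduced. If `f` divides `a f_w` and `a
f_z`, repeated differentiation shows that `f` divides `a ∂_v^n f` for all `v` and `n`; one of these
derivatives is a unit, so `f` divides `a` (`isReducedAt_chart`). By McCoy's theorem `f_w - f_z X` is
then a nonzerodivisor modulo `f` (`IsReducedAt.dvd_poly`). This controls cancellation in `A S + B
T`: if the two highest possible symbols vanish, the leading part of `(S, T)` comes from the syzygy
`(f ∂_z, -f ∂_w)` (`IsReducedAt.exists_step`). Hence the cohomology in degrees zero and one
vanishes, and the three symbols above cut out the characteristic variety exactly. It is isotropic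
because a tangent vector at a regular point on which the Liouville form is nonzero would project to
an immersed curve along which `f` and `df` both vanish, so that `f` would have a square factor
(`liouville_eq_zero`). It is coisotropic because explicit curves inside it supply enough tangent
vectors. Neither dimension theory nor a stratification enters.

Holonomic implies log symplectic. If `f` vanishes near a point, the degree zero cohomology is `D`
and the characteristic variety contains an open set. If `f ≠ 0` is not reduced, take `a` with `f ∣
a²` and `f ∤ a`. By a Hartogs argument (`HolDvd.of_punctured`) the points near which `f ∤ a` are
never isolated. A derivative of `f` of minimal order not vanishing somewhere on this set yields a
smooth curve on which `f` and `df` vanish, and which near a generic point is the whole zero set of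
`f` (`exists_multiple_component`). Over that curve every covector is characteristic
(`inChar_H2_of_singular`), off it only zero covectors are. Away from the zero section the
characteristic variety is thus a hypersurface of dimension three, which is not Lagrangian. -/

/-- `OrdLT R n P`: the operator `P` has order less than `n`; for `n = 0` this means `P = 0`. -/
def OrdLT (R : Type*) [CommRing R] [Algebra ℂ R]
    {M : Type*} [AddCommGroup M] [Module ℂ M] [Module R M] [IsScalarTower ℂ R M]
    {N : Type*} [AddCommGroup N] [Module ℂ N] [Module R N] [IsScalarTower ℂ R N] :
    ℕ → (M →ₗ[ℂ] N) → Prop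
  | 0, P => P = 0
  | m + 1, P => HasOrder R m P

/-- The shift by one puts the zero operator at the bottom of the filtration, so the recursion on
commutators is uniform and covers order zero as well. -/
lemma ordLT_succ_iff {n : ℕ} {P : M →ₗ[ℂ] N} :
    OrdLT R (n + 1) P ↔ ∀ a : R, OrdLT R n (comm a P) := by
  cases n <;> exact Iff.rfl

lemma OrdLT.comm {n : ℕ} {P : M →ₗ[ℂ] N} (h : OrdLT R (n + 1) P) (a : R) :
    OrdLT R n (comm a P) := ordLT_succ_iff.1 h a

lemma comm_add (a : R) (P Q : M →ₗ[ℂ] N) : comm a (P + Q) = comm a P + comm a Q := by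
  ext; simp; abel

lemma comm_sub (a : R) (P Q : M →ₗ[ℂ] N) : comm a (P - Q) = comm a P - comm a Q := by
  ext; simp [smul_sub]; abel

lemma comm_comp (a : R) (P : N →ₗ[ℂ] L) (Q : M →ₗ[ℂ] N) :
    comm a (P ∘ₗ Q) = P ∘ₗ comm a Q + comm a P ∘ₗ Q := by
  ext; simp

lemma comm_comm (a b : R) (P : M →ₗ[ℂ] N) : comm a (comm b P) = comm b (comm a P) := by
  ext x
  simp only [comm_apply, smul_sub, smul_smul, mul_comm a b]
  abel

lemma ordLT_zero (n : ℕ) : OrdLT R n (0 : M →ₗ[ℂ] N) := by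
  cases n with
  | zero => rfl
  | succ n => exact hasOrder_zero n

lemma OrdLT.add {n : ℕ} {P Q : M →ₗ[ℂ] N} (hP : OrdLT R n P) (hQ : OrdLT R n Q) :
    OrdLT R n (P + Q) := by
  cases n with
  | zero => rw [OrdLT] at *; simp [hP, hQ]
  | succ n => exact HasOrder.add hP hQ

lemma OrdLT.neg {n : ℕ} {P : M →ₗ[ℂ] N} (hP : OrdLT R n P) : OrdLT R n (-P) := by
  cases n with
  | zero => rw [OrdLT] at *; simp [hP]
  | succ n =>
    rw [← neg_one_smul ℂ P]
    exact HasOrder.smul (-1) hP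

lemma OrdLT.sub {n : ℕ} {P Q : M →ₗ[ℂ] N} (hP : OrdLT R n P) (hQ : OrdLT R n Q) :
    OrdLT R n (P - Q) := by
  rw [sub_eq_add_neg]; exact hP.add hQ.neg

lemma OrdLT.mono {m n : ℕ} (hmn : m ≤ n) {P : M →ₗ[ℂ] N} (h : OrdLT R m P) : OrdLT R n P := by
  cases m with
  | zero => rw [OrdLT] at h; rw [h]; exact ordLT_zero n
  | succ m =>
    obtain ⟨k, rfl⟩ : ∃ k, n = k + 1 := ⟨n - 1, by omega⟩
    exact HasOrder.mono (by omega) h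

lemma OrdLT.comp_left {m n : ℕ} {P : N →ₗ[ℂ] L} {Q : M →ₗ[ℂ] N} (hP : HasOrder R m P)
    (hQ : OrdLT R n Q) : OrdLT R (m + n) (P ∘ₗ Q) := by
  cases n with
  | zero =>
    have h : Q = 0 := hQ
    rw [h, LinearMap.comp_zero]; exact ordLT_zero _
  | succ n => exact hP.comp hQ

lemma hasOrder_lsmul (a : R) : HasOrder R 0 (Algebra.lsmul ℂ ℂ M a) := by
  intro b; ext x; simp [smul_smul, mul_comm]

/-- Multiplication of the values of an operator by a function. -/
def smulOp (a : R) (P : R →ₗ[ℂ] R) : R →ₗ[ℂ] R := Algebra.lsmul ℂ ℂ R a ∘ₗ P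

@[simp] lemma smulOp_apply (a : R) (P : R →ₗ[ℂ] R) (x : R) : smulOp a P x = a * P x := rfl

lemma comm_smulOp (a b : R) (P : R →ₗ[ℂ] R) : comm a (smulOp b P) = smulOp b (comm a P) := by
  ext x; simp; ring

lemma OrdLT.smulOp {n : ℕ} {P : R →ₗ[ℂ] R} (a : R) (hP : OrdLT R n P) :
    OrdLT R n (smulOp a P) := by
  have := OrdLT.comp_left (hasOrder_lsmul a) hP
  rwa [zero_add] at this

lemma hasOrder_derivation (δ : Derivation ℂ R R) :
    HasOrder R 1 (δ : R →ₗ[ℂ] R) := by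
  intro a b
  ext x
  simp only [comm_apply, Derivation.coeFn_coe, smul_eq_mul, Derivation.leibniz,
    LinearMap.zero_apply]
  ring

lemma HasOrder.apply_eq {P : R →ₗ[ℂ] R} (h : HasOrder R 0 P) (x : R) : P x = x * P 1 := by
  have := LinearMap.congr_fun (h x) 1
  simp only [comm_apply, smul_eq_mul, mul_one, LinearMap.zero_apply] at this
  linear_combination this

/-- The commutator of operators of orders `m` and `n` has order less than `m + n`. -/
lemma HasOrder.commutator {m n : ℕ} {P Q : R →ₗ[ℂ] R} (hP : HasOrder R m P)
    (hQ : HasOrder R n Q) : OrdLT R (m + n) (P ∘ₗ Q - Q ∘ₗ P) := by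
  induction hs : m + n generalizing m n P Q with
  | zero =>
    obtain ⟨rfl, rfl⟩ : m = 0 ∧ n = 0 := by omega
    ext x
    simp only [LinearMap.sub_apply, LinearMap.comp_apply, LinearMap.zero_apply]
    rw [hP.apply_eq (Q x), hQ.apply_eq (P x), hP.apply_eq x, hQ.apply_eq x]
    ring
  | succ s ih =>
    refine ordLT_succ_iff.2 fun a => ?_
    have e : PoissonSurface.comm a (P ∘ₗ Q - Q ∘ₗ P) =
        (P ∘ₗ PoissonSurface.comm a Q - PoissonSurface.comm a Q ∘ₗ P) +
        (PoissonSurface.comm a P ∘ₗ Q - Q ∘ₗ PoissonSurface.comm a P) := by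
      rw [comm_sub, comm_comp, comm_comp]; abel
    rw [e]
    refine OrdLT.add ?_ ?_
    · cases n with
      | zero => rw [hQ a, LinearMap.comp_zero, LinearMap.zero_comp, sub_zero]; exact ordLT_zero s
      | succ n => exact ih hP (hQ a) (by omega)
    · cases m with
      | zero => rw [hP a, LinearMap.comp_zero, LinearMap.zero_comp, sub_zero]; exact ordLT_zero s
      | succ m => exact ih (hP a) hQ (by omega)

/-! ### Symbols at a covector -/

/-- The value at `dg(p)` of the symbol of degree `n` of `P`. -/
def symVal (ev : R →ₐ[ℂ] ℂ) (g : R) (n : ℕ) (P : R →ₗ[ℂ] R) : ℂ :=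
  ev (P (g ^ n)) / (n.factorial : ℂ)

lemma symVal_add (ev : R →ₐ[ℂ] ℂ) (g : R) (n : ℕ) (P Q : R →ₗ[ℂ] R) :
    symVal ev g n (P + Q) = symVal ev g n P + symVal ev g n Q := by
  simp [symVal, add_div]

/-- At `p` the term `g P(g^n)` dies, because `g(p) = 0`. This is Euler's formula in the direction
`dg(p)`, with the commutator in the role of the directional derivative of the symbol. -/
lemma symVal_succ {ev : R →ₐ[ℂ] ℂ} {g : R} (hg : ev g = 0) (n : ℕ) (P : R →ₗ[ℂ] R) :
    ((n : ℂ) + 1) * symVal ev g (n + 1) P = symVal ev g n (comm g P) := by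
  have h1 : ((n : ℂ) + 1) ≠ 0 := Nat.cast_add_one_ne_zero n
  have h2 : (n.factorial : ℂ) ≠ 0 := by exact_mod_cast n.factorial_ne_zero
  simp only [symVal, comm_apply, smul_eq_mul, map_sub, map_mul, hg, zero_mul, sub_zero,
    pow_succ', Nat.factorial_succ]
  push_cast
  field_simp

lemma OrdLT.symVal_eq_zero {ev : R →ₐ[ℂ] ℂ} {g : R} (hg : ev g = 0) {n : ℕ} {P : R →ₗ[ℂ] R}
    (h : OrdLT R n P) : symVal ev g n P = 0 := by
  induction n generalizing P with
  | zero => have h' : P = 0 := h; simp [symVal, h']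
  | succ n ih =>
    have := symVal_succ hg n P
    rw [ih (h.comm g)] at this
    exact (mul_eq_zero.1 this).resolve_left (Nat.cast_add_one_ne_zero n)

lemma symVal_comp {ev : R →ₐ[ℂ] ℂ} {g : R} (hg : ev g = 0) {m n : ℕ} {P Q : R →ₗ[ℂ] R}
    (hP : HasOrder R m P) (hQ : HasOrder R n Q) :
    symVal ev g (m + n) (P ∘ₗ Q) = symVal ev g m P * symVal ev g n Q := by
  induction hs : m + n generalizing m n P Q with
  | zero =>
    obtain ⟨rfl, rfl⟩ : m = 0 ∧ n = 0 := by omega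
    simp only [symVal, pow_zero, LinearMap.comp_apply, Nat.factorial_zero, Nat.cast_one, div_one]
    rw [hP.apply_eq (Q 1), map_mul, mul_comm]
  | succ s ih =>
    have hs1 : ((s : ℂ) + 1) ≠ 0 := Nat.cast_add_one_ne_zero s
    have hmn : ((s : ℂ) + 1) = m + n := by exact_mod_cast hs.symm
    apply mul_left_cancel₀ hs1
    rw [symVal_succ hg, comm_comp, symVal_add]
    -- The two terms of the Leibniz rule contribute the product of symbols with weights `n` and `m`,
    -- which add up to `s + 1`.
    have e1 : symVal ev g s (P ∘ₗ comm g Q) = n * (symVal ev g m P * symVal ev g n Q) := by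
      cases n with
      | zero => rw [hQ g, LinearMap.comp_zero]; simp [symVal]
      | succ n =>
        rw [ih hP (hQ g) (by omega), ← symVal_succ hg]; push_cast; ring
    have e2 : symVal ev g s (comm g P ∘ₗ Q) = m * (symVal ev g m P * symVal ev g n Q) := by
      cases m with
      | zero => rw [hP g, LinearMap.zero_comp]; simp [symVal]
      | succ m =>
        rw [ih (hP g) hQ (by omega), ← symVal_succ hg]; push_cast; ring
    rw [e1, e2, hmn]; ring

end Order

/-! ## Local coordinates and total symbols -/

/-- Local coordinates on a `ℂ`-algebra `R` (the local ring of a surface): two functions with dual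
derivations, such that a derivation is determined by its values on the coordinates. -/
structure LocalCoords (R : Type*) [CommRing R] [Algebra ℂ R] where
  /-- the first coordinate -/
  w : R
  /-- the second coordinate -/
  z : R
  /-- the first coordinate derivation -/
  dw : Derivation ℂ R R
  /-- the second coordinate derivation -/
  dz : Derivation ℂ R R
  dw_w : dw w = 1
  dw_z : dw z = 0
  dz_w : dz w = 0
  dz_z : dz z = 1
  rigid : ∀ δ : Derivation ℂ R R, δ w = 0 → δ z = 0 → δ = 0

namespace LocalCoords

open Polynomial

variable {R : Type*} [CommRing R] [Algebra ℂ R] (c : LocalCoords R)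

/-- The first coordinate derivation, as a linear map. -/
def Dw : R →ₗ[ℂ] R := c.dw

/-- The second coordinate derivation, as a linear map. -/
def Dz : R →ₗ[ℂ] R := c.dz

@[simp] lemma Dw_apply (x : R) : c.Dw x = c.dw x := rfl
@[simp] lemma Dz_apply (x : R) : c.Dz x = c.dz x := rfl

lemma hasOrder_Dw : HasOrder R 1 c.Dw := hasOrder_derivation c.dw
lemma hasOrder_Dz : HasOrder R 1 c.Dz := hasOrder_derivation c.dz

lemma derivation_eq (δ : Derivation ℂ R R) : δ = δ c.w • c.dw + δ c.z • c.dz := by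
  rw [← sub_eq_zero]
  apply c.rigid <;> simp [c.dw_w, c.dw_z, c.dz_w, c.dz_z]

lemma dw_dz (x : R) : c.dw (c.dz x) = c.dz (c.dw x) := by
  have h : ⁅c.dw, c.dz⁆ = 0 := by
    apply c.rigid <;> simp [Derivation.commutator_apply, c.dw_w, c.dw_z, c.dz_w, c.dz_z]
  have := Derivation.congr_fun h x
  rw [Derivation.commutator_apply] at this
  simpa [sub_eq_zero] using this

lemma comm_w_Dw (S : R →ₗ[ℂ] R) : comm c.w (c.Dw ∘ₗ S) = c.Dw ∘ₗ comm c.w S + S := by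
  ext x; simp [c.dw_w]; ring

lemma comm_z_Dw (S : R →ₗ[ℂ] R) : comm c.z (c.Dw ∘ₗ S) = c.Dw ∘ₗ comm c.z S := by
  ext x; simp [c.dw_z]

lemma comm_w_Dz (S : R →ₗ[ℂ] R) : comm c.w (c.Dz ∘ₗ S) = c.Dz ∘ₗ comm c.w S := by
  ext x; simp [c.dz_w]

lemma comm_z_Dz (S : R →ₗ[ℂ] R) : comm c.z (c.Dz ∘ₗ S) = c.Dz ∘ₗ comm c.z S + S := by
  ext x; simp [c.dz_z]; ring

/-- For `P` of order at most one, `a ↦ [P, a](1)` is a derivation. It vanishes on both coordinates,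
hence is zero by rigidity. -/
lemma hasOrder_zero_of_comm {P : R →ₗ[ℂ] R} (h : HasOrder R 1 P) (hw : comm c.w P = 0)
    (hz : comm c.z P = 0) : HasOrder R 0 P := by
  let δ : Derivation ℂ R R := Derivation.mk'
    { toFun := fun a => comm a P 1
      map_add' := by intro a b; simp [add_mul]; ring
      map_smul' := by intro t a; simp [smul_sub] }
    (by
      intro a b
      have h1 := HasOrder.apply_eq (h a) b
      simp only [LinearMap.coe_mk, AddHom.coe_mk, comm_apply, smul_eq_mul, mul_one] at h1 ⊢
      linear_combination h1)
  have hδ : δ = 0 := c.rigid δ (LinearMap.congr_fun hw 1) (LinearMap.congr_fun hz 1)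
  intro a
  ext x
  rw [HasOrder.apply_eq (h a) x]
  have : comm a P 1 = 0 := Derivation.congr_fun hδ a
  rw [this]; simp

/-- Commutators with different functions commute, so the hypotheses pass to every `comm a P` and the
case of order one propagates upwards. -/
lemma ordLT_of_comm {n : ℕ} {P : R →ₗ[ℂ] R} (h : OrdLT R (n + 2) P)
    (hw : OrdLT R n (comm c.w P)) (hz : OrdLT R n (comm c.z P)) : OrdLT R (n + 1) P := by
  induction n generalizing P with
  | zero => exact c.hasOrder_zero_of_comm h hw hz
  | succ n ih =>
    refine ordLT_succ_iff.2 fun a => ih (h.comm a) ?_ ?_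
    · rw [comm_comm]; exact hw.comm a
    · rw [comm_comm]; exact hz.comm a

/-- The symbol of degree `n` of an operator, as a polynomial in the first fibre coordinate (the
second fibre coordinate being set to `1`). -/
def sym : ℕ → (R →ₗ[ℂ] R) → R[X]
  | 0, P => C (P 1)
  | n + 1, P => ((n : ℂ) + 1)⁻¹ • (X * sym n (comm c.w P) + sym n (comm c.z P))

/-- Euler's formula for a form of degree `n + 1` in `ξ, ζ`: commutators with `w` and `z` act on
symbols as `∂/∂ξ` and `∂/∂ζ`; here `ξ = X` and `ζ = 1`. -/
lemma succ_smul_sym (n : ℕ) (P : R →ₗ[ℂ] R) : ((n : ℂ) + 1) • c.sym (n + 1) P =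
    X * c.sym n (comm c.w P) + c.sym n (comm c.z P) := by
  rw [sym, smul_smul, mul_inv_cancel₀ (Nat.cast_add_one_ne_zero n), one_smul]

lemma sym_add (n : ℕ) (P Q : R →ₗ[ℂ] R) : c.sym n (P + Q) = c.sym n P + c.sym n Q := by
  induction n generalizing P Q with
  | zero => simp [sym]
  | succ n ih => rw [sym, sym, sym, comm_add, comm_add, ih, ih, ← smul_add]; congr 1; ring

lemma sym_smulOp (n : ℕ) (a : R) (P : R →ₗ[ℂ] R) :
    c.sym n (smulOp a P) = C a * c.sym n P := by
  induction n generalizing P with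
  | zero => simp [sym]
  | succ n ih =>
    rw [sym, sym, comm_smulOp, comm_smulOp, ih, ih, mul_smul_comm]; congr 1; ring

lemma sym_sub (n : ℕ) (P Q : R →ₗ[ℂ] R) : c.sym n (P - Q) = c.sym n P - c.sym n Q := by
  have h : P - Q = P + smulOp (-1 : R) Q := by ext; simp [sub_eq_add_neg]
  rw [h, sym_add, sym_smulOp]; simp [sub_eq_add_neg]

lemma sym_eq_zero {n : ℕ} {P : R →ₗ[ℂ] R} (h : OrdLT R n P) : c.sym n P = 0 := by
  induction n generalizing P with
  | zero => have h' : P = 0 := h; simp [sym, h']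
  | succ n ih => rw [sym, ih (h.comm _), ih (h.comm _)]; simp

lemma natDegree_sym_le (n : ℕ) (P : R →ₗ[ℂ] R) : (c.sym n P).natDegree ≤ n := by
  induction n generalizing P with
  | zero => simp [sym]
  | succ n ih =>
    rw [sym]
    refine (natDegree_smul_le _ _).trans (natDegree_add_le_of_degree_le ?_ ?_)
    · refine natDegree_mul_le.trans ?_
      have := ih (comm c.w P)
      have := natDegree_X_le (R := R)
      omega
    · exact (ih _).trans (Nat.le_succ n)

/-- This lets the symbol of `comm c.w P` be read off from that of `P`; Euler's formula then gives
the symbol of `comm c.z P`. -/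
lemma derivative_sym (n : ℕ) (P : R →ₗ[ℂ] R) :
    derivative (c.sym (n + 1) P) = c.sym n (comm c.w P) := by
  induction n generalizing P with
  | zero => simp [sym]
  | succ n ih =>
    have h0 : ((n : ℂ) + 1 + 1) ≠ 0 := by exact_mod_cast Nat.succ_ne_zero (n + 1)
    apply smul_right_injective _ h0
    have h := congrArg derivative (c.succ_smul_sym (n + 1) P)
    push_cast at h
    rw [derivative_smul, derivative_add, derivative_mul, derivative_X, ih, ih,
      comm_comm c.w c.z] at h
    have h2 := c.succ_smul_sym n (comm c.w P)
    simp only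
    rw [h, add_smul _ (1 : ℂ), h2, one_smul]
    ring

/-- Faithfulness of symbols: together with `sym_eq_zero` it says that the order drops exactly when
the symbol vanishes. If the symbol is zero, so are its partial derivatives, and induction applies to
both commutators. -/
lemma ordLT_of_sym_eq_zero {n : ℕ} {P : R →ₗ[ℂ] R} (h : OrdLT R (n + 1) P)
    (hs : c.sym n P = 0) : OrdLT R n P := by
  induction n generalizing P with
  | zero =>
    have h1 : P 1 = 0 := by simpa [sym] using hs
    ext x
    rw [HasOrder.apply_eq h x, h1]; simp
  | succ n ih =>
    have hw : c.sym n (comm c.w P) = 0 := by rw [← derivative_sym, hs]; simp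
    have hz : c.sym n (comm c.z P) = 0 := by
      have := c.succ_smul_sym n P
      rw [hs, hw] at this
      simpa using this.symm
    exact c.ordLT_of_comm h (ih (h.comm _) hw) (ih (h.comm _) hz)

/-- The symbol of `∂_w` is `ξ`. The extra summand `S` in the commutator of `w` with `∂_w ∘ S` raises
the Euler factor from `n + 1` to `n + 2`. -/
lemma sym_Dw_comp {n : ℕ} {S : R →ₗ[ℂ] R} (h : OrdLT R (n + 1) S) :
    c.sym (n + 1) (c.Dw ∘ₗ S) = X * c.sym n S := by
  have h0 : ((n : ℂ) + 1) ≠ 0 := Nat.cast_add_one_ne_zero n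
  apply smul_right_injective _ h0
  simp only
  rw [succ_smul_sym, comm_w_Dw, comm_z_Dw, sym_add]
  induction n generalizing S with
  | zero =>
    have h1 : ∀ a, comm a S = 0 := h
    rw [h1, h1]
    simp [sym]
  | succ n ih =>
    have e (a : R) : c.sym (n + 1) (c.Dw ∘ₗ comm a S) = X * c.sym n (comm a S) := by
      have := ih (h.comm a) (Nat.cast_add_one_ne_zero n)
      rw [← sym_add, ← comm_w_Dw, ← comm_z_Dw, ← succ_smul_sym] at this
      exact smul_right_injective _ (Nat.cast_add_one_ne_zero n : ((n : ℂ) + 1) ≠ 0) this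
    rw [e, e]
    have h2 := c.succ_smul_sym n S
    push_cast
    rw [add_smul _ (1 : ℂ), one_smul, ← mul_smul_comm, h2]
    ring

/-- The symbol of `∂_z` is `ζ = 1`: composing with `∂_z` raises the degree of the form without
changing the dehomogenized polynomial. -/
lemma sym_Dz_comp {n : ℕ} {S : R →ₗ[ℂ] R} (h : OrdLT R (n + 1) S) :
    c.sym (n + 1) (c.Dz ∘ₗ S) = c.sym n S := by
  have h0 : ((n : ℂ) + 1) ≠ 0 := Nat.cast_add_one_ne_zero n
  apply smul_right_injective _ h0
  simp only
  rw [succ_smul_sym, comm_w_Dz, comm_z_Dz, sym_add]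
  induction n generalizing S with
  | zero =>
    have h1 : ∀ a, comm a S = 0 := h
    rw [h1, h1]
    simp [sym]
  | succ n ih =>
    have e (a : R) : c.sym (n + 1) (c.Dz ∘ₗ comm a S) = c.sym n (comm a S) := by
      have := ih (h.comm a) (Nat.cast_add_one_ne_zero n)
      rw [← sym_add, ← comm_w_Dz, ← comm_z_Dz, ← succ_smul_sym] at this
      exact smul_right_injective _ (Nat.cast_add_one_ne_zero n : ((n : ℂ) + 1) ≠ 0) this
    rw [e, e]
    have h2 := c.succ_smul_sym n S
    push_cast
    rw [add_smul _ (1 : ℂ), one_smul, h2]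
    ring

lemma hasOrder_Dw_comp {n : ℕ} {S : R →ₗ[ℂ] R} (h : OrdLT R n S) :
    OrdLT R (n + 1) (c.Dw ∘ₗ S) := by
  rw [add_comm]; exact OrdLT.comp_left c.hasOrder_Dw h

lemma hasOrder_Dz_comp {n : ℕ} {S : R →ₗ[ℂ] R} (h : OrdLT R n S) :
    OrdLT R (n + 1) (c.Dz ∘ₗ S) := by
  rw [add_comm]; exact OrdLT.comp_left c.hasOrder_Dz h

/-- Every polynomial of degree at most `n` is the symbol of an operator of order at most `n`. -/
lemma exists_sym_eq {n : ℕ} {p : R[X]} (hp : p.natDegree ≤ n) :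
    ∃ S : R →ₗ[ℂ] R, HasOrder R n S ∧ c.sym n S = p := by
  induction n generalizing p with
  | zero =>
    refine ⟨Algebra.lsmul ℂ ℂ R (p.coeff 0), hasOrder_lsmul _, ?_⟩
    rw [eq_C_of_natDegree_le_zero hp]; simp [sym]
  | succ n ih =>
    -- Write `p = X · p.divX + p(0)`. The first summand is realized by `∂_w S`, and the constant,
    -- viewed in degree `n + 1`, by `∂_z T`.
    obtain ⟨S, hS, hS'⟩ := ih (p := p.divX) (by rw [natDegree_divX_eq_natDegree_tsub_one]; omega)
    obtain ⟨T, hT, hT'⟩ := ih (p := C (p.coeff 0)) (by simp)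
    refine ⟨c.Dw ∘ₗ S + c.Dz ∘ₗ T, (c.hasOrder_Dw_comp (n := n + 1) hS).add
      (c.hasOrder_Dz_comp (n := n + 1) hT), ?_⟩
    rw [sym_add, c.sym_Dw_comp hS, c.sym_Dz_comp hT, hS', hT', X_mul, divX_mul_X_add]

end LocalCoords

end PoissonSurface

end

noncomputable section

namespace PoissonSurface

/-! ## An upper bound for the characteristic variety of a cyclic module -/

section Cyclic

variable {R : Type*} [CommRing R] [Algebra ℂ R]

@[simp] lemma DRing.toLin_mul (P Q : DRing R) : (P * Q).toLin = P.toLin ∘ₗ Q.toLin := rfl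
@[simp] lemma DRing.toLin_sub (P Q : DRing R) : (P - Q).toLin = P.toLin - Q.toLin := rfl
@[simp] lemma DRing.toLin_one : (1 : DRing R).toLin = LinearMap.id := rfl

lemma zero_mem_orderFil (m : ℤ) : (0 : DRing R) ∈ orderFil R m := Or.inl rfl

lemma mem_orderFil_of_hasOrder {k : ℕ} {m : ℤ} {P : DRing R} (h : HasOrder R k P.toLin)
    (hk : (k : ℤ) ≤ m) : P ∈ orderFil R m := Or.inr ⟨k, hk, h⟩

lemma orderFil_mono {m n : ℤ} (h : m ≤ n) {P : DRing R} (hP : P ∈ orderFil R m) :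
    P ∈ orderFil R n := by
  rcases hP with hP | ⟨k, hk, hP⟩
  · exact Or.inl hP
  · exact Or.inr ⟨k, hk.trans h, hP⟩

lemma add_mem_orderFil {m : ℤ} {P Q : DRing R} (hP : P ∈ orderFil R m) (hQ : Q ∈ orderFil R m) :
    P + Q ∈ orderFil R m := by
  rcases hP with rfl | ⟨k, hk, hP⟩
  · rwa [zero_add]
  rcases hQ with rfl | ⟨l, hl, hQ⟩
  · rw [add_zero]; exact Or.inr ⟨k, hk, hP⟩
  · refine Or.inr ⟨max k l, by simp [hk, hl], ?_⟩
    exact (hP.mono (le_max_left _ _)).add (hQ.mono (le_max_right _ _))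

lemma sum_mem_orderFil {ι : Type*} (s : Finset ι) {m : ℤ} {P : ι → DRing R}
    (hP : ∀ i ∈ s, P i ∈ orderFil R m) : ∑ i ∈ s, P i ∈ orderFil R m := by
  classical
  induction s using Finset.induction_on with
  | empty => exact zero_mem_orderFil m
  | insert i s hi ih =>
    rw [Finset.sum_insert hi]
    exact add_mem_orderFil (hP i (Finset.mem_insert_self i s))
      (ih fun j hj => hP j (Finset.mem_insert_of_mem hj))

lemma mul_mem_orderFil {m n : ℤ} {P Q : DRing R} (hP : P ∈ orderFil R m)
    (hQ : Q ∈ orderFil R n) : P * Q ∈ orderFil R (m + n) := by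
  rcases hP with rfl | ⟨k, hk, hP⟩
  · rw [zero_mul]; exact zero_mem_orderFil _
  rcases hQ with rfl | ⟨l, hl, hQ⟩
  · rw [mul_zero]; exact zero_mem_orderFil _
  · exact Or.inr ⟨k + l, by push_cast; omega, hP.comp hQ⟩

lemma exists_mem_orderFil (P : DRing R) : ∃ m : ℤ, P ∈ orderFil R m := by
  obtain ⟨k, hk⟩ := P.2
  exact ⟨k, mem_orderFil_of_hasOrder hk le_rfl⟩

lemma hasOrder_pow {Q : DRing R} (hQ : HasOrder R 1 Q.toLin) (k : ℕ) :
    HasOrder R k (Q ^ k).toLin := by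
  induction k with
  | zero =>
    intro a; ext x; simp
  | succ k ih => rw [pow_succ]; exact ih.comp hQ

lemma symVal_pow {ev : R →ₐ[ℂ] ℂ} {g : R} (hg : ev g = 0) {Q : DRing R}
    (hQ : HasOrder R 1 Q.toLin) (k : ℕ) :
    symVal ev g k (Q ^ k).toLin = symVal ev g 1 Q.toLin ^ k := by
  induction k with
  | zero => simp [symVal]
  | succ k ih => rw [pow_succ, DRing.toLin_mul, symVal_comp hg (hasOrder_pow hQ k) hQ, ih, pow_succ]

variable {N : Type*} [AddCommGroup N] [Module (DRing R)ᵐᵒᵖ N]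

lemma op_smul_op_smul (P Q : DRing R) (x : N) :
    MulOpposite.op P • MulOpposite.op Q • x = MulOpposite.op (Q * P) • x := by
  rw [smul_smul, ← MulOpposite.op_mul]

lemma IsGoodFiltration.mono {F : ℤ → Set N} (hF : IsGoodFiltration (R := R) F) {i j : ℤ}
    (h : i ≤ j) : F i ⊆ F j := by
  obtain ⟨r, n, k, hn⟩ := hF.generated
  intro x hx
  obtain ⟨P, hP, rfl⟩ := (hn i x).1 hx
  exact (hn j _).2 ⟨P, fun a => orderFil_mono (by omega) (hP a), rfl⟩

lemma IsGoodFiltration.smul_mem {F : ℤ → Set N} (hF : IsGoodFiltration (R := R) F) {i j : ℤ}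
    {x : N} (hx : x ∈ F i) {P : DRing R} (hP : P ∈ orderFil R j) :
    MulOpposite.op P • x ∈ F (i + j) := by
  obtain ⟨r, n, k, hn⟩ := hF.generated
  obtain ⟨Q, hQ, rfl⟩ := (hn i x).1 hx
  refine (hn _ _).2 ⟨fun a => Q a * P, fun a => ?_, ?_⟩
  · exact orderFil_mono (by omega) (mul_mem_orderFil (hQ a) hP)
  · rw [Finset.smul_sum]
    exact Finset.sum_congr rfl fun a _ => op_smul_op_smul _ _ _

/-- If an operator `Q` of order one annihilates a generator of `N`, then the characteristic
variety of `N` is contained in the zero set of the symbol of `Q`. -/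
theorem not_inChar_of_smul_eq_zero {ev : R →ₐ[ℂ] ℂ} {g : R} (hg : ev g = 0) {u : N}
    (hu : ∀ x : N, ∃ P : DRing R, x = MulOpposite.op P • u) {Q : DRing R}
    (hQ : HasOrder R 1 Q.toLin) (hQu : MulOpposite.op Q • u = 0)
    (hQg : symVal ev g 1 Q.toLin ≠ 0) : ¬ InChar ev g N := by
  rintro ⟨F, hF, j, x, hx, hann⟩
  obtain ⟨r, n, k, hn⟩ := hF.generated
  choose p hp using fun i => hu (n i)
  choose d hd using fun i => exists_mem_orderFil (p i)
  -- The shift `a` bounds `F` by the filtration `u · F_j D` coming from the generator, and `b` below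
  -- bounds the latter by `F`.
  obtain ⟨a, ha⟩ : ∃ a : ℤ, ∀ i, d i - k i ≤ a := by
    obtain ⟨a, ha⟩ := Finite.exists_le fun i => d i - k i
    exact ⟨a, ha⟩
  obtain ⟨b, hb⟩ := hF.exhaustive u
  have hG : ∃ P ∈ orderFil R (j + a), x = MulOpposite.op P • u := by
    obtain ⟨T, hT, rfl⟩ := (hn j x).1 hx
    refine ⟨∑ i, p i * T i, sum_mem_orderFil _ fun i _ => orderFil_mono ?_
      (mul_mem_orderFil (hd i) (hT i)), ?_⟩
    · have := ha i; omega
    · rw [Finset.op_sum, Finset.sum_smul]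
      refine Finset.sum_congr rfl fun i _ => ?_
      rw [← op_smul_op_smul, ← hp i]
  -- Since `u · Q = 0`, one has `u · P Q = u · [P, Q]`, and `[P, Q]` has order no larger than `P`.
  -- So `Q` preserves the filtration induced by `u` instead of raising it by one.
  have hQs (l : ℕ) : ∃ P ∈ orderFil R (j + a), MulOpposite.op (Q ^ l) • x =
      MulOpposite.op P • u := by
    induction l with
    | zero => simpa using hG
    | succ l ih =>
      obtain ⟨P, hP, h⟩ := ih
      refine ⟨P * Q - Q * P, ?_, ?_⟩
      · rcases hP with rfl | ⟨m, hm, hP⟩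
        · simpa using zero_mem_orderFil _
        · exact mem_orderFil_of_hasOrder (k := m) (HasOrder.commutator hP hQ) hm
      · rw [pow_succ, ← op_smul_op_smul, h, op_smul_op_smul, MulOpposite.op_sub, sub_smul,
          ← op_smul_op_smul P Q, hQu, smul_zero, sub_zero]
  -- For such `l` the element `x · Q^l` lies in `F (j + a + b)`, hence in `F (j + l - 1)`. Thus the
  -- power of the symbol of `Q` annihilates the class of `x`.
  obtain ⟨l, hl⟩ : ∃ l : ℕ, a + b + 1 ≤ l := ⟨(a + b + 1).toNat, Int.self_le_toNat _⟩
  obtain ⟨P, hP, h⟩ := hQs l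
  have h1 : MulOpposite.op (Q ^ l) • x ∈ F (j + l - 1) := by
    rw [h]
    exact hF.mono (by omega) (hF.smul_mem hb hP)
  have h2 := hann l (Q ^ l) (hasOrder_pow hQ l) h1
  have h3 : symVal ev g l (Q ^ l).toLin = 0 := h2
  rw [symVal_pow hg hQ] at h3
  exact pow_ne_zero l hQg h3

/-- The identity operator annihilates everything, and its symbol is the constant `1`. -/
lemma not_inChar_of_subsingleton [Subsingleton N] (ev : R →ₐ[ℂ] ℂ) (g : R) :
    ¬ InChar ev g N := by
  rintro ⟨F, hF, j, x, hx, hann⟩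
  have hone : HasOrder R 0 (1 : DRing R).toLin := by intro a; ext; simp
  have h := hann 0 1 hone (by
    obtain ⟨r, n, k, hn⟩ := hF.generated
    exact (hn _ _).2 ⟨0, fun i => zero_mem_orderFil _, Subsingleton.elim _ _⟩)
  simp [symbolAt] at h

/-- The filtration of a cyclic module induced by the order filtration is good. -/
lemma isGoodFiltration_cyclic {u : N} (hu : ∀ x : N, ∃ P : DRing R, x = MulOpposite.op P • u) :
    IsGoodFiltration (R := R) fun j => {x : N | ∃ P ∈ orderFil R j, x = MulOpposite.op P • u} where
  exhaustive x := by
    obtain ⟨P, hP⟩ := hu x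
    obtain ⟨m, hm⟩ := exists_mem_orderFil P
    exact ⟨m, P, hm, hP⟩
  generated := by
    refine ⟨1, fun _ => u, fun _ => 0, fun j x => ⟨?_, ?_⟩⟩
    · rintro ⟨P, hP, rfl⟩
      exact ⟨fun _ => P, fun _ => by simpa using hP, by simp⟩
    · rintro ⟨P, hP, rfl⟩
      exact ⟨P 0, by simpa using hP 0, by simp⟩

/-- A covector lies in the characteristic variety of a cyclic module if the symbols of the
annihilating operators vanish there. -/
lemma inChar_of_cyclic {ev : R →ₐ[ℂ] ℂ} {g : R} (hg : ev g = 0) {u : N}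
    (hu : ∀ x : N, ∃ P : DRing R, x = MulOpposite.op P • u)
    (h : ∀ (m : ℕ) (P : DRing R), HasOrder R m P.toLin → MulOpposite.op P • u = 0 →
      symVal ev g m P.toLin = 0) : InChar ev g N := by
  refine ⟨_, isGoodFiltration_cyclic hu, 0, u, ⟨1, ?_, by simp⟩, ?_⟩
  · exact mem_orderFil_of_hasOrder (k := 0) (by intro a; ext; simp) le_rfl
  -- If `u · P` drops in the filtration, then `u · P = u · S` with `S` of order less than `m`. The
  -- operator `P - S` has the same symbol as `P` and kills `u`.
  · rintro m P hP ⟨S, hS, hPS⟩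
    have hS' : OrdLT R m S.toLin := by
      rcases hS with rfl | ⟨k, hk, hS⟩
      · exact ordLT_zero m
      · exact OrdLT.mono (m := k + 1) (by omega) hS
    have h1 := h m (P - S) (OrdLT.sub (n := m + 1) hP (hS'.mono (Nat.le_succ m))) (by
      rw [MulOpposite.op_sub, sub_smul, hPS, sub_self])
    have h2 := symVal_add ev g m (P - S).toLin S.toLin
    rw [h1, hS'.symVal_eq_zero hg, DRing.toLin_sub, sub_add_cancel, add_zero] at h2
    exact h2

end Cyclic

/-! ## The Lichnerowicz complex in local coordinates -/

namespace LocalCoords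

open Polynomial

variable {R : Type*} [CommRing R] [Algebra ℂ R] (c : LocalCoords R)

/-- The operator `f ∂_w - f_w`. -/
def opA (f : R) : R →ₗ[ℂ] R := smulOp f c.Dw - smulOp (c.dw f) LinearMap.id

/-- The operator `f ∂_z - f_z`. -/
def opB (f : R) : R →ₗ[ℂ] R := smulOp f c.Dz - smulOp (c.dz f) LinearMap.id

lemma opA_apply (f x : R) : c.opA f x = f * c.dw x - c.dw f * x := rfl
lemma opB_apply (f x : R) : c.opB f x = f * c.dz x - c.dz f * x := rfl

/-- The differential `(S, T) ↦ (f ∂_w - f_w) S + (f ∂_z - f_z) T`. -/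
def opAB (f : R) (S T : R →ₗ[ℂ] R) : R →ₗ[ℂ] R := c.opA f ∘ₗ S + c.opB f ∘ₗ T

lemma opAB_apply (f : R) (S T : R →ₗ[ℂ] R) (x : R) : c.opAB f S T x =
    (f * c.dw (S x) - c.dw f * S x) + (f * c.dz (T x) - c.dz f * T x) := rfl

lemma hasOrder_id : HasOrder R 0 (LinearMap.id : R →ₗ[ℂ] R) := by intro a; ext; simp

lemma hasOrder_opA (f : R) : HasOrder R 1 (c.opA f) :=
  OrdLT.sub (n := 2) (OrdLT.smulOp f c.hasOrder_Dw)
    (OrdLT.smulOp _ (hasOrder_id.mono zero_le_one))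

lemma hasOrder_opB (f : R) : HasOrder R 1 (c.opB f) :=
  OrdLT.sub (n := 2) (OrdLT.smulOp f c.hasOrder_Dz)
    (OrdLT.smulOp _ (hasOrder_id.mono zero_le_one))

lemma opAB_eq (f : R) (S T : R →ₗ[ℂ] R) : c.opAB f S T =
    smulOp f (c.Dw ∘ₗ S) + smulOp f (c.Dz ∘ₗ T) -
      (smulOp (c.dw f) S + smulOp (c.dz f) T) := by
  ext x; simp [opAB_apply]; ring

lemma sym_opAB {f : R} {n : ℕ} {S T : R →ₗ[ℂ] R} (hS : OrdLT R (n + 1) S)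
    (hT : OrdLT R (n + 1) T) :
    c.sym (n + 1) (c.opAB f S T) = C f * (X * c.sym n S + c.sym n T) := by
  rw [opAB_eq, sym_sub, sym_add, sym_smulOp, sym_smulOp, c.sym_Dw_comp hS, c.sym_Dz_comp hT,
    c.sym_eq_zero ((hS.smulOp (c.dw f)).add (hT.smulOp (c.dz f)))]
  ring

lemma opAB_sub (f : R) (S T S' T' : R →ₗ[ℂ] R) :
    c.opAB f (S - S') (T - T') = c.opAB f S T - c.opAB f S' T' := by
  ext x; simp [opAB_apply]; ring

/-- Both `A f ∂_z` and `B f ∂_w` equal `f² ∂_w ∂_z`. This is the identity `d_π² = 0` in coordinates.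
-/
lemma opAB_syzygy (f : R) (Q : R →ₗ[ℂ] R) :
    c.opAB f (smulOp f (c.Dz ∘ₗ Q)) (-smulOp f (c.Dw ∘ₗ Q)) = 0 := by
  ext x
  simp only [opAB_apply, smulOp_apply, LinearMap.comp_apply, Dw_apply, Dz_apply,
    LinearMap.neg_apply, map_neg, Derivation.leibniz, smul_eq_mul, c.dw_dz, LinearMap.zero_apply]
  ring

/-- The second order terms cancel and, up to sign, the Hamiltonian field of `f` for `∂_w ∧ ∂_z`
remains. It gives the third conormal equation. -/
lemma opAB_hamiltonian (f : R) (Q : R →ₗ[ℂ] R) :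
    c.opAB f (c.Dz ∘ₗ Q) (-(c.Dw ∘ₗ Q)) =
      smulOp (c.dz f) (c.Dw ∘ₗ Q) - smulOp (c.dw f) (c.Dz ∘ₗ Q) := by
  ext x
  simp only [opAB_apply, smulOp_apply, LinearMap.comp_apply, Dw_apply, Dz_apply,
    LinearMap.neg_apply, map_neg, c.dw_dz, LinearMap.sub_apply]
  ring

/-- If the leading term of `A S + B T` cancels, the leading terms of `S` and `T` come from a
common operator. -/
lemma exists_leading {f : R} (hf : ∀ a, f * a = 0 → a = 0) {n : ℕ} {S T : R →ₗ[ℂ] R}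
    (hS : OrdLT R (n + 1) S) (hT : OrdLT R (n + 1) T) (h : OrdLT R (n + 1) (c.opAB f S T)) :
    X * c.sym n S + c.sym n T = 0 ∧
    ∃ Q : R →ₗ[ℂ] R, OrdLT R n Q ∧ OrdLT R n (S - c.Dz ∘ₗ Q) ∧ OrdLT R n (T + c.Dw ∘ₗ Q) := by
  have h0 : X * c.sym n S + c.sym n T = 0 := by
    have h1 := c.sym_opAB (f := f) hS hT
    rw [c.sym_eq_zero h] at h1
    ext i
    have h2 := congrArg (fun p => p.coeff i) h1
    simp only [coeff_C_mul, coeff_zero] at h2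
    exact hf _ h2.symm
  refine ⟨h0, ?_⟩
  have hT0 : c.sym n T = -(X * c.sym n S) := by linear_combination h0
  cases n with
  | zero =>
    have hs : c.sym 0 S = 0 := by
      have h2 := c.natDegree_sym_le 0 T
      rw [hT0, natDegree_neg] at h2
      by_contra hne
      have : Nontrivial R := nontrivial_iff.1 ⟨_, _, hne⟩
      rw [natDegree_X_mul hne] at h2
      omega
    have hS0 : S = 0 := c.ordLT_of_sym_eq_zero hS hs
    have hT1 : T = 0 := c.ordLT_of_sym_eq_zero hT (by rw [hT0, hs]; simp)
    refine ⟨0, ordLT_zero 0, ?_, ?_⟩ <;> simp [hS0, hT1, ordLT_zero]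
  | succ k =>
    -- Here `X σ(S) = -σ(T)` has degree at most `k + 1`, so `σ(S)` loses a degree. As forms, `σ(S) =
    -- ζ q` and `σ(T) = -ξ q` for a form `q` of degree `k`, the symbol of `Q`.
    have hs : (c.sym (k + 1) S).natDegree ≤ k := by
      have h2 := c.natDegree_sym_le (k + 1) T
      rw [hT0, natDegree_neg] at h2
      by_cases hne : c.sym (k + 1) S = 0
      · rw [hne]; simp
      have : Nontrivial R := nontrivial_iff.1 ⟨_, _, hne⟩
      rw [natDegree_X_mul hne] at h2
      omega
    obtain ⟨Q, hQ, hQ'⟩ := c.exists_sym_eq hs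
    refine ⟨Q, hQ, c.ordLT_of_sym_eq_zero (hS.sub (c.hasOrder_Dz_comp (n := k + 1) hQ)) ?_,
      c.ordLT_of_sym_eq_zero (hT.add (c.hasOrder_Dw_comp (n := k + 1) hQ)) ?_⟩
    · rw [sym_sub, c.sym_Dz_comp hQ, hQ', sub_self]
    · rw [sym_add, c.sym_Dw_comp hQ, hQ', add_comm, h0]

/-! ### Cancellation of leading terms along a reduced curve -/

/-- The part of reducedness of the curve `f = 0` that is used: a function `a` such that `f`
divides `a df` is divisible by `f`. -/
structure IsReducedAt (f : R) : Prop where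
  regular : ∀ a, f * a = 0 → a = 0
  dvd : ∀ a, f ∣ c.dw f * a → f ∣ c.dz f * a → f ∣ a

variable {c}

/-- By McCoy's theorem a zero divisor in `(R/f)[X]` is killed by a nonzero constant `a`. Here `a`
would kill `f_w` and `f_z` modulo `f`, which reducedness excludes. -/
lemma IsReducedAt.dvd_poly {f : R} (hf : c.IsReducedAt f) {p : R[X]}
    (h : C f ∣ (C (c.dw f) - C (c.dz f) * X) * p) : C f ∣ p := by
  let I : Ideal R := Ideal.span {f}
  let q : R →+* R ⧸ I := Ideal.Quotient.mk I
  have hq (a : R) : q a = 0 ↔ f ∣ a := by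
    rw [Ideal.Quotient.eq_zero_iff_mem, Ideal.mem_span_singleton]
  have hdvd (r : R[X]) : C f ∣ r ↔ r.map q = 0 := by
    rw [C_dvd_iff_dvd_coeff, Polynomial.ext_iff]
    simp only [coeff_map, coeff_zero, hq]
  rw [hdvd, Polynomial.map_mul] at h
  rw [hdvd]
  have hreg : (C (c.dw f) - C (c.dz f) * X).map q ∈ nonZeroDivisors (R ⧸ I)[X] := by
    by_contra hcon
    obtain ⟨a, ha, h0⟩ := Polynomial.notMem_nonZeroDivisors_iff.1 hcon
    obtain ⟨a, rfl⟩ := Ideal.Quotient.mk_surjective a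
    apply ha
    refine (hq a).2 (hf.dvd a ?_ ?_)
    · have := congrArg (fun p => p.coeff 0) h0
      simp [smul_eq_mul] at this
      rw [← hq, map_mul, mul_comm]; exact this
    · have := congrArg (fun p => p.coeff 1) h0
      simp [smul_eq_mul, coeff_C] at this
      rw [← hq, map_mul, mul_comm]; exact this
  exact (mem_nonZeroDivisors_iff.1 hreg).1 _ h

/-- The leading terms of a pair `(S, T)` for which two leading terms of `A S + B T` cancel come
from the syzygy of `A` and `B`. -/
lemma IsReducedAt.exists_step {f : R} (hf : c.IsReducedAt f) {n : ℕ} {S T : R →ₗ[ℂ] R}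
    (hS : OrdLT R (n + 1) S) (hT : OrdLT R (n + 1) T) (h : OrdLT R n (c.opAB f S T)) :
    ∃ Q : R →ₗ[ℂ] R, OrdLT R n Q ∧ OrdLT R n (S - smulOp f (c.Dz ∘ₗ Q)) ∧
      OrdLT R n (T - -smulOp f (c.Dw ∘ₗ Q)) := by
  obtain ⟨h0, Q, hQ, hSQ, hTQ⟩ := c.exists_leading hf.regular hS hT (h.mono (Nat.le_succ n))
  cases n with
  | zero =>
    refine ⟨0, ordLT_zero 0, ?_, ?_⟩
    · rw [OrdLT] at *; subst hQ; rw [LinearMap.comp_zero, sub_zero] at hSQ; ext; simp [hSQ]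
    · rw [OrdLT] at *; subst hQ; rw [LinearMap.comp_zero, add_zero] at hTQ; ext; simp [hTQ]
  | succ k =>
    have hs : c.sym (k + 1) S = c.sym k Q := by
      have := c.sym_eq_zero hSQ
      rwa [sym_sub, c.sym_Dz_comp hQ, sub_eq_zero] at this
    -- Removing the common leading part `(∂_z Q, -∂_w Q)` costs only the Hamiltonian term, so the
    -- next symbol becomes computable.
    have e : c.opAB f S T = c.opAB f (S - c.Dz ∘ₗ Q) (T + c.Dw ∘ₗ Q) +
        (smulOp (c.dz f) (c.Dw ∘ₗ Q) - smulOp (c.dw f) (c.Dz ∘ₗ Q)) := by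
      rw [← opAB_hamiltonian, ← sub_neg_eq_add T, opAB_sub]; abel
    have h1 := c.sym_eq_zero h
    rw [e, sym_add, c.sym_opAB hSQ hTQ, c.sym_sub (k + 1), sym_smulOp, sym_smulOp, c.sym_Dw_comp hQ,
      c.sym_Dz_comp hQ] at h1
    -- The vanishing symbol of degree `k + 1` reads `f · (…) = (f_w - f_z X) σ(Q)`, so `f` divides
    -- `σ(Q)`. The quotient `p` is the symbol of the required multiple of the syzygy.
    obtain ⟨p, hp⟩ := hf.dvd_poly (p := c.sym k Q)
      ⟨X * c.sym k (S - c.Dz ∘ₗ Q) + c.sym k (T + c.Dw ∘ₗ Q), by linear_combination -h1⟩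
    have hpdeg : p.natDegree ≤ k := by
      -- As `f` is regular, division by `f` does not raise the degree in `X`.
      refine natDegree_le_iff_coeff_eq_zero.2 fun i hi => hf.regular _ ?_
      rw [← coeff_C_mul, ← hp]
      exact coeff_eq_zero_of_natDegree_lt ((c.natDegree_sym_le k Q).trans_lt hi)
    obtain ⟨Q', hQ', hQp⟩ := c.exists_sym_eq hpdeg
    refine ⟨Q', hQ', c.ordLT_of_sym_eq_zero
      (hS.sub ((c.hasOrder_Dz_comp (n := k + 1) hQ').smulOp f)) ?_,
      c.ordLT_of_sym_eq_zero
      (hT.sub ((c.hasOrder_Dw_comp (n := k + 1) hQ').smulOp f).neg) ?_⟩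
    · rw [sym_sub, sym_smulOp, c.sym_Dz_comp hQ', hQp, hs, hp, sub_self]
    · rw [sub_neg_eq_add, sym_add, sym_smulOp, c.sym_Dw_comp hQ', hQp]
      rw [hs, hp] at h0
      linear_combination h0

/-- The complex is exact in degree one along a reduced curve. -/
lemma IsReducedAt.exists_of_opAB_eq_zero {f : R} (hf : c.IsReducedAt f) {n : ℕ}
    {S T : R →ₗ[ℂ] R} (hS : OrdLT R n S) (hT : OrdLT R n T) (h : c.opAB f S T = 0) :
    ∃ Q : R →ₗ[ℂ] R, OrdLT R n Q ∧ S = smulOp f (c.Dz ∘ₗ Q) ∧ T = -smulOp f (c.Dw ∘ₗ Q) := by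
  induction n generalizing S T with
  | zero =>
    rw [OrdLT] at hS hT
    exact ⟨0, ordLT_zero 0, by ext; simp [hS], by ext; simp [hT]⟩
  | succ n ih =>
    obtain ⟨Q, hQ, hSQ, hTQ⟩ := hf.exists_step hS hT (by rw [h]; exact ordLT_zero n)
    obtain ⟨Q', hQ', h1, h2⟩ := ih hSQ hTQ (by rw [opAB_sub, opAB_syzygy, h, sub_zero])
    refine ⟨Q + Q', (hQ.add hQ').mono (Nat.le_succ n), ?_, ?_⟩
    · rw [sub_eq_iff_eq_add.1 h1]; ext x; simp; ring
    · rw [sub_eq_iff_eq_add.1 h2]; ext x; simp; ring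

/-- An element of the right ideal generated by `A` and `B` is a combination without cancellation
of more than one leading term. -/
lemma IsReducedAt.exists_ordLT {f : R} (hf : c.IsReducedAt f) {m n : ℕ}
    {S T : R →ₗ[ℂ] R} (hS : OrdLT R n S) (hT : OrdLT R n T) (h : OrdLT R m (c.opAB f S T)) :
    ∃ S' T' : R →ₗ[ℂ] R, OrdLT R m S' ∧ OrdLT R m T' ∧ c.opAB f S T = c.opAB f S' T' := by
  induction n generalizing S T with
  | zero => exact ⟨S, T, hS.mono (Nat.zero_le m), hT.mono (Nat.zero_le m), rfl⟩
  | succ n ih =>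
    by_cases hnm : n + 1 ≤ m
    · exact ⟨S, T, hS.mono hnm, hT.mono hnm, rfl⟩
    -- Here `m ≤ n`, so `A S + B T` loses both its symbols of degrees `n + 1` and `n`. Subtracting
    -- the syzygy lowers the order of `(S, T)` and leaves the combination unchanged.
    obtain ⟨Q, hQ, hSQ, hTQ⟩ := hf.exists_step hS hT (h.mono (by omega))
    have e := c.opAB_sub f S T (smulOp f (c.Dz ∘ₗ Q)) (-smulOp f (c.Dw ∘ₗ Q))
    rw [opAB_syzygy, sub_zero] at e
    rw [← e]
    exact ih hSQ hTQ (by rwa [e])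

variable (c)

/-- The covector `dg(p)` lies in the zero set of the symbols `f ξ`, `f ζ`, `f_w ζ - f_z ξ`. -/
def IsConormal (ev : R →ₐ[ℂ] ℂ) (f g : R) : Prop :=
  ev f * ev (c.dw g) = 0 ∧ ev f * ev (c.dz g) = 0 ∧
    ev (c.dw f) * ev (c.dz g) - ev (c.dz f) * ev (c.dw g) = 0

lemma symVal_opA (ev : R →ₐ[ℂ] ℂ) (f : R) {g : R} (hg : ev g = 0) :
    symVal ev g 1 (c.opA f) = ev f * ev (c.dw g) := by
  simp [symVal, opA_apply, hg]

lemma symVal_opB (ev : R →ₐ[ℂ] ℂ) (f : R) {g : R} (hg : ev g = 0) :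
    symVal ev g 1 (c.opB f) = ev f * ev (c.dz g) := by
  simp [symVal, opB_apply, hg]

variable {c}

/-- An element of order `m` of `A D + B D` can be written with `S'`, `T'` of order at most `m`, so a
single leading term cancels. It then equals `A S₁ + B T₁ + (f_z ∂_w - f_w ∂_z) Q`, and its symbol is
a combination of the three conormal equations. -/
lemma IsReducedAt.symVal_eq_zero {ev : R →ₐ[ℂ] ℂ} {f g : R} (hf : c.IsReducedAt f)
    (hg : ev g = 0) (h : c.IsConormal ev f g) {m n : ℕ} {S T : R →ₗ[ℂ] R}
    (hS : HasOrder R n S) (hT : HasOrder R n T) (hm : HasOrder R m (c.opAB f S T)) :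
    symVal ev g m (c.opAB f S T) = 0 := by
  obtain ⟨S', T', hS', hT', e⟩ := hf.exists_ordLT (m := m + 1) (n := n + 1) hS hT hm
  rw [e] at hm ⊢
  obtain ⟨-, Q, hQ, hSQ, hTQ⟩ := c.exists_leading hf.regular hS' hT' hm
  have e : c.opAB f S' T' = c.opAB f (S' - c.Dz ∘ₗ Q) (T' + c.Dw ∘ₗ Q) +
      (smulOp (c.dz f) (c.Dw ∘ₗ Q) - smulOp (c.dw f) (c.Dz ∘ₗ Q)) := by
    rw [← opAB_hamiltonian, ← sub_neg_eq_add T', opAB_sub]; abel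
  cases m with
  | zero =>
    rw [OrdLT] at hQ hSQ hTQ
    rw [e, hSQ, hTQ, hQ]
    simp [symVal, opAB_apply]
  | succ k =>
    obtain ⟨h1, h2, h3⟩ := h
    have hh : symVal ev g 1 (smulOp (c.dz f) c.Dw - smulOp (c.dw f) c.Dz) = 0 := by
      simp only [symVal, pow_one, LinearMap.sub_apply, smulOp_apply, Dw_apply, Dz_apply, map_sub,
        map_mul]
      simp; linear_combination -h3
    have hhord : HasOrder R 1 (smulOp (c.dz f) c.Dw - smulOp (c.dw f) c.Dz) :=
      OrdLT.sub (n := 2) (OrdLT.smulOp _ c.hasOrder_Dw) (OrdLT.smulOp _ c.hasOrder_Dz)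
    have e2 : smulOp (c.dz f) (c.Dw ∘ₗ Q) - smulOp (c.dw f) (c.Dz ∘ₗ Q) =
      (smulOp (c.dz f) c.Dw - smulOp (c.dw f) c.Dz) ∘ₗ Q := by ext; simp
    rw [e, e2, opAB, symVal_add, symVal_add, add_comm k 1, symVal_comp hg (c.hasOrder_opA f) hSQ,
      symVal_comp hg (c.hasOrder_opB f) hTQ, symVal_comp hg hhord hQ, symVal_opA _ _ _ hg,
      symVal_opB _ _ _ hg, h1, h2, hh]
    simp

end LocalCoords

end PoissonSurface

end

noncomputable section

namespace PoissonSurface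

namespace LocalCoords

variable {R : Type*} [CommRing R] [Algebra ℂ R] (c : LocalCoords R)

/-! ## The cohomology modules in local coordinates -/

lemma bivec_apply (B : Bivec R) (a b : R) :
    B.1 a b = B.1 c.w c.z * (c.dw a * c.dz b - c.dz a * c.dw b) := by
  have h1 (x y : R) : B.1 x y = B.1 x c.w * c.dw y + B.1 x c.z * c.dz y := by
    have := Derivation.congr_fun (c.derivation_eq (B.1 x)) y
    simpa using this
  have hw : B.1 c.w c.w = 0 := B.2 c.w
  have hz : B.1 c.z c.z = 0 := B.2 c.z
  rw [h1, B.skew a c.w, B.skew a c.z, h1 c.w a, h1 c.z a, hw, hz, B.skew c.z c.w]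
  ring

/-- The bivector field `∂_w ∧ ∂_z`. -/
def frame : Bivec R :=
  ⟨Derivation.mk'
    { toFun := fun a => c.dw a • c.dz - c.dz a • c.dw
      map_add' := by intro a b; ext x; simp; ring
      map_smul' := by intro t a; ext x; simp [smul_sub] }
    (by intro a b; ext x; simp; ring), fun a => by simp [mul_comm]⟩

lemma frame_apply (a b : R) : c.frame.1 a b = c.dw a * c.dz b - c.dz a * c.dw b := rfl

lemma bivec_eq (B : Bivec R) : B = B.1 c.w c.z • c.frame := by
  ext a b
  rw [Bivec.smul_val, Derivation.smul_apply, Derivation.smul_apply, frame_apply, smul_eq_mul]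
  exact c.bivec_apply B a b

/-- The operator `x ↦ x ∂_w ∧ ∂_z`. -/
def frameOp : DiffOps R (Bivec R) :=
  ⟨(LinearMap.toSpanSingleton R (Bivec R) c.frame).restrictScalars ℂ, 0, fun a => by
    ext x : 1
    simp [smul_smul]⟩

/-- The coefficient of a bivector field in the frame `∂_w ∧ ∂_z`. -/
def coeffBivec : Bivec R →ₗ[ℂ] R where
  toFun B := B.1 c.w c.z
  map_add' _ _ := rfl
  map_smul' _ _ := rfl

lemma hasOrder_coeffBivec : HasOrder R 0 c.coeffBivec := by
  intro a; ext B
  exact sub_self _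

/-- Evaluation of vector fields at a function. -/
def evalVec (a : R) : Vec R →ₗ[ℂ] R where
  toFun V := V a
  map_add' _ _ := rfl
  map_smul' _ _ := rfl

lemma hasOrder_evalVec (a : R) : HasOrder R 0 (evalVec a) := by
  intro b; ext V
  simp [evalVec]

/-- The operator with values in vector fields with given components. -/
def vecOp (S T : R →ₗ[ℂ] R) : R →ₗ[ℂ] Vec R where
  toFun x := S x • c.dw + T x • c.dz
  map_add' x y := by ext; simp; ring
  map_smul' t x := by ext; simp

lemma hasOrder_vecOp {n : ℕ} {S T : R →ₗ[ℂ] R} (hS : HasOrder R n S) (hT : HasOrder R n T) :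
    HasOrder R n (c.vecOp S T) := by
  have h (a : R) (S T : R →ₗ[ℂ] R) :
      comm a (c.vecOp S T) = c.vecOp (comm a S) (comm a T) := by
    ext x y; simp [vecOp]; ring
  induction n generalizing S T with
  | zero => intro a; rw [h, hS a, hT a]; ext; simp [vecOp]
  | succ n ih => intro a; rw [h]; exact ih (hS a) (hT a)

lemma lich0_w (B : Bivec R) (x : R) : lich0 B x c.w = B.1 c.w c.z * c.dz x := by
  rw [lich0_apply, c.bivec_apply, c.dw_w, c.dz_w]; ring

lemma lich0_z (B : Bivec R) (x : R) : lich0 B x c.z = -(B.1 c.w c.z * c.dw x) := by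
  rw [lich0_apply, c.bivec_apply, c.dw_z, c.dz_z]; ring

lemma lich1_coeff (B : Bivec R) (V : Vec R) : (lich1 B V).1 c.w c.z =
    (B.1 c.w c.z * c.dw (V c.w) - c.dw (B.1 c.w c.z) * V c.w) +
    (B.1 c.w c.z * c.dz (V c.z) - c.dz (B.1 c.w c.z) * V c.z) := by
  have h : (lich1 B V).1 c.w c.z =
    B.1 c.w (V c.z) + B.1 (V c.w) c.z - V (B.1 c.w c.z) := lich1Aux_apply B V _ _
  have hV := Derivation.congr_fun (c.derivation_eq V) (B.1 c.w c.z)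
  simp only [Derivation.add_apply, Derivation.smul_apply, smul_eq_mul] at hV
  rw [h, hV, c.bivec_apply B c.w (V c.z), c.bivec_apply B (V c.w) c.z, c.dw_w, c.dz_w, c.dw_z,
    c.dz_z]
  ring

lemma vec_ext {V W : Vec R} (hw : V c.w = W c.w) (hz : V c.z = W c.z) : V = W := by
  rw [c.derivation_eq V, c.derivation_eq W, hw, hz]

lemma DiffOps.ext {M : Type*} [AddCommGroup M] [Module ℂ M] [Module R M] [IsScalarTower ℂ R M]
    {φ ψ : DiffOps R M} (h : ∀ x, φ.toLin x = ψ.toLin x) : φ = ψ :=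
  Subtype.ext (LinearMap.ext h)

lemma frameOp_generates (φ : DiffOps R (Bivec R)) :
    ∃ P : DRing R, φ = MulOpposite.op P • c.frameOp := by
  obtain ⟨m, hm⟩ := φ.2
  refine ⟨⟨c.coeffBivec ∘ₗ φ.1, 0 + m, c.hasOrder_coeffBivec.comp hm⟩, DiffOps.ext fun x => ?_⟩
  exact c.bivec_eq _

/-- The class of `∂_w ∧ ∂_z` in the cohomology module of degree two. -/
def gen (B : Bivec R) : H2 B := Submodule.Quotient.mk c.frameOp

lemma gen_generates (B : Bivec R) (x : H2 B) : ∃ P : DRing R, x = MulOpposite.op P • c.gen B := by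
  obtain ⟨φ, rfl⟩ := Submodule.Quotient.mk_surjective _ x
  obtain ⟨P, rfl⟩ := c.frameOp_generates φ
  exact ⟨P, rfl⟩

/-- In the frame, the annihilator of the generator is the right ideal `A D + B D`; the components of
an operator into vector fields are its values on `w` and `z`. -/
lemma smul_gen_eq_zero_iff (B : Bivec R) (P : DRing R) : MulOpposite.op P • c.gen B = 0 ↔
    ∃ (n : ℕ) (S T : R →ₗ[ℂ] R), HasOrder R n S ∧ HasOrder R n T ∧
      P.toLin = c.opAB (B.1 c.w c.z) S T := by
  have h0 : MulOpposite.op P • c.gen B = 0 ↔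
      MulOpposite.op P • c.frameOp ∈ LinearMap.range (dM1 B) :=
    Submodule.Quotient.mk_eq_zero (LinearMap.range (dM1 B))
  rw [h0]
  constructor
  · rintro ⟨φ, hφ⟩
    obtain ⟨m, hm⟩ := φ.2
    refine ⟨0 + m, evalVec c.w ∘ₗ φ.1, evalVec c.z ∘ₗ φ.1, (hasOrder_evalVec _).comp hm,
      (hasOrder_evalVec _).comp hm, ?_⟩
    ext x
    have h1 : lich1 B (φ.1 x) = P.toLin x • c.frame :=
      LinearMap.congr_fun (congrArg DiffOps.toLin hφ) x
    have h2 := congrArg c.coeffBivec h1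
    have h3 : c.coeffBivec (P.toLin x • c.frame) = P.toLin x := by
      change P.toLin x * c.frame.1 c.w c.z = _
      rw [frame_apply, c.dw_w, c.dz_z, c.dw_z, c.dz_w]; ring
    rw [h3] at h2
    rw [← h2, opAB_apply]
    exact c.lich1_coeff B (φ.1 x)
  · rintro ⟨n, S, T, hS, hT, hP⟩
    refine ⟨⟨c.vecOp S T, n, c.hasOrder_vecOp hS hT⟩, DiffOps.ext fun x => ?_⟩
    change lich1 B (c.vecOp S T x) = P.toLin x • c.frame
    rw [c.bivec_eq (lich1 B _), lich1_coeff, hP, opAB_apply]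
    have hw : c.vecOp S T x c.w = S x := by simp [vecOp, c.dw_w, c.dz_w]
    have hz : c.vecOp S T x c.z = T x := by simp [vecOp, c.dw_z, c.dz_z]
    rw [hw, hz]

/-- The characteristic variety of the cohomology module of degree two is contained in the union
of the zero section, over the complement of the curve `f = 0`, and the conormal of the curve. -/
theorem isConormal_of_inChar_H2 {ev : R →ₐ[ℂ] ℂ} {g : R} (hg : ev g = 0) {B : Bivec R}
    (h : InChar ev g (H2 B)) : c.IsConormal ev (B.1 c.w c.z) g := by
  set f := B.1 c.w c.z with hf
  have key (Q : R →ₗ[ℂ] R) (hQ : HasOrder R 1 Q) {S T : R →ₗ[ℂ] R} {n : ℕ} (hS : HasOrder R n S)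
      (hT : HasOrder R n T) (e : Q = c.opAB f S T) : symVal ev g 1 Q = 0 := by
    by_contra hne
    exact not_inChar_of_smul_eq_zero hg (c.gen_generates B) (Q := ⟨Q, 1, hQ⟩) hQ
      ((c.smul_gen_eq_zero_iff B _).2 ⟨n, S, T, hS, hT, e⟩) hne h
  have h1 := key (c.opA f) (c.hasOrder_opA f) hasOrder_id (hasOrder_zero 0)
    (by ext x; simp [opAB])
  have h2 := key (c.opB f) (c.hasOrder_opB f) (hasOrder_zero 0) hasOrder_id
    (by ext x; simp [opAB])
  -- The third operator lies in the right ideal as `A ∂_z - B ∂_w`.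
  have h3 := key (smulOp (c.dz f) c.Dw - smulOp (c.dw f) c.Dz)
    (OrdLT.sub (n := 2) (OrdLT.smulOp _ c.hasOrder_Dw) (OrdLT.smulOp _ c.hasOrder_Dz))
    c.hasOrder_Dz (OrdLT.neg (n := 2) c.hasOrder_Dw)
    (c.opAB_hamiltonian f LinearMap.id).symm
  rw [c.symVal_opA _ _ hg] at h1
  rw [c.symVal_opB _ _ hg] at h2
  refine ⟨h1, h2, ?_⟩
  simp only [symVal, pow_one, LinearMap.sub_apply, smulOp_apply, Dw_apply, Dz_apply, map_sub,
    map_mul, Nat.factorial_one, Nat.cast_one, div_one] at h3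
  linear_combination -h3

/-- Reducedness makes the three conormal equations generate all symbols of the annihilator, so no
further condition cuts down the support. -/
theorem inChar_H2_of_isConormal {ev : R →ₐ[ℂ] ℂ} {g : R} (hg : ev g = 0) {B : Bivec R}
    (hf : c.IsReducedAt (B.1 c.w c.z)) (h : c.IsConormal ev (B.1 c.w c.z) g) :
    InChar ev g (H2 B) := by
  refine inChar_of_cyclic hg (c.gen_generates B) fun m P hP h0 => ?_
  obtain ⟨n, S, T, hS, hT, e⟩ := (c.smul_gen_eq_zero_iff B P).1 h0
  rw [e] at hP ⊢
  exact hf.symVal_eq_zero hg h hS hT hP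

/-- If `f` and `df` vanish at `p`, then `A S + B T` followed by evaluation at `p` is zero. All
symbols of the annihilator therefore vanish on the whole fibre over `p`; reducedness plays no role.
-/
theorem inChar_H2_of_singular {ev : R →ₐ[ℂ] ℂ} {g : R} (hg : ev g = 0) {B : Bivec R}
    (h : ev (B.1 c.w c.z) = 0) (hw : ev (c.dw (B.1 c.w c.z)) = 0)
    (hz : ev (c.dz (B.1 c.w c.z)) = 0) : InChar ev g (H2 B) := by
  refine inChar_of_cyclic hg (c.gen_generates B) fun m P hP h0 => ?_
  obtain ⟨n, S, T, hS, hT, e⟩ := (c.smul_gen_eq_zero_iff B P).1 h0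
  rw [e]
  simp [symVal, opAB_apply, h, hw, hz]

/-- A cocycle satisfies `∂_w ∘ φ = 0`, since `f` is regular. Its symbol is then killed by `X`, so
its order drops indefinitely and `φ = 0`. -/
theorem not_inChar_H0 (ev : R →ₐ[ℂ] ℂ) (g : R) {B : Bivec R}
    (hf : ∀ a, B.1 c.w c.z * a = 0 → a = 0) : ¬ InChar ev g (H0 B) := by
  have : Subsingleton (H0 B) := by
    refine subsingleton_of_forall_eq 0 fun ⟨φ, hφ⟩ => Subtype.ext (DiffOps.ext fun x => ?_)
    have h (x : R) : lich0 B (φ.toLin x) = 0 :=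
      LinearMap.congr_fun (congrArg DiffOps.toLin (LinearMap.mem_ker.1 hφ)) x
    have hw : c.Dw ∘ₗ φ.toLin = 0 := by
      ext x
      have := c.lich0_z B (φ.toLin x)
      rw [h] at this
      exact hf _ (neg_eq_zero.1 this.symm)
    obtain ⟨m, hm⟩ := φ.2
    have key : ∀ n, OrdLT R n φ.toLin → φ.toLin = 0 := by
      intro n
      induction n with
      | zero => exact id
      | succ n ih =>
        intro hn
        refine ih (c.ordLT_of_sym_eq_zero hn ?_)
        have h1 := c.sym_Dw_comp hn
        rw [hw, c.sym_eq_zero (ordLT_zero _)] at h1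
        ext i
        have := congrArg (fun p => p.coeff (i + 1)) h1
        simpa using this.symm
    exact LinearMap.congr_fun (key (m + 1) hm) x
  exact not_inChar_of_subsingleton ev g

/-- The components of a cocycle form a pair with `A S + B T = 0`; such a pair is a multiple of the
syzygy, which is the image of the first differential. -/
theorem not_inChar_H1 (ev : R →ₐ[ℂ] ℂ) (g : R) {B : Bivec R}
    (hf : c.IsReducedAt (B.1 c.w c.z)) : ¬ InChar ev g (H1 B) := by
  have : Subsingleton (H1 B) := by
    rw [Submodule.Quotient.subsingleton_iff, eq_top_iff]
    rintro ⟨φ, hφ⟩ -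
    obtain ⟨m, hm⟩ := φ.2
    have h (x : R) : lich1 B (φ.toLin x) = 0 :=
      LinearMap.congr_fun (congrArg DiffOps.toLin (LinearMap.mem_ker.1 hφ)) x
    have h0 : c.opAB (B.1 c.w c.z) (evalVec c.w ∘ₗ φ.toLin) (evalVec c.z ∘ₗ φ.toLin) = 0 := by
      ext x
      have h1 := c.lich1_coeff B (φ.toLin x)
      rw [h] at h1
      exact h1.symm
    obtain ⟨Q, hQ, hS, hT⟩ := hf.exists_of_opAB_eq_zero (n := 0 + m + 1)
      ((hasOrder_evalVec c.w).comp hm) ((hasOrder_evalVec c.z).comp hm) h0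
    refine ⟨⟨Q, 0 + m, hQ⟩, DiffOps.ext fun x => c.vec_ext ?_ ?_⟩
    · exact (c.lich0_w B _).trans (LinearMap.congr_fun hS x).symm
    · exact (c.lich0_z B _).trans (LinearMap.congr_fun hT x).symm
  exact not_inChar_of_subsingleton ev g

end LocalCoords

/-- For `π = 0` every operator is a cocycle, so the module is free on the identity and nothing
nonzero annihilates the generator. -/
theorem inChar_H0_of_eq_zero {R : Type*} [CommRing R] [Algebra ℂ R] {ev : R →ₐ[ℂ] ℂ} {g : R}
    (hg : ev g = 0) {B : Bivec R} (hB : B = 0) : InChar ev g (H0 B) := by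
  subst hB
  have h0 (φ : DiffOps R R) : φ ∈ LinearMap.ker (dM0 (0 : Bivec R)) := by
    refine LinearMap.mem_ker.2 (LocalCoords.DiffOps.ext fun x => ?_)
    ext a
    exact (lich0_apply (0 : Bivec R) _ _).trans (by simp; rfl)
  let u : H0 (0 : Bivec R) := ⟨⟨LinearMap.id, 0, LocalCoords.hasOrder_id⟩, h0 _⟩
  refine inChar_of_cyclic hg (u := u) ?_ ?_
  · rintro ⟨φ, hφ⟩
    exact ⟨⟨φ.1, φ.2⟩, rfl⟩
  · intro m P hP h
    have : P.toLin = 0 := by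
      have := congrArg (fun y => DiffOps.toLin (Subtype.val y)) h
      exact this
    simp [this, symVal]

end PoissonSurface

end

noncomputable section

namespace PoissonSurface

/-! ## Holomorphic functions of several variables -/

section Holomorphic

open Set Metric MeasureTheory intervalIntegral

variable {E : Type*} [NormedAddCommGroup E] [NormedSpace ℂ E] [FiniteDimensional ℂ E]
variable {F : Type*} [NormedAddCommGroup F] [NormedSpace ℂ F]

/-- An integral depending holomorphically on a parameter. -/
theorem differentiableOn_intervalIntegral {U : Set E} (hU : IsOpen U) {a b : ℝ} {K : E → ℝ → F}
    (hK : ContinuousOn (fun p : E × ℝ => K p.1 p.2) (U ×ˢ uIcc a b))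
    (hd : ∀ s ∈ uIcc a b, DifferentiableOn ℂ (fun x => K x s) U) :
    DifferentiableOn ℂ (fun x => ∫ s in a..b, K x s) U := by
  have : ProperSpace E := FiniteDimensional.proper ℂ E
  intro x₀ hx₀
  obtain ⟨r, hr, hrU⟩ : ∃ r > 0, closedBall x₀ (2 * r) ⊆ U := by
    obtain ⟨ε, hε, h⟩ := nhds_basis_closedBall.mem_iff.1 (hU.mem_nhds hx₀)
    exact ⟨ε / 2, by positivity, by rwa [mul_div_cancel₀ _ two_ne_zero]⟩
  have hsub : closedBall x₀ (2 * r) ×ˢ uIcc a b ⊆ U ×ˢ uIcc a b := prod_mono hrU subset_rfl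
  have hcpt : IsCompact (closedBall x₀ (2 * r) ×ˢ uIcc a b) :=
    (isCompact_closedBall _ _).prod isCompact_uIcc
  have hball {x : E} (hx : x ∈ ball x₀ r) : ball x r ⊆ closedBall x₀ (2 * r) := by
    intro y hy
    rw [mem_ball] at hx hy
    rw [mem_closedBall]
    have := dist_triangle y x x₀
    linarith
  obtain ⟨M, hM⟩ := hcpt.exists_bound_of_continuousOn (hK.mono hsub)
  have hcont {x : E} (hx : x ∈ U) : ContinuousOn (K x) (uIcc a b) :=
    hK.comp (f := fun s => (x, s)) (by fun_prop) fun s hs => ⟨hx, hs⟩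
  have hx₀' : x₀ ∈ ball x₀ r := mem_ball_self hr
  -- Continuity of the derivative in the parameter comes from the Cauchy estimate for `K(·, t) -
  -- K(·, s)`, which is uniformly small on the ball.
  have hfd : ContinuousOn (fun s => fderiv ℂ (fun x => K x s) x₀) (uIcc a b) := by
    have huc := hcpt.uniformContinuousOn_of_continuous (hK.mono hsub)
    rw [Metric.uniformContinuousOn_iff_le] at huc
    rw [Metric.continuousOn_iff]
    intro s hs ε hε
    obtain ⟨δ, hδ, h⟩ := huc (r * ε / 4) (by positivity)
    refine ⟨δ, hδ, fun t ht hts => ?_⟩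
    have hd' (s : ℝ) (hs : s ∈ uIcc a b) : DifferentiableOn ℂ (fun x => K x s) (ball x₀ r) :=
      (hd s hs).mono ((hball hx₀').trans hrU)
    have hda (s : ℝ) (hs : s ∈ uIcc a b) : DifferentiableAt ℂ (fun x => K x s) x₀ :=
      (hd' s hs).differentiableAt (ball_mem_nhds _ hr)
    have hbd (y : E) (hy : y ∈ ball x₀ r) : ‖K y t - K y s‖ ≤ r * ε / 4 := by
      rw [← dist_eq_norm]
      refine h (y, t) ⟨hball hx₀' hy, ht⟩ (y, s) ⟨hball hx₀' hy, hs⟩ ?_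
      rw [Prod.dist_eq]
      simpa using hts.le
    rw [dist_eq_norm, ← fderiv_fun_sub (hda t ht) (hda s hs)]
    refine lt_of_le_of_lt (Complex.norm_fderiv_le_div_of_mapsTo_ball (R₂ := r * ε / 2)
      ((hd' t ht).sub (hd' s hs)) ?_ hr) ?_
    · intro y hy
      rw [mem_closedBall, dist_eq_norm]
      refine (norm_sub_le _ _).trans ?_
      have h1 := hbd y hy
      have h2 := hbd x₀ hx₀'
      simp only
      linarith
    · rw [div_lt_iff₀ hr]; nlinarith
  refine (intervalIntegral.hasFDerivAt_integral_of_dominated_of_fderiv_le (μ := volume)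
    (F' := fun x s => fderiv ℂ (fun x => K x s) x) (bound := fun _ => 2 * M / r)
    (ball_mem_nhds x₀ hr) ?_ ?_ ?_ ?_ ?_ ?_).differentiableAt.differentiableWithinAt
  · filter_upwards [hU.mem_nhds hx₀] with x hx
    exact ((hcont hx).mono uIoc_subset_uIcc).aestronglyMeasurable measurableSet_uIoc
  · exact (hcont hx₀).intervalIntegrable
  · exact (hfd.mono uIoc_subset_uIcc).aestronglyMeasurable measurableSet_uIoc
  · refine Filter.Eventually.of_forall fun s hs x hx => ?_
    have hs' := uIoc_subset_uIcc hs
    refine Complex.norm_fderiv_le_div_of_mapsTo_ball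
      ((hd s hs').mono ((hball hx).trans hrU)) ?_ hr
    intro y hy
    rw [mem_closedBall, dist_eq_norm]
    refine (norm_sub_le _ _).trans ?_
    have h1 := hM (y, s) ⟨hball hx hy, hs'⟩
    have h2 := hM (x, s) ⟨hball hx (mem_ball_self hr), hs'⟩
    simp only at h1 h2
    linarith
  · exact intervalIntegrable_const
  · refine Filter.Eventually.of_forall fun s hs x hx => ?_
    exact ((hd s (uIoc_subset_uIcc hs)).differentiableAt
      (hU.mem_nhds (hrU (hball hx (mem_ball_self hr))))).hasFDerivAt

/-- A circle integral depending holomorphically on a parameter. -/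
theorem differentiableOn_circleIntegral {U : Set E} (hU : IsOpen U) {t₀ : ℂ} {r : ℝ}
    (hr : 0 ≤ r) {K : E → ℂ → F}
    (hK : ContinuousOn (fun p : E × ℂ => K p.1 p.2) (U ×ˢ sphere t₀ r))
    (hd : ∀ t ∈ sphere t₀ r, DifferentiableOn ℂ (fun x => K x t) U) :
    DifferentiableOn ℂ (fun x => ∮ t in C(t₀, r), K x t) U := by
  unfold circleIntegral
  refine differentiableOn_intervalIntegral hU ?_ fun s _ => ?_
  · refine ContinuousOn.smul ?_ (hK.comp (f := fun p : E × ℝ => (p.1, circleMap t₀ r p.2)) ?_ ?_)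
    · simp only [deriv_circleMap]; fun_prop
    · fun_prop
    · exact fun p hp => ⟨hp.1, circleMap_mem_sphere _ hr _⟩
  · exact (hd _ (circleMap_mem_sphere _ hr _)).const_smul _

variable [CompleteSpace F]

/-- The directional derivatives of a holomorphic function are holomorphic. -/
theorem DifferentiableOn.fderiv_apply {U : Set E} (hU : IsOpen U) {f : E → F}
    (hf : DifferentiableOn ℂ f U) (v : E) : DifferentiableOn ℂ (fun x => fderiv ℂ f x v) U := by
  intro x₀ hx₀
  obtain ⟨r, hr, V, hV, hxV, hVU⟩ : ∃ r > 0, ∃ V : Set E, IsOpen V ∧ x₀ ∈ V ∧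
      ∀ x ∈ V, ∀ t : ℂ, ‖t‖ ≤ r → x + t • v ∈ U := by
    have h1 : ∀ᶠ p : E × ℂ in 𝓝 (x₀, 0), p.1 + p.2 • v ∈ U := by
      have : ContinuousAt (fun p : E × ℂ => p.1 + p.2 • v) (x₀, 0) := by fun_prop
      exact this.eventually_mem (hU.mem_nhds (by simpa using hx₀))
    rw [nhds_prod_eq] at h1
    obtain ⟨V, hV, W, hW, h⟩ := Filter.eventually_prod_iff.1 h1
    obtain ⟨V', hV'V, hV', hxV'⟩ := _root_.mem_nhds_iff.1 hV
    obtain ⟨r, hr, hrW⟩ := nhds_basis_closedBall.mem_iff.1 hW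
    exact ⟨r, hr, V', hV', hxV', fun x hx t ht => h (hV'V hx) (hrW (by simpa using ht))⟩
  -- Cauchy's formula for the derivative at `0` of `t ↦ f (x + t v)` turns a directional derivative
  -- into an integral that depends holomorphically on `x`.
  have key : ∀ x ∈ V, fderiv ℂ f x v =
      (2 * Real.pi * Complex.I : ℂ)⁻¹ • ∮ t in C(0, r), (t - 0)⁻¹ ^ 2 • f (x + t • v) := by
    intro x hx
    have hg (t : ℂ) (ht : t ∈ closedBall (0 : ℂ) r) :
        DifferentiableAt ℂ (fun t : ℂ => f (x + t • v)) t := by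
      refine DifferentiableAt.comp t (hf.differentiableAt (hU.mem_nhds (hVU x hx t ?_)))
        (by fun_prop)
      simpa using ht
    have h0 : HasDerivAt (fun t : ℂ => f (x + t • v)) (fderiv ℂ f x v) 0 := by
      have h1 : HasFDerivAt f (fderiv ℂ f x) (x + (0 : ℂ) • v) := by
        rw [zero_smul, add_zero]
        have := hVU x hx 0 (by simpa using hr.le)
        exact (hf.differentiableAt (hU.mem_nhds (by simpa using this))).hasFDerivAt
      have h2 : HasDerivAt (fun t : ℂ => x + t • v) v 0 := by
        simpa using ((hasDerivAt_id (0 : ℂ)).smul_const v).const_add x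
      exact h1.comp_hasDerivAt 0 h2
    have hdc : DifferentiableOn ℂ (fun t : ℂ => f (x + t • v)) (closedBall 0 r) :=
      fun t ht => (hg t ht).differentiableWithinAt
    have h3 := Complex.two_pi_I_inv_smul_circleIntegral_sub_sq_inv_smul_of_differentiable
      (U := {t : ℂ | x + t • v ∈ U}) (c := 0) (R := r) (w₀ := 0) (E := F)
      (hU.preimage (by fun_prop)) (fun t ht => hVU x hx t (by simpa using ht))
      (f := fun t : ℂ => f (x + t • v))
      (fun t ht => ((hf.differentiableAt (hU.mem_nhds ht)).comp t
        (by fun_prop)).differentiableWithinAt) (mem_ball_self hr)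
    rw [h0.deriv] at h3
    rw [← h3]
    simp only [inv_pow]
  have hdiff : DifferentiableOn ℂ (fun x => (2 * Real.pi * Complex.I : ℂ)⁻¹ •
      ∮ t in C(0, r), (t - 0)⁻¹ ^ 2 • f (x + t • v)) V := by
    refine DifferentiableOn.const_smul (differentiableOn_circleIntegral hV hr.le ?_ ?_) _
    · refine ContinuousOn.smul ?_ ?_
      · refine ContinuousOn.pow (ContinuousOn.inv₀ (by fun_prop) ?_) 2
        rintro ⟨x, t⟩ ⟨-, ht⟩
        rw [sub_zero]
        exact ne_of_mem_sphere ht hr.ne'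
      · refine hf.continuousOn.comp (by fun_prop) ?_
        rintro ⟨x, t⟩ ⟨hx, ht⟩
        exact hVU x hx t (by rw [mem_sphere_zero_iff_norm.1 ht])
    · intro t ht
      refine DifferentiableOn.const_smul (hf.comp (by fun_prop) fun x hx => ?_) _
      exact hVU x hx t (by rw [mem_sphere_zero_iff_norm.1 ht])
  exact ((hdiff.congr key).differentiableAt (hV.mem_nhds hxV)).differentiableWithinAt

/-- Holomorphic functions of several variables are smooth. -/
theorem DifferentiableOn.contDiffOn_nat {U : Set E} (hU : IsOpen U) {f : E → F}
    (hf : DifferentiableOn ℂ f U) (n : ℕ) : ContDiffOn ℂ n f U := by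
  induction n generalizing f with
  | zero => exact contDiffOn_zero.2 hf.continuousOn
  | succ n ih =>
    have := contDiffOn_succ_iff_fderiv_apply (𝕜 := ℂ) (n := (n : WithTop ℕ∞)) (f := f)
      hU.uniqueDiffOn
    push_cast
    refine this.2 ⟨hf, by simp, fun v => ?_⟩
    refine (ih (DifferentiableOn.fderiv_apply hU hf v)).congr fun x hx => ?_
    rw [fderivWithin_of_isOpen hU hx]

end Holomorphic

end PoissonSurface

end

noncomputable section

namespace PoissonSurface

/-! ### Calculus of germs of holomorphic maps -/

section HolNear

open Set Metric Filter

variable {E : Type*} [NormedAddCommGroup E] [NormedSpace ℂ E]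
variable {F : Type*} [NormedAddCommGroup F] [NormedSpace ℂ F]
variable {G : Type*} [NormedAddCommGroup G] [NormedSpace ℂ G]

/-- `f` is holomorphic in a neighbourhood of `c`. -/
def HolNear (f : E → F) (c : E) : Prop := ∀ᶠ x in 𝓝 c, DifferentiableAt ℂ f x

lemma HolNear.eventually {f : E → F} {c : E} (h : HolNear f c) : ∀ᶠ x in 𝓝 c, HolNear f x :=
  eventually_eventually_nhds.2 h

lemma HolNear.differentiableAt {f : E → F} {c : E} (h : HolNear f c) : DifferentiableAt ℂ f c :=
  h.self_of_nhds

lemma HolNear.continuousAt {f : E → F} {c : E} (h : HolNear f c) : ContinuousAt f c :=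
  h.differentiableAt.continuousAt

lemma HolNear.congr {f g : E → F} {c : E} (h : HolNear f c) (hfg : f =ᶠ[𝓝 c] g) :
    HolNear g c := by
  filter_upwards [h, hfg.eventuallyEq_nhds] with x hx hx'
  exact hx.congr_of_eventuallyEq hx'.symm

lemma HolNear.exists_ball {f : E → F} {c : E} (h : HolNear f c) :
    ∃ r > 0, DifferentiableOn ℂ f (ball c r) := by
  obtain ⟨r, hr, h⟩ := Metric.eventually_nhds_iff_ball.1 h
  exact ⟨r, hr, fun x hx => (h x hx).differentiableWithinAt⟩

lemma holNear_of_differentiableOn {f : E → F} {U : Set E} (hU : IsOpen U)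
    (h : DifferentiableOn ℂ f U) {c : E} (hc : c ∈ U) : HolNear f c := by
  filter_upwards [hU.mem_nhds hc] with x hx
  exact h.differentiableAt (hU.mem_nhds hx)

lemma holNear_of_differentiable {f : E → F} (h : Differentiable ℂ f) (c : E) : HolNear f c :=
  Eventually.of_forall h

lemma holNear_const (a : F) (c : E) : HolNear (fun _ => a) c :=
  holNear_of_differentiable (by fun_prop) c

lemma HolNear.add {f g : E → F} {c : E} (hf : HolNear f c) (hg : HolNear g c) :
    HolNear (fun x => f x + g x) c := by
  filter_upwards [hf, hg] with x h1 h2 using h1.fun_add h2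

lemma HolNear.sub {f g : E → F} {c : E} (hf : HolNear f c) (hg : HolNear g c) :
    HolNear (fun x => f x - g x) c := by
  filter_upwards [hf, hg] with x h1 h2 using h1.fun_sub h2

lemma HolNear.mul {f g : E → ℂ} {c : E} (hf : HolNear f c) (hg : HolNear g c) :
    HolNear (fun x => f x * g x) c := by
  filter_upwards [hf, hg] with x h1 h2 using h1.fun_mul h2

lemma HolNear.pow {f : E → ℂ} {c : E} (hf : HolNear f c) (n : ℕ) :
    HolNear (fun x => f x ^ n) c := by
  filter_upwards [hf] with x h1 using h1.fun_pow n

lemma HolNear.div {f g : E → ℂ} {c : E} (hf : HolNear f c) (hg : HolNear g c) (h0 : g c ≠ 0) :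
    HolNear (fun x => f x / g x) c := by
  filter_upwards [hf, hg, hg.continuousAt.eventually_ne h0] with x h1 h2 h3
  fun_prop (disch := assumption)

lemma HolNear.comp {g : F → G} {f : E → F} {c : E} (hg : HolNear g (f c)) (hf : HolNear f c) :
    HolNear (fun x => g (f x)) c := by
  filter_upwards [hf, hf.continuousAt.eventually hg] with x h1 h2 using h2.fun_comp' x h1

lemma HolNear.comp_of_eq {g : F → G} {f : E → F} {c : E} {d : F} (hg : HolNear g d)
    (hf : HolNear f c) (h : f c = d) : HolNear (fun x => g (f x)) c :=
  HolNear.comp (h ▸ hg) hf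

lemma HolNear.fderiv_apply [FiniteDimensional ℂ E] [CompleteSpace F] {f : E → F} {c : E}
    (hf : HolNear f c) (v : E) : HolNear (fun x => fderiv ℂ f x v) c := by
  obtain ⟨r, hr, h⟩ := hf.exists_ball
  exact holNear_of_differentiableOn isOpen_ball (DifferentiableOn.fderiv_apply isOpen_ball h v)
    (mem_ball_self hr)

lemma HolNear.contDiffAt [FiniteDimensional ℂ E] [CompleteSpace F] {f : E → F} {c : E}
    (hf : HolNear f c) (n : ℕ) : ContDiffAt ℂ n f c := by
  obtain ⟨r, hr, h⟩ := hf.exists_ball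
  exact (DifferentiableOn.contDiffOn_nat isOpen_ball h n).contDiffAt (ball_mem_nhds c hr)

lemma HolNear.analyticAt [CompleteSpace F] {f : ℂ → F} {c : ℂ} (hf : HolNear f c) :
    AnalyticAt ℂ f c :=
  Complex.analyticAt_iff_eventually_differentiableAt.2 hf

lemma HolNear.continuousAt_fderiv [FiniteDimensional ℂ E] [CompleteSpace F] {f : E → F} {c : E}
    (hf : HolNear f c) : ContinuousAt (fderiv ℂ f) c :=
  ((hf.contDiffAt 1).fderiv_right (m := 0) (by norm_num)).continuousAt

/-! ### The identity theorem -/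

lemma differentiableOn_line {f : E → ℂ} {U : Set E} (hf : DifferentiableOn ℂ f U) (x v : E) :
    DifferentiableOn ℂ (fun t : ℂ => f (x + t • v)) {t : ℂ | x + t • v ∈ U} :=
  hf.comp (by fun_prop) fun _ ht => ht

/-- The parameters `t` with `x + t v` in the ball form a convex, hence connected, set containing `0`
and `1`, so the identity theorem in one variable applies. -/
lemma eq_zero_of_line {f : E → ℂ} {c : E} {r : ℝ} (hf : DifferentiableOn ℂ f (ball c r))
    {x v : E} (hx : x ∈ ball c r) (hxv : x + v ∈ ball c r)
    (h : ∀ᶠ t : ℂ in 𝓝 0, f (x + t • v) = 0) : f (x + v) = 0 := by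
  let T : Set ℂ := {t : ℂ | x + t • v ∈ ball c r}
  have hT : IsOpen T := isOpen_ball.preimage (by fun_prop)
  have hconv : Convex ℝ T := by
    intro s hs t ht a b ha hb hab
    have := convex_ball c r hs ht ha hb hab
    have hab' : (a : ℂ) + b = 1 := by exact_mod_cast hab
    have hx' : x = ((a : ℂ) + b) • x := by rw [hab', one_smul]
    change x + (a • s + b • t) • v ∈ ball c r
    convert this using 1
    simp only [← Complex.coe_smul, smul_eq_mul]
    nth_rewrite 1 [hx']
    module
  have h0 : (0 : ℂ) ∈ T := by simpa [T] using hx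
  have h1 : (1 : ℂ) ∈ T := by simpa [T] using hxv
  have := ((differentiableOn_line hf x v).analyticOnNhd hT)
    |>.eqOn_zero_of_preconnected_of_eventuallyEq_zero hconv.isPreconnected h0 h h1
  simpa using this

lemma HolNear.eventuallyEq_zero_of_lines {f : E → ℂ} {c : E} (hf : HolNear f c)
    (h : ∀ v : E, ∀ᶠ t : ℂ in 𝓝 0, f (c + t • v) = 0) : f =ᶠ[𝓝 c] 0 := by
  obtain ⟨r, hr, hd⟩ := hf.exists_ball
  filter_upwards [ball_mem_nhds c hr] with x hx
  have := eq_zero_of_line hd (mem_ball_self hr) (v := x - c) (by simpa using hx) (h _)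
  simpa using this

lemma eqOn_zero_of_eventuallyEq_zero {f : E → ℂ} {c : E} {r : ℝ}
    (hf : DifferentiableOn ℂ f (ball c r)) {x : E} (hx : x ∈ ball c r) (h : f =ᶠ[𝓝 x] 0)
    {y : E} (hy : y ∈ ball c r) : f y = 0 := by
  have := eq_zero_of_line hf hx (v := y - x) (by simpa using hy) (by
    have hc : Tendsto (fun t : ℂ => x + t • (y - x)) (𝓝 0) (𝓝 x) := by
      have : ContinuousAt (fun t : ℂ => x + t • (y - x)) 0 := by fun_prop
      simpa [ContinuousAt] using this
    exact hc.eventually h)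
  simpa using this

lemma HolNear.eventually_not_eventuallyEq_zero {f : E → ℂ} {c : E} (hf : HolNear f c)
    (h : ¬ f =ᶠ[𝓝 c] 0) : ∀ᶠ x in 𝓝 c, ¬ f =ᶠ[𝓝 x] 0 := by
  obtain ⟨r, hr, hd⟩ := hf.exists_ball
  filter_upwards [ball_mem_nhds c hr] with x hx hx0
  apply h
  filter_upwards [ball_mem_nhds c hr] with y hy
  exact eqOn_zero_of_eventuallyEq_zero hd hx hx0 hy

/-- If `g(x) ≠ 0` at a point `x` close to `c`, then `f` vanishes near `x`, and hence near `c` by the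
identity theorem. -/
lemma HolNear.eventuallyEq_zero_of_mul {f g : E → ℂ} {c : E} (hf : HolNear f c)
    (hg : HolNear g c) (h0 : ¬ f =ᶠ[𝓝 c] 0) (h : ∀ᶠ x in 𝓝 c, f x * g x = 0) :
    g =ᶠ[𝓝 c] 0 := by
  filter_upwards [hf.eventually_not_eventuallyEq_zero h0, hg, eventually_eventually_nhds.2 h]
    with x h1 h2 h3
  by_contra hne
  apply h1
  filter_upwards [h3, h2.continuousAt.eventually_ne hne] with y h4 h5
  exact (mul_eq_zero.1 h4).resolve_right h5

/-- The derivative of `f` in the direction `v`. -/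
def dirDeriv (v : E) (f : E → ℂ) : E → ℂ := fun x => fderiv ℂ f x v

lemma HolNear.dirDeriv_iterate [FiniteDimensional ℂ E] {f : E → ℂ} {c : E} (hf : HolNear f c)
    (v : E) (n : ℕ) : HolNear ((dirDeriv v)^[n] f) c := by
  induction n with
  | zero => exact hf
  | succ n ih => rw [Function.iterate_succ_apply']; exact ih.fderiv_apply v

lemma tendsto_line (c v : E) : Tendsto (fun t : ℂ => c + t • v) (𝓝 0) (𝓝 c) := by
  have : ContinuousAt (fun t : ℂ => c + t • v) 0 := by fun_prop
  simpa [ContinuousAt] using this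

lemma HolNear.line {f : E → F} {c : E} (hf : HolNear f c) (v : E) :
    HolNear (fun t : ℂ => f (c + t • v)) 0 :=
  hf.comp_of_eq (f := fun t : ℂ => c + t • v) (holNear_of_differentiable (by fun_prop) _)
    (by simp)

lemma DifferentiableAt.hasDerivAt_line {f : E → F} {c v : E} {t : ℂ}
    (hf : DifferentiableAt ℂ f (c + t • v)) :
    HasDerivAt (fun t : ℂ => f (c + t • v)) (fderiv ℂ f (c + t • v) v) t := by
  have h2 : HasDerivAt (fun t : ℂ => c + t • v) v t := by
    simpa using ((hasDerivAt_id t).smul_const v).const_add c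
  exact hf.hasFDerivAt.comp_hasDerivAt t h2

/-- A holomorphic function is determined by its Taylor coefficients. -/
lemma HolNear.eventuallyEq_zero_of_dirDeriv [FiniteDimensional ℂ E] {f : E → ℂ} {c : E}
    (hf : HolNear f c) (h : ∀ (v : E) (n : ℕ), (dirDeriv v)^[n] f c = 0) : f =ᶠ[𝓝 c] 0 := by
  refine hf.eventuallyEq_zero_of_lines fun v => ?_
  have key (n : ℕ) : iteratedDeriv n (fun t : ℂ => f (c + t • v)) =ᶠ[𝓝 0]
      fun t => (dirDeriv v)^[n] f (c + t • v) := by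
    induction n with
    | zero => simp
    | succ n ih =>
      rw [iteratedDeriv_succ, Function.iterate_succ_apply']
      refine ih.deriv.trans ?_
      filter_upwards [(tendsto_line c v).eventually (hf.dirDeriv_iterate v n)] with t ht
      exact (DifferentiableAt.hasDerivAt_line ht).deriv
  have han := (hf.line v).analyticAt
  have htop : analyticOrderAt (fun t : ℂ => f (c + t • v)) 0 = ⊤ := by
    refine ENat.eq_top_iff_forall_ge.2 fun n => ?_
    rw [natCast_le_analyticOrderAt_iff_iteratedDeriv_eq_zero han]
    intro i _
    rw [(key i).self_of_nhds]
    simpa using h v i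
  exact analyticOrderAt_eq_top.1 htop

/-! ### Division -/

/-- A holomorphic function that vanishes on a hyperplane is divisible by its equation. -/
lemma HolNear.exists_eq_linear_mul [FiniteDimensional ℂ E] {f : E → ℂ} {c : E} (hf : HolNear f c)
    (ℓ : E →L[ℂ] ℂ) (hℓ : ℓ ≠ 0) (h : ∀ᶠ x in 𝓝 c, ℓ (x - c) = 0 → f x = 0) :
    ∃ g : E → ℂ, HolNear g c ∧ ∀ᶠ x in 𝓝 c, f x = ℓ (x - c) * g x := by
  obtain ⟨v, hv⟩ : ∃ v, ℓ v = 1 := by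
    obtain ⟨v, hv⟩ : ∃ v, ℓ v ≠ 0 := by
      by_contra! hcon
      exact hℓ (by ext; simp [hcon])
    exact ⟨(ℓ v)⁻¹ • v, by simp [hv]⟩
  -- The segment from the projection of `x` along `v` to the hyperplane (`s = 0`) to `x` (`s = 1`).
  -- Its velocity is `ℓ(x - c) v`, so integrating `df` along it produces the factor `ℓ(x - c)`.
  let σ : E → ℝ → E := fun x s => x - ((1 - (s : ℂ)) * ℓ (x - c)) • v
  have hσ : Continuous fun p : E × ℝ => σ p.1 p.2 := by
    simp only [σ]; fun_prop
  obtain ⟨U, hUf, hU, hcU⟩ := _root_.eventually_nhds_iff.1 (hf.and h)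
  have hev : ∀ᶠ x in 𝓝 c, ∀ s ∈ Icc (0 : ℝ) 1, σ x s ∈ U := by
    refine isCompact_Icc.eventually_forall_of_forall_eventually fun s _ => ?_
    refine hσ.continuousAt.eventually_mem (hU.mem_nhds ?_)
    simpa [σ] using hcU
  obtain ⟨V, hVσ, hV, hcV⟩ := _root_.eventually_nhds_iff.1 hev
  have hfU : DifferentiableOn ℂ f U := fun x hx => (hUf x hx).1.differentiableWithinAt
  have hf' : DifferentiableOn ℂ (fun x => fderiv ℂ f x v) U :=
    PoissonSurface.DifferentiableOn.fderiv_apply hU hfU v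
  refine ⟨fun x => ∫ s in (0 : ℝ)..1, fderiv ℂ f (σ x s) v, ?_, ?_⟩
  · refine holNear_of_differentiableOn hV (differentiableOn_intervalIntegral hV ?_ ?_) hcV
    · refine hf'.continuousOn.comp (f := fun p : E × ℝ => σ p.1 p.2) hσ.continuousOn ?_
      rintro ⟨x, s⟩ ⟨hx, hs⟩
      rw [uIcc_of_le zero_le_one] at hs
      exact hVσ x hx s hs
    · intro s hs
      rw [uIcc_of_le zero_le_one] at hs
      refine hf'.comp ?_ fun x hx => hVσ x hx s hs
      simp only [σ]; fun_prop
  · filter_upwards [hV.mem_nhds hcV] with x hx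
    have hderiv : ∀ s ∈ uIcc (0 : ℝ) 1,
        HasDerivAt (fun s => f (σ x s)) (ℓ (x - c) * fderiv ℂ f (σ x s) v) s := by
      intro s hs
      rw [uIcc_of_le zero_le_one] at hs
      have h1 : HasDerivAt (fun s : ℝ => σ x s) (ℓ (x - c) • v) s := by
        have h2 : HasDerivAt (fun s : ℝ => (1 - (s : ℂ)) * ℓ (x - c)) (-ℓ (x - c)) s := by
          have h3 := ((hasDerivAt_id s).ofReal_comp.const_sub (1 : ℂ)).mul_const (ℓ (x - c))
          simpa using h3
        have h3 := (h2.smul_const v).const_sub x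
        rwa [neg_smul, neg_neg] at h3
      have h4 : HasDerivAt (fun s => f (σ x s)) _ s :=
        ((hUf _ (hVσ x hx s hs)).1.hasFDerivAt.restrictScalars ℝ).comp_hasDerivAt s h1
      convert h4 using 1
      simp
    have hcont : ContinuousOn (fun s => ℓ (x - c) * fderiv ℂ f (σ x s) v) (uIcc (0 : ℝ) 1) := by
      refine continuousOn_const.mul (hf'.continuousOn.comp (f := fun s => σ x s) ?_ ?_)
      · exact (hσ.comp (by fun_prop : Continuous fun s : ℝ => (x, s))).continuousOn
      · intro s hs
        rw [uIcc_of_le zero_le_one] at hs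
        exact hVσ x hx s hs
    have hint := intervalIntegral.integral_eq_sub_of_hasDerivAt hderiv hcont.intervalIntegrable
    rw [intervalIntegral.integral_const_mul] at hint
    rw [hint]
    have h1 : σ x 1 = x := by simp [σ]
    have h0 : f (σ x 0) = 0 := by
      refine (hUf _ (hVσ x hx 0 (by simp))).2 ?_
      simp only [σ, map_sub, map_smul, hv]
      simp
    simp only [h1, h0, sub_zero]

/-! ### Straightening smooth hypersurfaces -/

/-- The holomorphic inverse function theorem, for maps with derivative the identity. -/
lemma HolNear.exists_openPartialHomeomorph [FiniteDimensional ℂ E] {φ : E → E} {c : E}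
    (hφ : HolNear φ c) (h : fderiv ℂ φ c = ContinuousLinearMap.id ℂ E) :
    ∃ Ψ : OpenPartialHomeomorph E E, c ∈ Ψ.source ∧ (∀ x, Ψ x = φ x) ∧
      DifferentiableOn ℂ Ψ Ψ.source ∧ DifferentiableOn ℂ Ψ.symm Ψ.target := by
  have : CompleteSpace E := FiniteDimensional.complete ℂ E
  have hcd := hφ.contDiffAt 1
  have hfd : HasFDerivAt φ ((ContinuousLinearEquiv.refl ℂ E : E ≃L[ℂ] E) : E →L[ℂ] E) c := by
    rw [ContinuousLinearEquiv.coe_refl, ← h]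
    exact hφ.differentiableAt.hasFDerivAt
  let Ψ := hcd.toOpenPartialHomeomorph φ hfd one_ne_zero
  have hinv : ContDiffAt ℂ (1 : ℕ) Ψ.symm (φ c) := hcd.to_localInverse hfd one_ne_zero
  have hinv' : ∀ᶠ y in 𝓝 (φ c), DifferentiableAt ℂ Ψ.symm y :=
    (hinv.eventually (by simp)).mono fun y hy => hy.differentiableAt (by simp)
  have hS : {x | DifferentiableAt ℂ φ x ∧ DifferentiableAt ℂ Ψ.symm (φ x)} ∈ 𝓝 c :=
    hφ.and (hφ.continuousAt.eventually hinv')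
  obtain ⟨S, hSsub, hSo, hcS⟩ := _root_.mem_nhds_iff.1 hS
  have hcΨ : c ∈ Ψ.source := hcd.mem_toOpenPartialHomeomorph_source hfd one_ne_zero
  refine ⟨Ψ.restrOpen S hSo, ⟨hcΨ, hcS⟩, fun x => rfl, ?_, ?_⟩
  · exact fun x hx => (hSsub hx.2).1.differentiableWithinAt
  · rintro y ⟨hy, hyS⟩
    have := (hSsub hyS).2
    have e : φ (Ψ.symm y) = y := Ψ.right_inv hy
    rw [e] at this
    exact this.differentiableWithinAt

/-- A holomorphic function with nonzero differential is, after a change of coordinates, linear. -/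
lemma HolNear.exists_straighten [FiniteDimensional ℂ E] {g : E → ℂ} {c : E}
    (hg : HolNear g c) (h : fderiv ℂ g c ≠ 0) :
    ∃ Ψ : OpenPartialHomeomorph E E, c ∈ Ψ.source ∧
      (∀ x, fderiv ℂ g c (Ψ x) = g x) ∧
      DifferentiableOn ℂ Ψ Ψ.source ∧ DifferentiableOn ℂ Ψ.symm Ψ.target := by
  obtain ⟨v, hv⟩ : ∃ v, fderiv ℂ g c v = 1 := by
    obtain ⟨v, hv⟩ : ∃ v, fderiv ℂ g c v ≠ 0 := by
      by_contra! hcon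
      exact h (by ext; simp [hcon])
    exact ⟨(fderiv ℂ g c v)⁻¹ • v, by simp [hv]⟩
  set ℓ := fderiv ℂ g c with hℓ
  -- Correcting `x` in a direction `v` with `ℓ(v) = 1` gives `ℓ ∘ φ = g` while keeping the
  -- derivative at `c` equal to the identity.
  let φ : E → E := fun x => x + (g x - ℓ x) • v
  have hφ : HolNear φ c := by
    filter_upwards [hg] with x hx
    simp only [φ]; fun_prop
  obtain ⟨Ψ, h1, h2, h3, h4⟩ := hφ.exists_openPartialHomeomorph (by
    have h5 : HasFDerivAt φ (ContinuousLinearMap.id ℂ E + (ℓ - ℓ).smulRight v) c :=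
      (hasFDerivAt_id c).add ((hg.differentiableAt.hasFDerivAt.sub ℓ.hasFDerivAt).smul_const v)
    rw [h5.fderiv]; simp)
  refine ⟨Ψ, h1, fun x => ?_, h3, h4⟩
  rw [h2]
  simp [φ, hv]

/-- A holomorphic function that vanishes on a smooth hypersurface is divisible by its equation. -/
lemma HolNear.exists_eq_mul [FiniteDimensional ℂ E] {f g : E → ℂ} {c : E} (hf : HolNear f c)
    (hg : HolNear g c) (hgc : g c = 0) (hdg : fderiv ℂ g c ≠ 0)
    (h : ∀ᶠ x in 𝓝 c, g x = 0 → f x = 0) :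
    ∃ q : E → ℂ, HolNear q c ∧ ∀ᶠ x in 𝓝 c, f x = g x * q x := by
  obtain ⟨Ψ, hc, hΨ, hd, hd'⟩ := hg.exists_straighten hdg
  have hsymm : HolNear Ψ.symm (Ψ c) :=
    holNear_of_differentiableOn Ψ.open_target hd' (Ψ.map_source hc)
  have hΨn : HolNear Ψ c := holNear_of_differentiableOn Ψ.open_source hd hc
  have hf' : HolNear (fun y => f (Ψ.symm y)) (Ψ c) :=
    hf.comp_of_eq hsymm (Ψ.left_inv hc)
  obtain ⟨q, hq, hfq⟩ := hf'.exists_eq_linear_mul (fderiv ℂ g c) hdg (by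
    have hcont : Tendsto Ψ.symm (𝓝 (Ψ c)) (𝓝 c) := by
      have := hsymm.continuousAt
      rwa [ContinuousAt, Ψ.left_inv hc] at this
    filter_upwards [hcont.eventually h, Ψ.open_target.mem_nhds (Ψ.map_source hc)] with y h1 h2 h3
    apply h1
    rw [← hΨ, Ψ.right_inv h2]
    rwa [map_sub, hΨ c, hgc, sub_zero] at h3)
  refine ⟨fun x => q (Ψ x), hq.comp hΨn, ?_⟩
  filter_upwards [hΨn.continuousAt.eventually hfq, Ψ.open_source.mem_nhds hc] with x h1 h2
  rw [Ψ.left_inv h2, map_sub, hΨ, hΨ, hgc, sub_zero] at h1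
  exact h1

end HolNear

end PoissonSurface

end

noncomputable section

namespace PoissonSurface

section Curves

open Set Metric Filter

/-! ### Smooth curves in the plane -/

lemma exists_ker_basis {ℓ : C2 →L[ℂ] ℂ} (hℓ : ℓ ≠ 0) : ∃ (u : C2) (μ : C2 →L[ℂ] ℂ),
    μ u = 1 ∧ ℓ u = 0 ∧ ∀ x, ℓ x = 0 → x = μ x • u := by
  let e₀ : C2 := EuclideanSpace.single 0 1
  let e₁ : C2 := EuclideanSpace.single 1 1
  have hx (x : C2) : x = x 0 • e₀ + x 1 • e₁ := by
    ext i; fin_cases i <;> simp [e₀, e₁]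
  have hℓx (x : C2) : ℓ x = x 0 * ℓ e₀ + x 1 * ℓ e₁ := by
    conv_lhs => rw [hx x]
    simp
  by_cases h0 : ℓ e₀ = 0
  · have h1 : ℓ e₁ ≠ 0 := by
      intro h1
      apply hℓ
      ext x
      rw [hℓx x, h0, h1]; simp
    refine ⟨e₀, EuclideanSpace.proj 0, by simp [e₀], h0, fun x hx0 => ?_⟩
    rw [hℓx x, h0, mul_zero, zero_add] at hx0
    have h2 := (mul_eq_zero.1 hx0).resolve_right h1
    conv_lhs => rw [hx x, h2]
    simp
  · refine ⟨e₁ - (ℓ e₁ / ℓ e₀) • e₀, EuclideanSpace.proj 1, by simp [e₀, e₁], ?_, fun x hx0 => ?_⟩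
    · simp [h0]
    · rw [hℓx x] at hx0
      have h2 : x 0 = -(x 1 * (ℓ e₁ / ℓ e₀)) := by
        field_simp
        linear_combination hx0
      conv_lhs => rw [hx x, h2]
      simp only [EuclideanSpace.coe_proj, smul_sub, smul_smul, neg_smul]
      abel

lemma exists_functional_of_ne_zero {v : C2} (hv : v ≠ 0) : ∃ ℓ μ : C2 →L[ℂ] ℂ,
    ℓ ≠ 0 ∧ μ v = 1 ∧ ℓ v = 0 ∧ ∀ x, ℓ x = 0 → x = μ x • v := by
  let p₀ : C2 →L[ℂ] ℂ := EuclideanSpace.proj 0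
  let p₁ : C2 →L[ℂ] ℂ := EuclideanSpace.proj 1
  have hne : v 0 ≠ 0 ∨ v 1 ≠ 0 := by
    by_contra! h
    apply hv
    ext i; fin_cases i
    · exact h.1
    · exact h.2
  let ℓ : C2 →L[ℂ] ℂ := v 1 • p₀ - v 0 • p₁
  have hℓ (x : C2) : ℓ x = v 1 * x 0 - v 0 * x 1 := by simp [ℓ, p₀, p₁]
  have hℓ0 : ℓ ≠ 0 := by
    intro h
    have h0 := hℓ (EuclideanSpace.single 0 1)
    have h1 := hℓ (EuclideanSpace.single 1 1)
    rw [h] at h0 h1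
    simp at h0 h1
    exact hne.elim (fun h => h h1) (fun h => h h0.symm)
  have hker : ℓ v = 0 := by rw [hℓ]; ring
  obtain ⟨u, μ, h1, h2, h3⟩ := exists_ker_basis hℓ0
  have h4 := h3 v hker
  have h5 : μ v ≠ 0 := by
    intro h; rw [h, zero_smul] at h4; exact hv h4
  refine ⟨ℓ, (μ v)⁻¹ • μ, hℓ0, by simp [h5], hker, fun x hx => ?_⟩
  have h6 := h3 x hx
  rw [smul_apply, smul_eq_mul]
  nth_rewrite 2 [h4]
  nth_rewrite 1 [h6]
  rw [smul_smul]
  congr 1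
  field_simp

/-- A smooth curve through `q` with equation `g` has a holomorphic parametrization. -/
lemma HolNear.exists_parametrization {g : C2 → ℂ} {q : C2} (hg : HolNear g q) (hgq : g q = 0)
    (hdg : fderiv ℂ g q ≠ 0) : ∃ (κ : ℂ → C2) (τ : C2 → ℂ), HolNear κ 0 ∧ HolNear τ q ∧
      κ 0 = q ∧ τ q = 0 ∧ (∀ᶠ t in 𝓝 0, g (κ t) = 0) ∧ deriv κ 0 ≠ 0 ∧
      ∀ᶠ x in 𝓝 q, g x = 0 → κ (τ x) = x := by
  obtain ⟨Ψ, hq, hΨ, hd, hd'⟩ := hg.exists_straighten hdg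
  obtain ⟨u, μ, h1, h2, h3⟩ := exists_ker_basis hdg
  set ℓ := fderiv ℂ g q
  have hsymm : HolNear Ψ.symm (Ψ q) :=
    holNear_of_differentiableOn Ψ.open_target hd' (Ψ.map_source hq)
  have hΨn : HolNear Ψ q := holNear_of_differentiableOn Ψ.open_source hd hq
  let κ : ℂ → C2 := fun t => Ψ.symm (Ψ q + t • u)
  let τ : C2 → ℂ := fun x => μ (Ψ x - Ψ q)
  have hκ : HolNear κ 0 := hsymm.line u
  have hτ : HolNear τ q := by
    filter_upwards [hΨn] with x hx
    simp only [τ]; fun_prop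
  have hκ0 : κ 0 = q := by simp [κ, Ψ.left_inv hq]
  have htar : ∀ᶠ t : ℂ in 𝓝 0, Ψ q + t • u ∈ Ψ.target :=
    (tendsto_line (Ψ q) u).eventually (Ψ.open_target.mem_nhds (Ψ.map_source hq))
  have hτκ : ∀ᶠ t in 𝓝 0, τ (κ t) = t := by
    filter_upwards [htar] with t ht
    simp [τ, κ, Ψ.right_inv ht, h1]
  refine ⟨κ, τ, hκ, hτ, hκ0, by simp [τ], ?_, ?_, ?_⟩
  · filter_upwards [htar] with t ht
    rw [← hΨ, Ψ.right_inv ht, map_add, hΨ, hgq, map_smul, h2]; simp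
  · intro h0
    have e0 : HasFDerivAt τ (fderiv ℂ τ (κ 0)) (κ 0) := by
      rw [hκ0]; exact hτ.differentiableAt.hasFDerivAt
    have e1 := e0.comp_hasDerivAt 0 hκ.differentiableAt.hasDerivAt
    have e2 : HasDerivAt (fun t : ℂ => t) (fderiv ℂ τ (κ 0) (deriv κ 0)) 0 :=
      e1.congr_of_eventuallyEq (hτκ.mono fun t ht => ht.symm)
    have := e2.unique (hasDerivAt_id (0 : ℂ))
    rw [h0, map_zero] at this
    exact zero_ne_one this
  · filter_upwards [Ψ.open_source.mem_nhds hq] with x hx hgx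
    have h4 : ℓ (Ψ x - Ψ q) = 0 := by rw [map_sub, hΨ, hΨ, hgx, hgq, sub_zero]
    have h5 : Ψ q + τ x • u = Ψ x := by
      rw [← h3 _ h4]; abel
    simp only [κ]
    rw [h5, Ψ.left_inv hx]

/-- An immersed curve germ has a smooth local equation. -/
lemma HolNear.exists_equation {κ : ℂ → C2} (hκ : HolNear κ 0) (h0 : deriv κ 0 ≠ 0) :
    ∃ g : C2 → ℂ, HolNear g (κ 0) ∧ g (κ 0) = 0 ∧ fderiv ℂ g (κ 0) ≠ 0 ∧
      ∀ p : C2 → Prop, (∀ᶠ t in 𝓝 0, p (κ t)) → ∀ᶠ x in 𝓝 (κ 0), g x = 0 → p x := by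
  obtain ⟨ℓ, μ, hℓ, hμ, hℓv, hker⟩ := exists_functional_of_ne_zero h0
  set v := deriv κ 0
  -- On the line `t ↦ t v` this map is `κ`, and its derivative at `0` is the identity. The equation
  -- of the line, transported by its inverse, is the equation of the curve.
  let φ : C2 → C2 := fun x => x + (κ (μ x) - μ x • v)
  have hμn : HolNear (fun x => κ (μ x)) 0 :=
    hκ.comp_of_eq (f := μ) (holNear_of_differentiable (by fun_prop) _) (by simp)
  have hφ : HolNear φ 0 := by
    filter_upwards [hμn] with x hx
    exact differentiableAt_id.add (hx.sub (by fun_prop))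
  have hφ0 : φ 0 = κ 0 := by simp [φ]
  obtain ⟨Ψ, h1, h2, h3, h4⟩ := hφ.exists_openPartialHomeomorph (by
    have h5 : HasFDerivAt (fun x => κ (μ x)) (μ.smulRight v) 0 := by
      have h6 : HasDerivAt κ v (μ 0) := by rw [map_zero]; exact hκ.differentiableAt.hasDerivAt
      have h7 := h6.hasFDerivAt.comp 0 μ.hasFDerivAt
      exact h7.congr_fderiv (ContinuousLinearMap.ext fun y => by simp)
    have h8 : HasFDerivAt φ (ContinuousLinearMap.id ℂ C2 +
        (μ.smulRight v - μ.smulRight v)) 0 :=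
      (hasFDerivAt_id 0).add (h5.sub (μ.hasFDerivAt.smul_const v))
    rw [h8.fderiv]; simp)
  have hs0 : Ψ.symm (κ 0) = 0 := by rw [← hφ0, ← h2, Ψ.left_inv h1]
  have hmem : κ 0 ∈ Ψ.target := by rw [← hφ0, ← h2]; exact Ψ.map_source h1
  have hsymm : HolNear Ψ.symm (κ 0) := holNear_of_differentiableOn Ψ.open_target h4 hmem
  have hφcurve (t : ℂ) : φ (t • v) = κ t := by simp [φ, hμ]
  refine ⟨fun x => ℓ (Ψ.symm x), ?_, by simp [hs0], ?_, ?_⟩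
  · filter_upwards [hsymm] with x hx
    fun_prop
  · intro hcon
    have e1 : HasFDerivAt (fun x => ℓ (Ψ.symm (Ψ x)))
        ((fderiv ℂ (fun x => ℓ (Ψ.symm x)) (κ 0)).comp (fderiv ℂ Ψ 0)) 0 := by
      have hd : DifferentiableAt ℂ (fun x => ℓ (Ψ.symm x)) (Ψ 0) := by
        rw [h2, hφ0]
        have := hsymm.differentiableAt
        fun_prop
      have := hd.hasFDerivAt.comp 0
        (h3.differentiableAt (Ψ.open_source.mem_nhds h1)).hasFDerivAt
      rw [h2, hφ0] at this
      exact this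
    have e2 : HasFDerivAt (fun x => ℓ x)
        ((fderiv ℂ (fun x => ℓ (Ψ.symm x)) (κ 0)).comp (fderiv ℂ Ψ 0)) 0 := by
      refine e1.congr_of_eventuallyEq ?_
      filter_upwards [Ψ.open_source.mem_nhds h1] with x hx
      rw [Ψ.left_inv hx]
    rw [hcon] at e2
    have := e2.unique ℓ.hasFDerivAt
    exact hℓ (by rw [← this]; simp)
  · intro p hp
    have hcont : Tendsto (fun x => μ (Ψ.symm x)) (𝓝 (κ 0)) (𝓝 0) := by
      have : ContinuousAt (fun x => μ (Ψ.symm x)) (κ 0) :=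
        μ.continuous.continuousAt.comp hsymm.continuousAt
      simpa [ContinuousAt, hs0] using this
    filter_upwards [hcont.eventually hp, Ψ.open_target.mem_nhds hmem] with x hx hx' hgx
    have h5 := hker _ hgx
    have h6 : x = κ (μ (Ψ.symm x)) := by
      rw [← hφcurve, ← h5, ← h2, Ψ.right_inv hx']
    rw [h6]; exact hx

/-- A holomorphic function with an accumulating sequence of zeros on a smooth curve vanishes on
the curve. -/
lemma HolNear.eventually_eq_zero_on_curve {f g : C2 → ℂ} {q : C2} (hf : HolNear f q)
    (hg : HolNear g q) (hgq : g q = 0) (hdg : fderiv ℂ g q ≠ 0)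
    (h : ∃ᶠ x in 𝓝[≠] q, g x = 0 ∧ f x = 0) : ∀ᶠ x in 𝓝 q, g x = 0 → f x = 0 := by
  obtain ⟨κ, τ, hκ, hτ, hκ0, hτ0, -, -, hinv⟩ := hg.exists_parametrization hgq hdg
  have han : AnalyticAt ℂ (fun t => f (κ t)) 0 := (hf.comp_of_eq hκ hκ0).analyticAt
  have hτt : Tendsto τ (𝓝 q) (𝓝 0) := by simpa [ContinuousAt, hτ0] using hτ.continuousAt
  -- Zeros of `f` on the curve accumulating at `q` pull back to zeros of `f ∘ κ` accumulating at
  -- `0`; one-variable zeros are isolated.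
  have h0 : ∀ᶠ t in 𝓝 0, f (κ t) = 0 := by
    refine han.frequently_zero_iff_eventually_zero.1 fun hcon => h ?_
    rw [eventually_nhdsWithin_iff] at hcon ⊢
    filter_upwards [hτt.eventually hcon, hinv] with x h1 h2 hxq h3
    have h4 := h2 h3.1
    refine h1 ?_ (by rw [h4]; exact h3.2)
    rintro (h5 : τ x = 0)
    rw [h5, hκ0] at h4
    exact hxq h4.symm
  filter_upwards [hτt.eventually h0, hinv] with x h1 h2 h3
  rw [h2 h3] at h1
  exact h1

/-! ### Divisibility of germs -/

/-- The germ of `f` at `c` divides the germ of `a`. -/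
def HolDvd (f a : C2 → ℂ) (c : C2) : Prop :=
  ∃ b : C2 → ℂ, HolNear b c ∧ ∀ᶠ x in 𝓝 c, a x = f x * b x

lemma holDvd_of_ne_zero {f a : C2 → ℂ} {c : C2} (hf : HolNear f c) (ha : HolNear a c)
    (h : f c ≠ 0) : HolDvd f a c := by
  refine ⟨_, ha.div hf h, ?_⟩
  filter_upwards [hf.continuousAt.eventually_ne h] with x hx
  field_simp

/-- The complement of a complex line is dense; this allows the Hartogs argument to ignore the line
through the exceptional point. -/
lemma frequently_sub_notMem_span (q v x : C2) :
    ∃ᶠ y in 𝓝 x, ∀ t : ℂ, y - q ≠ t • v := by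
  obtain ⟨u, hu⟩ : ∃ u : C2, ∀ t : ℂ, u ≠ t • v := by
    by_contra! hcon
    by_cases hv : v = 0
    · obtain ⟨t, ht⟩ := hcon (EuclideanSpace.single 0 1)
      rw [hv, smul_zero] at ht
      have := congrArg (fun y : C2 => y 0) ht
      simp at this
    obtain ⟨ℓ, μ, h1, h2, h3, h4⟩ := exists_functional_of_ne_zero hv
    apply h1
    ext y
    obtain ⟨t, ht⟩ := hcon y
    rw [ht, map_smul, h3]; simp
  by_cases hx : ∀ t : ℂ, x - q ≠ t • v
  · intro hcon
    exact hcon.self_of_nhds hx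
  push Not at hx
  obtain ⟨t, ht⟩ := hx
  have h1 : ∃ᶠ s : ℂ in 𝓝[≠] 0, True := by
    rw [frequently_true_iff_neBot]; infer_instance
  have h2 : Tendsto (fun s : ℂ => x + s • u) (𝓝[≠] 0) (𝓝 x) :=
    (tendsto_line x u).mono_left nhdsWithin_le_nhds
  refine h2.frequently (h1.and_eventually self_mem_nhdsWithin |>.mono ?_)
  rintro s ⟨-, hs⟩ t' h
  have hs' : s ≠ 0 := hs
  apply hu (s⁻¹ * (t' - t))
  have h3 : s • u = (t' - t) • v := by
    rw [sub_smul, ← h, ← ht]; abel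
  rw [mul_smul, ← h3, smul_smul, inv_mul_cancel₀ hs', one_smul]

/-- Hartogs' phenomenon for quotients: if `f` divides `a` at all points near `q` except possibly
`q` itself, then `f` divides `a` at `q`. -/
theorem HolDvd.of_punctured {f a : C2 → ℂ} {q : C2} (hf : HolNear f q) (ha : HolNear a q)
    (hf0 : ¬ f =ᶠ[𝓝 q] 0) (h : ∀ᶠ x in 𝓝[≠] q, HolDvd f a x) : HolDvd f a q := by
  by_cases hfq : f q ≠ 0
  · exact holDvd_of_ne_zero hf ha hfq
  push Not at hfq
  have hall := (hf.and ha).and ((eventually_nhdsWithin_iff.1 h).and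
    (hf.eventually_not_eventuallyEq_zero hf0))
  obtain ⟨R, hR, hB⟩ := Metric.eventually_nhds_iff_ball.1 hall
  have hfd : DifferentiableOn ℂ f (ball q R) := fun x hx => (hB x hx).1.1.differentiableWithinAt
  have had : DifferentiableOn ℂ a (ball q R) := fun x hx => (hB x hx).1.2.differentiableWithinAt
  have hfn {x : C2} (hx : x ∈ ball q R) : HolNear f x :=
    holNear_of_differentiableOn isOpen_ball hfd hx
  obtain ⟨y, hy, hfy⟩ : ∃ y ∈ ball q R, f y ≠ 0 := by
    by_contra! hcon
    exact hf0 (by filter_upwards [ball_mem_nhds q hR] with x hx using hcon x hx)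
  set v := y - q with hv
  have hv0 : v ≠ 0 := by
    intro h0; rw [sub_eq_zero.1 h0] at hfy; exact hfy hfq
  obtain ⟨ℓ₀, ℓ, -, hℓv, -, -⟩ := exists_functional_of_ne_zero hv0
  have hφ := (hf.line v).analyticAt.eventually_eq_zero_or_eventually_ne_zero
  have hφ' : ∀ᶠ t : ℂ in 𝓝[≠] 0, f (q + t • v) ≠ 0 := by
    refine hφ.resolve_left fun h0 => hfy ?_
    have := eq_zero_of_line hfd (mem_ball_self hR) (v := v) (by simpa [hv] using hy) h0
    simpa [hv] using this
  obtain ⟨r, hr, hrφ⟩ : ∃ r > 0, ∀ t ∈ closedBall (0 : ℂ) r,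
      (t ≠ 0 → f (q + t • v) ≠ 0) ∧ q + t • v ∈ ball q R := by
    have h1 := (eventually_nhdsWithin_iff.1 hφ').and
      ((tendsto_line q v).eventually (ball_mem_nhds q hR))
    obtain ⟨r, hr, h2⟩ := nhds_basis_closedBall.mem_iff.1 h1
    exact ⟨r, hr, fun t ht => h2 ht⟩
  -- Since `ℓ(v) = 1`, the point `σ x t` lies on the line through `x` parallel to `v` and has
  -- `ℓ`-coordinate `t` relative to `q`; it equals `x` at `t = ℓ(x - q)`.
  let σ : C2 → ℂ → C2 := fun x t => x + (t - ℓ (x - q)) • v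
  have hσ : Continuous fun p : C2 × ℂ => σ p.1 p.2 := by simp only [σ]; fun_prop
  have hσq (t : ℂ) : σ q t = q + t • v := by simp [σ]
  have hU : ∀ᶠ x in 𝓝 q, (∀ t ∈ closedBall (0 : ℂ) r, σ x t ∈ ball q R) ∧
      (∀ t ∈ sphere (0 : ℂ) r, f (σ x t) ≠ 0) ∧ ℓ (x - q) ∈ ball (0 : ℂ) r := by
    refine Eventually.and ?_ (Eventually.and ?_ ?_)
    · refine (isCompact_closedBall 0 r).eventually_forall_of_forall_eventually fun t ht => ?_
      refine hσ.continuousAt.eventually_mem (isOpen_ball.mem_nhds ?_)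
      rw [hσq]; exact (hrφ t ht).2
    · refine (isCompact_sphere 0 r).eventually_forall_of_forall_eventually fun t ht => ?_
      have ht' := hrφ t (sphere_subset_closedBall ht)
      have hmem : σ q t ∈ ball q R := by rw [hσq]; exact ht'.2
      have hc : ContinuousAt (fun p : C2 × ℂ => f (σ p.1 p.2)) (q, t) :=
        (hfn hmem).continuousAt.comp (f := fun p : C2 × ℂ => σ p.1 p.2) hσ.continuousAt
      refine hc.eventually_ne ?_
      rw [hσq]
      exact ht'.1 (ne_of_mem_sphere ht hr.ne')
    · have hc : ContinuousAt (fun x => ℓ (x - q)) q := by fun_prop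
      exact hc.eventually_mem (isOpen_ball.mem_nhds (by simpa using hr))
  obtain ⟨U, hUσ, hUo, hqU⟩ := _root_.eventually_nhds_iff.1 hU
  -- The Cauchy integral of `a / f` over a circle where `f ≠ 0`. It makes sense and is holomorphic
  -- also at `q`.
  let b : C2 → ℂ := fun x => (2 * Real.pi * Complex.I : ℂ)⁻¹ •
    ∮ t in C(0, r), (t - ℓ (x - q))⁻¹ • (a (σ x t) / f (σ x t))
  have hne {x : C2} (hx : x ∈ U) {t : ℂ} (ht : t ∈ sphere (0 : ℂ) r) : t - ℓ (x - q) ≠ 0 := by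
    intro h0
    have h1 := (hUσ x hx).2.2
    rw [← sub_eq_zero.1 h0, mem_ball, mem_sphere.1 ht] at h1
    exact lt_irrefl _ h1
  have hbd : DifferentiableOn ℂ b U := by
    suffices hI : DifferentiableOn ℂ
        (fun x => ∮ t in C(0, r), (t - ℓ (x - q))⁻¹ • (a (σ x t) / f (σ x t))) U from
      hI.const_smul (2 * Real.pi * Complex.I : ℂ)⁻¹
    refine differentiableOn_circleIntegral hUo hr.le ?_ ?_
    · have hlin : Continuous fun p : C2 × ℂ => p.2 - ℓ (p.1 - q) := by fun_prop
      refine ContinuousOn.smul (hlin.continuousOn.inv₀ fun p hp => hne hp.1 hp.2)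
        (ContinuousOn.div (f := fun p : C2 × ℂ => a (σ p.1 p.2))
          (g := fun p : C2 × ℂ => f (σ p.1 p.2)) ?_ ?_ fun p hp => (hUσ p.1 hp.1).2.1 p.2 hp.2)
      · exact had.continuousOn.comp hσ.continuousOn
          fun p hp => (hUσ p.1 hp.1).1 p.2 (sphere_subset_closedBall hp.2)
      · exact hfd.continuousOn.comp hσ.continuousOn
          fun p hp => (hUσ p.1 hp.1).1 p.2 (sphere_subset_closedBall hp.2)
    · intro t ht
      have hσd : DifferentiableOn ℂ (fun x => σ x t) U := by simp only [σ]; fun_prop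
      have hm : MapsTo (fun x => σ x t) U (ball q R) :=
        fun x hx => (hUσ x hx).1 t (sphere_subset_closedBall ht)
      have hlin : Differentiable ℂ fun x : C2 => t - ℓ (x - q) := by fun_prop
      refine DifferentiableOn.smul (hlin.differentiableOn.inv fun x hx => hne hx ht) ?_
      simp only [div_eq_mul_inv]
      exact (had.comp hσd hm).mul ((hfd.comp hσd hm).inv fun x hx => (hUσ x hx).2.1 t ht)
  have hloc (x : C2) (hx : x ∈ ball q R ∧ x ≠ q) : HolDvd f a x := (hB x hx.1).2.1 hx.2
  choose! β hβ hβa using hloc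
  -- The local quotients agree where they overlap, because the germ of `f` is nonzero, so their
  -- diagonal values form one holomorphic function off `q`.
  let B : C2 → ℂ := fun x => β x x
  have hBβ {x : C2} (hx : x ∈ ball q R) (hxq : x ≠ q) : B =ᶠ[𝓝 x] β x := by
    filter_upwards [isOpen_ball.mem_nhds hx, eventually_ne_nhds hxq, hβ x ⟨hx, hxq⟩ |>.eventually,
      eventually_eventually_nhds.2 (hβa x ⟨hx, hxq⟩)] with z hz hzq h1 h2
    have h3 : ∀ᶠ w in 𝓝 z, f w * (β z w - β x w) = 0 := by
      filter_upwards [h2, hβa z ⟨hz, hzq⟩] with w h4 h5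
      rw [mul_sub, ← h4, ← h5, sub_self]
    have h6 := (hfn hz).eventuallyEq_zero_of_mul ((hβ z ⟨hz, hzq⟩).sub h1) (hB z hz).2.2 h3
    exact sub_eq_zero.1 h6.self_of_nhds
  have hBa {x : C2} (hx : x ∈ ball q R) (hxq : x ≠ q) : a x = f x * B x :=
    (hβa x ⟨hx, hxq⟩).self_of_nhds
  -- Off the line `q + ℂ v` the whole disc avoids `q`, so `a / f` extends holomorphically over it
  -- and Cauchy's formula identifies `b` with the quotient. The remaining points follow by
  -- continuity.
  have key {x : C2} (hx : x ∈ U) (hxv : ∀ t : ℂ, x - q ≠ t • v) : a x = f x * b x := by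
    have hσne (t : ℂ) : σ x t ≠ q := by
      intro h0
      apply hxv (ℓ (x - q) - t)
      simp only [σ] at h0
      calc x - q = x - (x + (t - ℓ (x - q)) • v) := by rw [h0]
        _ = (ℓ (x - q) - t) • v := by module
    have hd : DifferentiableOn ℂ (fun t => B (σ x t)) (closedBall 0 r) := by
      intro t ht
      have h1 := (hUσ x hx).1 t ht
      have h2 : DifferentiableAt ℂ B (σ x t) :=
        ((hβ _ ⟨h1, hσne t⟩).congr (hBβ h1 (hσne t)).symm).differentiableAt
      have h3 : DifferentiableAt ℂ (σ x) t := by simp only [σ]; fun_prop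
      exact (h2.comp t h3).differentiableWithinAt
    have hx1 : σ x (ℓ (x - q)) = x := by simp [σ]
    have hmem := (hUσ x hx).2.2
    have hxB : x ∈ ball q R := by
      have := (hUσ x hx).1 _ (ball_subset_closedBall hmem)
      rwa [hx1] at this
    have hxq : x ≠ q := by rw [← hx1]; exact hσne _
    have hb : b x = B x := by
      have h1 := hd.circleIntegral_sub_inv_smul hmem
      rw [hx1] at h1
      simp only [b]
      rw [show (∮ t in C(0, r), (t - ℓ (x - q))⁻¹ • (a (σ x t) / f (σ x t))) =
        ∮ t in C(0, r), (t - ℓ (x - q))⁻¹ • B (σ x t) from ?_, h1, smul_smul,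
        inv_mul_cancel₀ Complex.two_pi_I_ne_zero, one_smul]
      refine circleIntegral.integral_congr hr.le fun t ht => ?_
      rw [hBa ((hUσ x hx).1 t (sphere_subset_closedBall ht)) (hσne t),
        mul_div_cancel_left₀ _ ((hUσ x hx).2.1 t ht)]
    rw [hb]; exact hBa hxB hxq
  refine ⟨b, holNear_of_differentiableOn hUo hbd hqU, ?_⟩
  filter_upwards [hUo.mem_nhds hqU, ball_mem_nhds q hR] with x hx hxB
  by_contra hcon
  have hc : ContinuousAt (fun x => a x - f x * b x) x :=
    (had.differentiableAt (isOpen_ball.mem_nhds hxB)).continuousAt.sub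
      ((hfn hxB).continuousAt.mul (hbd.differentiableAt (hUo.mem_nhds hx)).continuousAt)
  have h1 := hc.eventually_ne (sub_ne_zero.2 hcon)
  obtain ⟨z, hz1, hz2, hz3⟩ := ((frequently_sub_notMem_span q v x).and_eventually
    (h1.and (hUo.mem_nhds hx))).exists
  exact hz2 (sub_eq_zero.2 (key hz3 hz1))

end Curves

end PoissonSurface

end

noncomputable section

namespace PoissonSurface

section Components

open Set Metric Filter

/-! ### Multiple components -/

/-- The iterated derivative of `f` in a list of directions. -/
def wordDeriv (L : List C2) (f : C2 → ℂ) : C2 → ℂ := L.foldr dirDeriv f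

lemma HolNear.word {f : C2 → ℂ} {c : C2} (hf : HolNear f c) (L : List C2) :
    HolNear (wordDeriv L f) c := by
  induction L with
  | nil => exact hf
  | cons v L ih => exact HolNear.fderiv_apply ih v

lemma wordDeriv_replicate (n : ℕ) (v : C2) (f : C2 → ℂ) :
    wordDeriv (List.replicate n v) f = (dirDeriv v)^[n] f := by
  induction n with
  | zero => rfl
  | succ n ih =>
    rw [Function.iterate_succ_apply', ← ih, List.replicate_succ]; rfl

lemma HolNear.exists_wordDeriv_ne_zero {f : C2 → ℂ} {c : C2} (hf : HolNear f c)
    (h : ¬ f =ᶠ[𝓝 c] 0) : ∃ L : List C2, wordDeriv L f c ≠ 0 := by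
  by_contra! hcon
  refine h (hf.eventuallyEq_zero_of_dirDeriv fun v n => ?_)
  rw [← wordDeriv_replicate]; exact hcon _

/-- If a power of the equation of a smooth curve divides `f`, for all exponents, then `f = 0`. -/
lemma HolNear.eventuallyEq_zero_of_pow_mul {f g : C2 → ℂ} {c : C2} (hf : HolNear f c)
    (hg : HolNear g c) (hgc : g c = 0)
    (h : ∀ n : ℕ, HolDvd (fun x => g x ^ n) f c) : f =ᶠ[𝓝 c] 0 := by
  refine hf.eventuallyEq_zero_of_lines fun v => ?_
  have hord : analyticOrderAt (fun t : ℂ => f (c + t • v)) 0 = ⊤ := by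
    refine ENat.eq_top_iff_forall_ge.2 fun n => ?_
    obtain ⟨u, hu, hfu⟩ := h n
    have hga := (hg.line v).analyticAt
    have hua := (hu.line v).analyticAt
    have e : (fun t : ℂ => f (c + t • v)) =ᶠ[𝓝 0]
        ((fun t : ℂ => g (c + t • v)) ^ n * fun t : ℂ => u (c + t • v)) := by
      filter_upwards [(tendsto_line c v).eventually hfu] with t ht
      simpa using ht
    rw [analyticOrderAt_congr e, analyticOrderAt_mul (hga.pow n) hua, analyticOrderAt_pow hga]
    have h1 : 1 ≤ analyticOrderAt (fun t : ℂ => g (c + t • v)) 0 := by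
      rw [Order.one_le_iff_ne_zero, hga.analyticOrderAt_ne_zero]
      simpa using hgc
    calc (n : ℕ∞) = n • 1 := by simp
      _ ≤ n • analyticOrderAt (fun t : ℂ => g (c + t • v)) 0 := nsmul_le_nsmul_right h1 n
      _ ≤ _ := le_self_add
  exact analyticOrderAt_eq_top.1 hord

/-- A smooth curve germ on which `f` vanishes is, at nearby points, the whole zero set of `f`. -/
lemma HolNear.exists_zero_iff {f g : C2 → ℂ} {q : C2} (hf : HolNear f q) (hg : HolNear g q)
    (hgq : g q = 0) (hdg : fderiv ℂ g q ≠ 0) (hf0 : ¬ f =ᶠ[𝓝 q] 0)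
    (h : ∀ᶠ x in 𝓝 q, g x = 0 → f x = 0) :
    ∃ᶠ x in 𝓝 q, g x = 0 ∧ ∀ᶠ y in 𝓝 x, f y = 0 ↔ g y = 0 := by
  -- Take the largest power of `g` dividing `f`. The cofactor `u` is not identically zero on the
  -- curve, and where `u ≠ 0` the zeros of `f` and `g` coincide.
  obtain ⟨n, hn, hn'⟩ : ∃ n : ℕ, HolDvd (fun x => g x ^ n) f q ∧
      ¬ HolDvd (fun x => g x ^ (n + 1)) f q := by
    by_contra! hcon
    refine hf0 (hf.eventuallyEq_zero_of_pow_mul hg hgq fun n => ?_)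
    induction n with
    | zero => exact ⟨f, hf, by simp⟩
    | succ n ih => exact hcon n ih
  obtain ⟨u, hu, hfu⟩ := hn
  have hu0 : ¬ ∀ᶠ x in 𝓝 q, g x = 0 → u x = 0 := by
    intro hcon
    obtain ⟨u', hu', huu'⟩ := hu.exists_eq_mul hg hgq hdg hcon
    refine hn' ⟨u', hu', ?_⟩
    filter_upwards [hfu, huu'] with x h1 h2
    rw [h1, h2]; ring
  have hn0 : n ≠ 0 := by
    rintro rfl
    apply hu0
    filter_upwards [h, hfu] with x h1 h2 h3
    rw [h1 h3] at h2
    simpa using h2.symm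
  refine ((not_eventually.1 hu0).and_eventually (hu.eventually.and
    (eventually_eventually_nhds.2 hfu))).mono ?_
  rintro x ⟨h1, h2, h3⟩
  push Not at h1
  refine ⟨h1.1, ?_⟩
  filter_upwards [h2.continuousAt.eventually_ne h1.2, h3] with y h4 h5
  rw [h5, mul_eq_zero, or_iff_left h4, pow_eq_zero_iff hn0]

/-- If `f` is not reduced at `p` then, at some point close to `p`, the zero set of `f` is a smooth
curve along which the differential of `f` vanishes. -/
theorem exists_multiple_component {f a b : C2 → ℂ} {p : C2} (hf : HolNear f p)
    (ha : HolNear a p) (hf0 : ¬ f =ᶠ[𝓝 p] 0)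
    (hab : ∀ᶠ x in 𝓝 p, a x ^ 2 = f x * b x) (hfa : ¬ HolDvd f a p) :
    ∃ᶠ q in 𝓝 p, ∃ g : C2 → ℂ, HolNear g q ∧ g q = 0 ∧ fderiv ℂ g q ≠ 0 ∧
      (∀ᶠ x in 𝓝 q, f x = 0 ↔ g x = 0) ∧ ∀ᶠ x in 𝓝 q, g x = 0 → fderiv ℂ f x = 0 := by
  intro hcon
  have hall := ((hf.and ha).and (hab.and (hf.eventually_not_eventuallyEq_zero hf0))).and hcon
  obtain ⟨R, hR, hB⟩ := Metric.eventually_nhds_iff_ball.1 hall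
  have hBo : IsOpen (ball p R) := isOpen_ball
  have hfn {x : C2} (hx : x ∈ ball p R) : HolNear f x := by
    filter_upwards [hBo.mem_nhds hx] with y hy using (hB y hy).1.1.1
  have han {x : C2} (hx : x ∈ ball p R) : HolNear a x := by
    filter_upwards [hBo.mem_nhds hx] with y hy using (hB y hy).1.1.2
  let N : Set C2 := {x | x ∈ ball p R ∧ ¬ HolDvd f a x}
  have hNf {x : C2} (hx : x ∈ N) : f x = 0 := by
    by_contra h
    exact hx.2 (holDvd_of_ne_zero (hfn hx.1) (han hx.1) h)
  -- The points of non-divisibility have no isolated points, by the Hartogs argument. This replaces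
  -- the theory of components of the curve.
  have hacc {q : C2} (hq : q ∈ N) : ∃ᶠ x in 𝓝[≠] q, x ∈ N := by
    intro h
    refine hq.2 (HolDvd.of_punctured (hfn hq.1) (han hq.1) (hB q hq.1).1.2.2 ?_)
    have h1 : ∀ᶠ x in 𝓝[≠] q, x ∈ ball p R :=
      nhdsWithin_le_nhds (hBo.mem_nhds hq.1)
    filter_upwards [h, h1] with x h2 h3
    by_contra h4
    exact h2 ⟨h3, h4⟩
  classical
  -- Minimize the number of derivatives needed to make `f` nonzero at a point of `N`. Dropping the
  -- outermost derivative gives a function `g` that vanishes on `N` but has nonzero differential at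
  -- `q`.
  have hex : ∃ k : ℕ, ∃ q ∈ N, ∃ L : List C2, L.length = k ∧ wordDeriv L f q ≠ 0 := by
    have hp : p ∈ N := ⟨mem_ball_self hR, hfa⟩
    obtain ⟨L, hL⟩ := hf.exists_wordDeriv_ne_zero hf0
    exact ⟨_, p, hp, L, rfl, hL⟩
  obtain ⟨q, hq, L, hLk, hL⟩ := Nat.find_spec hex
  have hmin {x : C2} (hx : x ∈ N) (L' : List C2) (hL' : L'.length < L.length) :
      wordDeriv L' f x = 0 := by
    by_contra h
    rw [hLk] at hL'
    exact Nat.find_min hex hL' ⟨x, hx, L', rfl, h⟩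
  cases L with
  | nil => exact hL (hNf hq)
  | cons v L =>
    set g := wordDeriv L f
    have hg : HolNear g q := (hfn hq.1).word L
    have hgN {x : C2} (hx : x ∈ N) : g x = 0 := hmin hx L (by simp)
    have hdg : fderiv ℂ g q ≠ 0 := by
      intro h
      apply hL
      change fderiv ℂ g q v = 0
      rw [h]; rfl
    have hvan {H : C2 → ℂ} (hH : HolNear H q) (hHN : ∀ x ∈ N, H x = 0) :
        ∀ᶠ x in 𝓝 q, g x = 0 → H x = 0 :=
      hH.eventually_eq_zero_on_curve hg (hgN hq) hdg
        ((hacc hq).mono fun x hx => ⟨hgN hx, hHN x hx⟩)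
    -- If `L` were empty then `g = f`; since `a² = f b` vanishes on `N`, `a` would vanish on the
    -- smooth curve `f = 0`, and `f` would divide `a`.
    have hL1 : L ≠ [] := by
      rintro rfl
      have haN : ∀ x ∈ N, a x = 0 := by
        intro x hx
        have := (hB x hx.1).1.2.1
        rw [hNf hx, zero_mul] at this
        exact pow_eq_zero_iff two_ne_zero |>.1 this
      obtain ⟨d, hd, had⟩ := (han hq.1).exists_eq_mul hg (hgN hq) hdg (hvan (han hq.1) haN)
      exact hq.2 ⟨d, hd, had⟩
    -- The minimal word has at least two letters, so every first derivative of `f` vanishes on `N`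
    -- and hence on the whole curve.
    have hdf : ∀ᶠ x in 𝓝 q, g x = 0 → fderiv ℂ f x = 0 := by
      have hi (i : Fin 2) := hvan ((hfn hq.1).fderiv_apply (EuclideanSpace.single i (1 : ℂ)))
        fun x hx => hmin hx [EuclideanSpace.single i (1 : ℂ)] (by
          have := List.length_pos_iff.2 hL1
          simp only [List.length_cons, List.length_nil]
          omega)
      filter_upwards [hi 0, hi 1] with x h0 h1 hx
      refine ContinuousLinearMap.coe_injective
        ((EuclideanSpace.basisFun (Fin 2) ℂ).toBasis.ext fun i => ?_)
      fin_cases i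
      · simpa using h0 hx
      · simpa using h1 hx
    have hz := (hfn hq.1).exists_zero_iff hg (hgN hq) hdg (hB q hq.1).1.2.2
      (hvan (hfn hq.1) fun x hx => hNf hx)
    obtain ⟨x, ⟨hx1, hx2⟩, hx3, hx4, hx5, hx6⟩ := (hz.and_eventually (hg.eventually.and
      ((hg.continuousAt_fderiv.eventually_ne hdg).and
        ((eventually_eventually_nhds.2 hdf).and (hBo.mem_nhds hq.1))))).exists
    exact (hB x hx6).2 ⟨g, hx3, hx1, hx4, hx2, hx5⟩

/-- A holomorphic function that vanishes to second order along an immersed curve is divisible by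
the square of the equation of the curve. -/
lemma HolNear.exists_eq_sq_mul {f : C2 → ℂ} {κ : ℂ → C2} (hκ : HolNear κ 0)
    (h0 : deriv κ 0 ≠ 0) (hf : HolNear f (κ 0)) (h : ∀ᶠ t in 𝓝 0, f (κ t) = 0)
    (hd : ∀ᶠ t in 𝓝 0, fderiv ℂ f (κ t) = 0) :
    ∃ g u : C2 → ℂ, HolNear g (κ 0) ∧ HolNear u (κ 0) ∧ g (κ 0) = 0 ∧
      ∀ᶠ x in 𝓝 (κ 0), f x = g x ^ 2 * u x := by
  obtain ⟨g, hg, hg0, hdg, hgκ⟩ := hκ.exists_equation h0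
  obtain ⟨f₁, hf₁, hff₁⟩ := hf.exists_eq_mul hg hg0 hdg (hgκ (fun x => f x = 0) h)
  -- On `g = 0` the product rule leaves `df = f₁ dg` with `dg ≠ 0`, so `f₁` vanishes on the curve
  -- too.
  have hz : ∀ᶠ x in 𝓝 (κ 0), g x = 0 → f₁ x = 0 := by
    filter_upwards [hgκ (fun x => fderiv ℂ f x = 0) hd, eventually_eventually_nhds.2 hff₁, hg, hf₁,
      hg.continuousAt_fderiv.eventually_ne hdg] with x h1 h2 h3 h4 h5 hgx
    have h6 : fderiv ℂ f x = g x • fderiv ℂ f₁ x + f₁ x • fderiv ℂ g x := by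
      rw [EventuallyEq.fderiv_eq h2]
      exact fderiv_fun_mul h3 h4
    rw [h1 hgx, hgx] at h6
    have h7 : f₁ x • fderiv ℂ g x = 0 := by rw [h6]; module
    exact (smul_eq_zero.1 h7).resolve_right h5
  obtain ⟨u, hu, hf₁u⟩ := hf₁.exists_eq_mul hg hg0 hdg hz
  refine ⟨g, u, hg, hu, hg0, ?_⟩
  filter_upwards [hff₁, hf₁u] with x h1 h2
  rw [h1, h2]; ring

/-- Hadamard's lemma. -/
lemma HolNear.exists_hadamard {f : C2 → ℂ} {c : C2} (hf : HolNear f c) :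
    ∃ g h : C2 → ℂ, HolNear g c ∧ HolNear h c ∧
      ∀ᶠ x in 𝓝 c, f x = f c + (x 0 - c 0) * g x + (x 1 - c 1) * h x := by
  let p₀ : C2 →L[ℂ] ℂ := EuclideanSpace.proj 0
  let p₁ : C2 →L[ℂ] ℂ := EuclideanSpace.proj 1
  let e₀ : C2 := EuclideanSpace.single 0 1
  have hp (x : C2) : p₀ x = x 0 ∧ p₁ x = x 1 := ⟨rfl, rfl⟩
  -- Projection onto the line where the first coordinate equals that of `c`. Then `f - f ∘ ρ`
  -- vanishes on that line, and `f ∘ ρ - f(c)` where the second coordinate equals that of `c`.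
  let ρ : C2 → C2 := fun x => x - p₀ (x - c) • e₀
  have hρc : ρ c = c := by simp [ρ]
  have hρ : HolNear ρ c := holNear_of_differentiable (by simp only [ρ]; fun_prop) c
  have hfρ : HolNear (fun x => f (ρ x)) c := hf.comp_of_eq hρ hρc
  obtain ⟨g, hg, hg'⟩ := (hf.sub hfρ).exists_eq_linear_mul p₀
    (fun h => by
      have := congrArg (fun ℓ : C2 →L[ℂ] ℂ => ℓ e₀) h
      simp [p₀, e₀] at this)
    (Eventually.of_forall fun x hx => by
      have : ρ x = x := by simp only [ρ, hx, zero_smul, sub_zero]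
      rw [this, sub_self])
  obtain ⟨h, hh, hh'⟩ := (hfρ.sub (holNear_const (f c) c)).exists_eq_linear_mul p₁
    (fun h => by
      have := congrArg (fun ℓ : C2 →L[ℂ] ℂ => ℓ (EuclideanSpace.single 1 1)) h
      simp [p₁] at this)
    (Eventually.of_forall fun x hx => by
      have : ρ x = c := by
        have h1 : x 1 - c 1 = 0 := hx
        ext i; fin_cases i
        · simp [ρ, p₀, e₀]
        · simpa [ρ, e₀, sub_eq_zero] using h1
      rw [this, sub_self])
  refine ⟨g, h, hg, hh, ?_⟩
  filter_upwards [hg', hh'] with x h1 h2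
  have h3 : p₀ (x - c) = x 0 - c 0 := rfl
  have h4 : p₁ (x - c) = x 1 - c 1 := rfl
  rw [h3] at h1
  rw [h4] at h2
  linear_combination h1 + h2

end Components

end PoissonSurface

end

noncomputable section

namespace PoissonSurface

section Charts

open Set Filter

/-! ## Germs in a chart -/

lemma HolNear.dirDeriv {f : C2 → ℂ} {c : C2} (hf : HolNear f c) (v : C2) :
    HolNear (dirDeriv v f) c := hf.fderiv_apply v

lemma HolNear.inv {f : C2 → ℂ} {c : C2} (hf : HolNear f c) (h0 : f c ≠ 0) :
    HolNear (fun x => (f x)⁻¹) c := by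
  filter_upwards [hf, hf.continuousAt.eventually_ne h0] with x h1 h2
  fun_prop (disch := assumption)

lemma holNear_coord (i : Fin 2) (c : C2) : HolNear (fun x : C2 => x i) c :=
  holNear_of_differentiable (by fun_prop) c

variable {X : Type*} [TopologicalSpace X] {e : OpenPartialHomeomorph X C2}

lemma eventually_symm {p : X} (hp : p ∈ e.source) {P : X → Prop} (h : ∀ᶠ x in 𝓝 p, P x) :
    ∀ᶠ y in 𝓝 (e p), P (e.symm y) := by
  have hc : Tendsto e.symm (𝓝 (e p)) (𝓝 p) := by
    simpa [ContinuousAt, e.left_inv hp] using e.continuousAt_symm (e.map_source hp)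
  exact hc.eventually h

lemma eventually_right_inv {p : X} (hp : p ∈ e.source) : ∀ᶠ y in 𝓝 (e p), e (e.symm y) = y := by
  filter_upwards [e.open_target.mem_nhds (e.map_source hp)] with y hy using e.right_inv hy

variable [ChartedSpace C2 X] [IsManifold 𝓘(ℂ, C2) ω X]

instance isManifold_one : IsManifold 𝓘(ℂ, C2) 1 X := IsManifold.of_le (n := ω) le_top

lemma holAt_pull (he : e ∈ atlas C2 X) {p : X} (hp : p ∈ e.source) {F : C2 → ℂ}
    (hF : HolNear F (e p)) : HolAt (fun x => F (e x)) p := by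
  filter_upwards [(e.continuousAt hp).eventually hF, e.open_source.mem_nhds hp] with x h1 h2
  exact (mdifferentiableAt_iff_differentiableAt.2 h1).comp x (mdifferentiableAt_atlas he h2)

lemma HolAt.holNear (he : e ∈ atlas C2 X) {p : X} (hp : p ∈ e.source) {φ : X → ℂ}
    (hφ : HolAt φ p) : HolNear (fun y => φ (e.symm y)) (e p) := by
  have hc : Tendsto e.symm (𝓝 (e p)) (𝓝 p) := by
    simpa [ContinuousAt, e.left_inv hp] using e.continuousAt_symm (e.map_source hp)
  filter_upwards [hc.eventually hφ, e.open_target.mem_nhds (e.map_source hp)] with y h1 h2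
  exact mdifferentiableAt_iff_differentiableAt.1
    (MDifferentiableAt.comp y h1 (mdifferentiableAt_atlas_symm he h2))

/-- The germ at `p` of a holomorphic function of the coordinates `e`. -/
def chartGerm (he : e ∈ atlas C2 X) {p : X} (hp : p ∈ e.source) (F : C2 → ℂ)
    (hF : HolNear F (e p)) : Stalk p :=
  germ (fun x => F (e x)) (holAt_pull he hp hF)

variable (he : e ∈ atlas C2 X) {p : X} (hp : p ∈ e.source)

lemma chartGerm_eq_iff {F G : C2 → ℂ} (hF : HolNear F (e p)) (hG : HolNear G (e p)) :
    chartGerm he hp F hF = chartGerm he hp G hG ↔ F =ᶠ[𝓝 (e p)] G := by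
  refine (germ_eq_iff _ _).trans ⟨fun h => ?_, fun h => (e.continuousAt hp).eventually h⟩
  filter_upwards [eventually_symm hp h, eventually_right_inv hp] with y h1 h2
  rwa [h2] at h1

lemma germ_eq_chartGerm {φ : X → ℂ} (hφ : HolAt φ p) :
    germ φ hφ = chartGerm he hp (fun y => φ (e.symm y)) (hφ.holNear he hp) := by
  refine (germ_eq_iff _ _).2 ?_
  filter_upwards [e.open_source.mem_nhds hp] with x hx
  rw [e.left_inv hx]

lemma exists_chartGerm (a : Stalk p) : ∃ (F : C2 → ℂ) (hF : HolNear F (e p)),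
    chartGerm he hp F hF = a := by
  obtain ⟨φ, hφ, rfl⟩ := exists_germ a
  exact ⟨_, _, (germ_eq_chartGerm he hp hφ).symm⟩

lemma chartGerm_mul {F G : C2 → ℂ} (hF : HolNear F (e p)) (hG : HolNear G (e p)) :
    chartGerm he hp F hF * chartGerm he hp G hG =
      chartGerm he hp (fun x => F x * G x) (hF.mul hG) := rfl

lemma chartGerm_add {F G : C2 → ℂ} (hF : HolNear F (e p)) (hG : HolNear G (e p)) :
    chartGerm he hp F hF + chartGerm he hp G hG =
      chartGerm he hp (fun x => F x + G x) (hF.add hG) := rfl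

lemma chartGerm_smul (t : ℂ) {F : C2 → ℂ} (hF : HolNear F (e p)) :
    t • chartGerm he hp F hF =
      chartGerm he hp (fun x => t * F x) ((holNear_const t _).mul hF) := rfl

lemma chartGerm_const (t : ℂ) :
    chartGerm he hp (fun _ => t) (holNear_const t _) = algebraMap ℂ (Stalk p) t := rfl

lemma evalAt_chartGerm {F : C2 → ℂ} (hF : HolNear F (e p)) :
    evalAt p (chartGerm he hp F hF) = F (e p) := rfl

lemma chartGerm_eq_zero_iff {F : C2 → ℂ} (hF : HolNear F (e p)) :
    chartGerm he hp F hF = 0 ↔ F =ᶠ[𝓝 (e p)] 0 :=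
  chartGerm_eq_iff he hp hF (holNear_const 0 _)

lemma isUnit_of_evalAt_ne_zero {a : Stalk p} (h : evalAt p a ≠ 0) : IsUnit a := by
  obtain ⟨F, hF, rfl⟩ := exists_chartGerm (chart_mem_atlas C2 p) (mem_chart_source C2 p) a
  refine IsUnit.of_mul_eq_one (chartGerm (chart_mem_atlas C2 p) (mem_chart_source C2 p)
    (fun x => (F x)⁻¹) (hF.inv h)) ?_
  rw [chartGerm_mul, ← map_one (algebraMap ℂ (Stalk p)), ← chartGerm_const (chart_mem_atlas C2 p)
    (mem_chart_source C2 p), chartGerm_eq_iff]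
  filter_upwards [hF.continuousAt.eventually_ne h] with x hx using mul_inv_cancel₀ hx

/-- The derivative of germs in the direction `v`, in the coordinates `e`. -/
def chartDeriv (v : C2) : Derivation ℂ (Stalk p) (Stalk p) :=
  let D : Stalk p → Stalk p := fun a => chartGerm he hp
    (dirDeriv v (exists_chartGerm he hp a).choose)
    ((exists_chartGerm he hp a).choose_spec.choose.dirDeriv v)
  have hD {F : C2 → ℂ} (hF : HolNear F (e p)) : D (chartGerm he hp F hF) =
      chartGerm he hp (dirDeriv v F) (hF.dirDeriv v) := by
    have h := (chartGerm_eq_iff he hp _ _).1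
      (exists_chartGerm he hp (chartGerm he hp F hF)).choose_spec.choose_spec
    refine (chartGerm_eq_iff he hp _ _).2 ?_
    filter_upwards [h.eventuallyEq_nhds] with x hx
    simp only [dirDeriv, hx.fderiv_eq]
  Derivation.mk'
    { toFun := D
      map_add' := by
        intro a b
        obtain ⟨F, hF, rfl⟩ := exists_chartGerm he hp a
        obtain ⟨G, hG, rfl⟩ := exists_chartGerm he hp b
        rw [chartGerm_add, hD, hD, hD, chartGerm_add, chartGerm_eq_iff]
        filter_upwards [hF, hG] with x h1 h2
        simp only [dirDeriv]
        rw [fderiv_fun_add h1 h2]; rfl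
      map_smul' := by
        intro t a
        obtain ⟨F, hF, rfl⟩ := exists_chartGerm he hp a
        rw [chartGerm_smul, hD, hD, RingHom.id_apply, chartGerm_smul, chartGerm_eq_iff]
        filter_upwards [hF] with x h1
        simp only [dirDeriv]
        rw [fderiv_const_mul h1]; rfl }
    (by
      intro a b
      obtain ⟨F, hF, rfl⟩ := exists_chartGerm he hp a
      obtain ⟨G, hG, rfl⟩ := exists_chartGerm he hp b
      simp only [LinearMap.coe_mk, AddHom.coe_mk, smul_eq_mul]
      rw [chartGerm_mul, hD, hD, hD, chartGerm_mul, chartGerm_mul, chartGerm_add, chartGerm_eq_iff]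
      filter_upwards [hF, hG] with x h1 h2
      simp only [dirDeriv]
      rw [fderiv_fun_mul h1 h2]; rfl)

lemma chartDeriv_chartGerm (v : C2) {F : C2 → ℂ} (hF : HolNear F (e p)) :
    chartDeriv he hp v (chartGerm he hp F hF) =
      chartGerm he hp (dirDeriv v F) (hF.dirDeriv v) := by
  have h := (chartGerm_eq_iff he hp _ _).1
    (exists_chartGerm he hp (chartGerm he hp F hF)).choose_spec.choose_spec
  refine (chartGerm_eq_iff he hp
    ((exists_chartGerm he hp (chartGerm he hp F hF)).choose_spec.choose.dirDeriv v) _).2 ?_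
  filter_upwards [h.eventuallyEq_nhds] with x hx
  simp only [dirDeriv, hx.fderiv_eq]

lemma chartDeriv_iterate (v : C2) (n : ℕ) {F : C2 → ℂ} (hF : HolNear F (e p)) :
    (chartDeriv he hp v)^[n] (chartGerm he hp F hF) =
      chartGerm he hp ((dirDeriv v)^[n] F) (hF.dirDeriv_iterate v n) := by
  induction n with
  | zero => rfl
  | succ n ih =>
    simp only [Function.iterate_succ_apply', ih, chartDeriv_chartGerm]

lemma eq_zero_of_chartDeriv {a : Stalk p}
    (h : ∀ (v : C2) (n : ℕ), evalAt p ((chartDeriv he hp v)^[n] a) = 0) : a = 0 := by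
  obtain ⟨F, hF, rfl⟩ := exists_chartGerm he hp a
  refine (chartGerm_eq_zero_iff he hp hF).2 (hF.eventuallyEq_zero_of_dirDeriv fun v n => ?_)
  have := h v n
  rwa [chartDeriv_iterate, evalAt_chartGerm] at this

/-- The germ of a coordinate function. -/
def chartCoord (i : Fin 2) : Stalk p := chartGerm he hp (fun x => x i) (holNear_coord i _)

lemma chartDeriv_coord (v : C2) (i : Fin 2) :
    chartDeriv he hp v (chartCoord he hp i) = algebraMap ℂ (Stalk p) (v i) := by
  rw [chartCoord, chartDeriv_chartGerm, ← chartGerm_const he hp, chartGerm_eq_iff]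
  refine Eventually.of_forall fun x => ?_
  have : fderiv ℂ (fun x : C2 => x i) x = EuclideanSpace.proj i :=
    (EuclideanSpace.proj i : C2 →L[ℂ] ℂ).fderiv
  simp only [dirDeriv, this]; rfl

/-- By Hadamard's lemma `δ a` is a combination of values of `δ` with coefficients in the maximal
ideal. Iterating, every value of `δ` vanishes to infinite order along all lines through the point.
-/
lemma derivation_eq_zero {δ : Derivation ℂ (Stalk p) (Stalk p)}
    (h0 : δ (chartCoord he hp 0) = 0) (h1 : δ (chartCoord he hp 1) = 0) : δ = 0 := by
  have key (n : ℕ) : ∀ {F : C2 → ℂ} (hF : HolNear F (e p)) (a : Stalk p),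
      δ a = chartGerm he hp F hF → ∀ v : C2,
        (n : ℕ∞) ≤ analyticOrderAt (fun t : ℂ => F (e p + t • v)) 0 := by
    induction n with
    | zero => intros; simp
    | succ n ih =>
      intro F hF a hFa v
      obtain ⟨A, hA, rfl⟩ := exists_chartGerm he hp a
      obtain ⟨G, H, hG, hH, hGH⟩ := hA.exists_hadamard
      obtain ⟨G', hG', hGG'⟩ := exists_chartGerm he hp (δ (chartGerm he hp G hG))
      obtain ⟨H', hH', hHH'⟩ := exists_chartGerm he hp (δ (chartGerm he hp H hH))
      have e1 : chartGerm he hp A hA = algebraMap ℂ _ (A (e p)) +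
          (chartCoord he hp 0 - algebraMap ℂ _ (e p 0)) * chartGerm he hp G hG +
          (chartCoord he hp 1 - algebraMap ℂ _ (e p 1)) * chartGerm he hp H hH :=
        (chartGerm_eq_iff he hp _ (((holNear_const _ _).add
          (((holNear_coord 0 _).sub (holNear_const _ _)).mul hG)).add
          (((holNear_coord 1 _).sub (holNear_const _ _)).mul hH))).2 hGH
      have e2 : δ (chartGerm he hp A hA) =
          (chartCoord he hp 0 - algebraMap ℂ _ (e p 0)) * chartGerm he hp G' hG' +
          (chartCoord he hp 1 - algebraMap ℂ _ (e p 1)) * chartGerm he hp H' hH' := by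
        rw [e1, hGG', hHH']
        simp [h0, h1]
      rw [hFa] at e2
      have e3 := (chartGerm_eq_iff he hp hF
        ((((holNear_coord 0 _).sub (holNear_const _ _)).mul hG').add
          (((holNear_coord 1 _).sub (holNear_const _ _)).mul hH'))).1 e2
      have e4 : (fun t : ℂ => F (e p + t • v)) =ᶠ[𝓝 0] (id *
          ((fun _ => v 0) * (fun t : ℂ => G' (e p + t • v)) +
            (fun _ => v 1) * fun t : ℂ => H' (e p + t • v))) := by
        filter_upwards [(tendsto_line (e p) v).eventually e3] with t ht
        rw [ht]
        simp
        ring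
      have aG := (hG'.line v).analyticAt
      have aH := (hH'.line v).analyticAt
      have oG := ih hG' _ hGG'.symm v
      have oH := ih hH' _ hHH'.symm v
      rw [analyticOrderAt_congr e4, analyticOrderAt_mul analyticAt_id
        ((analyticAt_const.mul aG).add (analyticAt_const.mul aH)), analyticOrderAt_id, Nat.cast_add,
        Nat.cast_one, add_comm]
      refine add_le_add le_rfl (le_trans (le_min ?_ ?_) le_analyticOrderAt_add)
      · rw [analyticOrderAt_mul analyticAt_const aG]; exact oG.trans le_add_self
      · rw [analyticOrderAt_mul analyticAt_const aH]; exact oH.trans le_add_self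
  ext a
  obtain ⟨F, hF, hFa⟩ := exists_chartGerm he hp (δ a)
  rw [← hFa]
  refine (chartGerm_eq_zero_iff he hp hF).2 (hF.eventuallyEq_zero_of_lines fun v => ?_)
  exact analyticOrderAt_eq_top.1 (ENat.eq_top_iff_forall_ge.2 fun n => key n hF a hFa.symm v)

/-- The local coordinates on `𝒪_p` given by a chart. -/
def chartCoords : LocalCoords (Stalk p) where
  w := chartCoord he hp 0
  z := chartCoord he hp 1
  dw := chartDeriv he hp (EuclideanSpace.single 0 1)
  dz := chartDeriv he hp (EuclideanSpace.single 1 1)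
  dw_w := by rw [chartDeriv_coord]; simp
  dw_z := by rw [chartDeriv_coord]; simp
  dz_w := by rw [chartDeriv_coord]; simp
  dz_z := by rw [chartDeriv_coord]; simp
  rigid _ h0 h1 := derivation_eq_zero he hp h0 h1

lemma chartDeriv_eq (v : C2) (a : Stalk p) : chartDeriv he hp v a =
    algebraMap ℂ _ (v 0) * (chartCoords he hp).dw a +
      algebraMap ℂ _ (v 1) * (chartCoords he hp).dz a := by
  have := Derivation.congr_fun ((chartCoords he hp).derivation_eq (chartDeriv he hp v)) a
  rw [this]
  have h0 : chartDeriv he hp v (chartCoords he hp).w = _ := chartDeriv_coord he hp v 0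
  have h1 : chartDeriv he hp v (chartCoords he hp).z = _ := chartDeriv_coord he hp v 1
  rw [h0, h1]
  simp [Algebra.smul_def]

/-- The divisibility `f ∣ b a` is stable under differentiating `b`. Starting from `b = f`, some
iterated derivative is a unit, since `f ≠ 0`, and so `f` divides `a`. -/
lemma isReducedAt_chart {f : Stalk p} (hf0 : f ≠ 0) (hf : IsReduced (Stalk p ⧸ Ideal.span {f})) :
    (chartCoords he hp).IsReducedAt f where
  regular a ha := by
    obtain ⟨F, hF, rfl⟩ := exists_chartGerm he hp f
    obtain ⟨A, hA, rfl⟩ := exists_chartGerm he hp a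
    rw [chartGerm_mul, chartGerm_eq_zero_iff] at ha
    rw [Ne, chartGerm_eq_zero_iff] at hf0
    exact (chartGerm_eq_zero_iff he hp _).2 (hF.eventuallyEq_zero_of_mul hA hf0 ha)
  dvd a hw hz := by
    have hsq (y : Stalk p) (h : f ∣ y ^ 2) : f ∣ y := by
      rw [← Ideal.mem_span_singleton, ← Ideal.Quotient.eq_zero_iff_mem] at h ⊢
      rw [map_pow] at h
      exact pow_eq_zero_iff two_ne_zero |>.1 h
    by_contra hfa
    refine hf0 (eq_zero_of_chartDeriv he hp fun v n => ?_)
    have hv : f ∣ chartDeriv he hp v f * a := by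
      rw [chartDeriv_eq, add_mul, mul_assoc, mul_assoc]
      exact dvd_add (hw.mul_left _) (hz.mul_left _)
    -- Differentiate `b a = f k` and multiply by `b_v a`. Every term other than `(b_v a)²` contains
    -- `f`, `f_v a` or `b a`, hence is divisible by `f`, and reducedness removes the square.
    have hK (b : Stalk p) (hb : f ∣ b * a) : f ∣ chartDeriv he hp v b * a := by
      apply hsq
      obtain ⟨k, hk⟩ := hb
      obtain ⟨l, hl⟩ := hv
      have h1 := congrArg (chartDeriv he hp v) hk
      simp only [Derivation.leibniz, smul_eq_mul] at h1
      refine ⟨chartDeriv he hp v b * (l * k + chartDeriv he hp v k * a -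
        k * chartDeriv he hp v a), ?_⟩
      linear_combination chartDeriv he hp v b * a * h1 + chartDeriv he hp v b * k * hl -
        chartDeriv he hp v b * chartDeriv he hp v a * hk
    have hn : f ∣ (chartDeriv he hp v)^[n] f * a := by
      induction n with
      | zero => exact Dvd.intro _ rfl
      | succ n ih => rw [Function.iterate_succ_apply']; exact hK _ ih
    by_contra hne
    obtain ⟨u, hu⟩ := isUnit_of_evalAt_ne_zero hne
    rw [← hu] at hn
    exact hfa ((Units.dvd_mul_left).1 hn)

end Charts

end PoissonSurface

end

noncomputable section

namespace PoissonSurface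

section Fibers

open Set Filter

/-! ## The characteristic variety in a chart -/

variable {X : Type*} [TopologicalSpace X] [ChartedSpace C2 X]

lemma exists_linear_germ (c : C2) (η : C2 →L[ℂ] ℂ) : ∃ G : C2 → ℂ, HolNear G c ∧ G c = 0 ∧
    fderiv ℂ G c = η := by
  refine ⟨fun x => η (x - c), holNear_of_differentiable (by fun_prop) c, by simp, ?_⟩
  have : HasFDerivAt (fun x => η (x - c)) (η.comp (ContinuousLinearMap.id ℂ C2)) c :=
    HasFDerivAt.comp (g := η) (f := fun x : C2 => x - c) c η.hasFDerivAt
      ((hasFDerivAt_id c).sub_const c)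
  exact this.fderiv

/-- A covector satisfies the equations of the conormal space of the curve `f = 0`. -/
def IsConormalCovector (f : C2 → ℂ) (c : C2) (η : C2 →L[ℂ] ℂ) : Prop :=
  f c * η (EuclideanSpace.single 0 1) = 0 ∧ f c * η (EuclideanSpace.single 1 1) = 0 ∧
    fderiv ℂ f c (EuclideanSpace.single 0 1) * η (EuclideanSpace.single 1 1) -
      fderiv ℂ f c (EuclideanSpace.single 1 1) * η (EuclideanSpace.single 0 1) = 0

/-- The coefficient of `π` in the frame `∂_w ∧ ∂_z` given by a chart, as a function of the
coordinates. -/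
def chartCoeff (e : OpenPartialHomeomorph X C2) (π : PoissonStructure X) : C2 → ℂ :=
  fun y => π.bracket (fun x => e x 0) (fun x => e x 1) (e.symm y)

variable [IsManifold 𝓘(ℂ, C2) ω X]
  {e : OpenPartialHomeomorph X C2} (he : e ∈ atlas C2 X) (π : PoissonStructure X)

include he

lemma holNear_chartCoeff {p : X} (hp : p ∈ e.source) : HolNear (chartCoeff e π) (e p) :=
  (π.holAt_bracket (holAt_pull he hp (holNear_coord 0 _))
    (holAt_pull he hp (holNear_coord 1 _))).holNear he hp

lemma germAt_coord {p : X} (hp : p ∈ e.source) :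
    (π.germAt p).1 (chartCoords he hp).w (chartCoords he hp).z =
      chartGerm he hp (chartCoeff e π) (holNear_chartCoeff he π hp) :=
  (π.germAt_germ _ _).trans (germ_eq_chartGerm he hp _)

lemma zeroIdeal_eq {p : X} (hp : p ∈ e.source) : π.zeroIdeal p =
    Ideal.span {chartGerm he hp (chartCoeff e π) (holNear_chartCoeff he π hp)} := by
  rw [← germAt_coord he π hp]
  apply le_antisymm
  · apply Ideal.span_le.2
    rintro _ ⟨a, b, rfl⟩
    rw [(chartCoords he hp).bivec_apply _ a b]
    exact Ideal.mem_span_singleton.2 (Dvd.intro _ rfl)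
  · apply Ideal.span_le.2
    rintro _ rfl
    exact Ideal.subset_span ⟨_, _, rfl⟩

lemma dAt_pull {p : X} (hp : p ∈ e.source) {F : C2 → ℂ} (hF : DifferentiableAt ℂ F (e p)) :
    dAt (fun x => F (e x)) p = (fderiv ℂ F (e p)).comp (mfderiv 𝓘(ℂ, C2) 𝓘(ℂ, C2) e p) := by
  rw [← mfderiv_eq_fderiv]
  exact mfderiv_comp p (mdifferentiableAt_iff_differentiableAt.2 hF) (mdifferentiableAt_atlas he hp)

lemma comp_mfderiv_injective {p : X} (hp : p ∈ e.source) {η θ : C2 →L[ℂ] ℂ}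
    (h : (η.comp (mfderiv 𝓘(ℂ, C2) 𝓘(ℂ, C2) e p) : Cotangent p) =
      θ.comp (mfderiv 𝓘(ℂ, C2) 𝓘(ℂ, C2) e p)) : η = θ := by
  have h1 := (mdifferentiable_of_mem_atlas (I := 𝓘(ℂ, C2)) he).comp_symm_deriv (e.map_source hp)
  rw [e.left_inv hp] at h1
  ext v
  have h2 := congrArg (fun L : C2 →L[ℂ] C2 => L v) h1
  have h3 := congrArg (fun L : Cotangent p => L (mfderiv 𝓘(ℂ, C2) 𝓘(ℂ, C2) e.symm (e p) v)) h
  change mfderiv 𝓘(ℂ, C2) 𝓘(ℂ, C2) e p (mfderiv 𝓘(ℂ, C2) 𝓘(ℂ, C2) e.symm (e p) v) = v at h2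
  change η (mfderiv 𝓘(ℂ, C2) 𝓘(ℂ, C2) e p (mfderiv 𝓘(ℂ, C2) 𝓘(ℂ, C2) e.symm (e p) v)) =
    θ (mfderiv 𝓘(ℂ, C2) 𝓘(ℂ, C2) e p (mfderiv 𝓘(ℂ, C2) 𝓘(ℂ, C2) e.symm (e p) v)) at h3
  rwa [h2] at h3

lemma exists_eq_comp_mfderiv {p : X} (hp : p ∈ e.source) (α : Cotangent p) :
    ∃ η : C2 →L[ℂ] ℂ, α = η.comp (mfderiv 𝓘(ℂ, C2) 𝓘(ℂ, C2) e p) := by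
  have h1 := (mdifferentiable_of_mem_atlas (I := 𝓘(ℂ, C2)) he).symm_comp_deriv hp
  refine ⟨ContinuousLinearMap.comp (α : C2 →L[ℂ] ℂ) (mfderiv 𝓘(ℂ, C2) 𝓘(ℂ, C2) e.symm (e p) :), ?_⟩
  ext v
  have h2 := congrArg (fun L : C2 →L[ℂ] C2 => L v) h1
  exact (congrArg (fun u : C2 => α u) h2).symm

/-- The bivector `π` vanishes at a point iff its coefficient does. -/
lemma bivector_eq_zero_iff {p : X} (hp : p ∈ e.source) :
    π.bivector p = 0 ↔ chartCoeff e π (e p) = 0 := by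
  have hcoeff : chartCoeff e π (e p) =
      π.bivector p (dAt (fun x => e x 0) p) (dAt (fun x => e x 1) p) := by
    have (x : X) (hx : x = p) : π.bracket (fun x => e x 0) (fun x => e x 1) x =
        π.bivector p (dAt (fun x => e x 0) p) (dAt (fun x => e x 1) p) := by subst hx; rfl
    exact this _ (e.left_inv hp)
  refine ⟨fun h => by rw [hcoeff, h]; rfl, fun h => ?_⟩
  rw [hcoeff] at h
  set d₀ := dAt (fun x => e x 0) p with hd₀
  set d₁ := dAt (fun x => e x 1) p with hd₁
  have hspan (α : Cotangent p) : ∃ s t : ℂ, α = s • d₀ + t • d₁ := by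
    obtain ⟨η, rfl⟩ := exists_eq_comp_mfderiv he hp α
    refine ⟨η (EuclideanSpace.single 0 1), η (EuclideanSpace.single 1 1), ?_⟩
    have hd (i : Fin 2) : dAt (fun x => e x i) p =
        (EuclideanSpace.proj i : C2 →L[ℂ] ℂ).comp (mfderiv 𝓘(ℂ, C2) 𝓘(ℂ, C2) e p) := by
      rw [dAt_pull he hp (F := fun y => y i) (by fun_prop)]
      congr 1
      exact (EuclideanSpace.proj i : C2 →L[ℂ] ℂ).fderiv
    rw [hd₀, hd₁, hd, hd]
    ext v
    set u : C2 := mfderiv 𝓘(ℂ, C2) 𝓘(ℂ, C2) e p v with hu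
    change η u = η (EuclideanSpace.single 0 1) * u 0 + η (EuclideanSpace.single 1 1) * u 1
    have : u = u 0 • EuclideanSpace.single 0 1 + u 1 • EuclideanSpace.single 1 1 := by
      ext i; fin_cases i <;> simp
    conv_lhs => rw [this]
    simp [mul_comm]
  have h' : π.bivector p d₁ d₀ = 0 := by
    have := π.alternating p (d₀ + d₁)
    simp only [map_add, LinearMap.add_apply, π.alternating, h] at this
    simpa using this
  ext α β
  obtain ⟨s, t, rfl⟩ := hspan α
  obtain ⟨s', t', rfl⟩ := hspan β
  simp [π.alternating, h, h']

lemma mem_inChart_iff {p : X} (hp : p ∈ e.source) (η : C2 →L[ℂ] ℂ) :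
    (e p, η) ∈ inChart π.charVariety e ↔
      ∃ (G : C2 → ℂ) (hG : HolNear G (e p)), G (e p) = 0 ∧ fderiv ℂ G (e p) = η ∧
        (InChar (evalAt p) (chartGerm he hp G hG) (H0 (π.germAt p)) ∨
         InChar (evalAt p) (chartGerm he hp G hG) (H1 (π.germAt p)) ∨
         InChar (evalAt p) (chartGerm he hp G hG) (H2 (π.germAt p))) := by
  have h1 : (e p, η) ∈ inChart π.charVariety e ↔
      (⟨p, η.comp (mfderiv 𝓘(ℂ, C2) 𝓘(ℂ, C2) e p)⟩ : Σ x : X, Cotangent x) ∈ π.charVariety := by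
    simp only [inChart, mem_ofPred_eq, e.map_source hp, true_and]
    rw [e.left_inv hp]
  rw [h1]
  constructor
  · rintro ⟨g, hg, hg0, hdg, h⟩
    have hG := hg.holNear he hp
    refine ⟨_, hG, by simpa [e.left_inv hp] using hg0, ?_, ?_⟩
    · apply comp_mfderiv_injective he hp
      refine ((dAt_pull he hp hG.differentiableAt).symm.trans ?_).trans hdg
      refine Filter.EventuallyEq.mfderiv_eq ?_
      filter_upwards [e.open_source.mem_nhds hp] with x hx
      rw [e.left_inv hx]
    · rw [← germ_eq_chartGerm he hp hg]; exact h
  · rintro ⟨G, hG, hG0, hdG, h⟩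
    refine ⟨_, holAt_pull he hp hG, hG0, ?_, h⟩
    rw [← hdG]
    exact dAt_pull he hp hG.differentiableAt

/-- Only degree two contributes at a reduced point. The conditions depend on `g` only through
`dg(p)`, so a linear representative suffices. -/
lemma mem_inChart_iff_isConormalCovector {p : X} (hp : p ∈ e.source)
    (hf0 : ¬ chartCoeff e π =ᶠ[𝓝 (e p)] 0) (hred : IsReduced (π.ZeroStalk p)) (η : C2 →L[ℂ] ℂ) :
    (e p, η) ∈ inChart π.charVariety e ↔ IsConormalCovector (chartCoeff e π) (e p) η := by
  have hF := holNear_chartCoeff he π hp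
  have hco := germAt_coord he π hp
  have hr : (chartCoords he hp).IsReducedAt
      ((π.germAt p).1 (chartCoords he hp).w (chartCoords he hp).z) := by
    rw [hco]
    refine isReducedAt_chart he hp ?_ ?_
    · rwa [Ne, chartGerm_eq_zero_iff]
    · rw [← zeroIdeal_eq he π hp]; exact hred
  have hev {G : C2 → ℂ} (hG : HolNear G (e p)) (hdG : fderiv ℂ G (e p) = η) :
      (chartCoords he hp).IsConormal (evalAt p)
        ((π.germAt p).1 (chartCoords he hp).w (chartCoords he hp).z) (chartGerm he hp G hG) ↔
      IsConormalCovector (chartCoeff e π) (e p) η := by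
    rw [hco, ← hdG]
    simp only [LocalCoords.IsConormal, chartCoords, chartDeriv_chartGerm, evalAt_chartGerm]
    rfl
  rw [mem_inChart_iff he π hp]
  constructor
  · rintro ⟨G, hG, hG0, hdG, h | h | h⟩
    · exact absurd h ((chartCoords he hp).not_inChar_H0 _ _ hr.regular)
    · exact absurd h ((chartCoords he hp).not_inChar_H1 _ _ hr)
    · exact (hev hG hdG).1 ((chartCoords he hp).isConormal_of_inChar_H2 hG0 h)
  · intro h
    obtain ⟨G, hG, hG0, hdG⟩ := exists_linear_germ (e p) η
    exact ⟨G, hG, hG0, hdG, Or.inr (Or.inr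
      ((chartCoords he hp).inChar_H2_of_isConormal hG0 hr ((hev hG hdG).2 h)))⟩

lemma mem_inChart_of_singular {p : X} (hp : p ∈ e.source) (h0 : chartCoeff e π (e p) = 0)
    (hd : fderiv ℂ (chartCoeff e π) (e p) = 0) (η : C2 →L[ℂ] ℂ) :
    (e p, η) ∈ inChart π.charVariety e := by
  rw [mem_inChart_iff he π hp]
  obtain ⟨G, hG, hG0, hdG⟩ := exists_linear_germ (e p) η
  refine ⟨G, hG, hG0, hdG, Or.inr (Or.inr ((chartCoords he hp).inChar_H2_of_singular hG0 ?_ ?_ ?_))⟩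
  · rw [germAt_coord]; exact h0
  all_goals
    rw [germAt_coord]
    simp only [chartCoords, chartDeriv_chartGerm, evalAt_chartGerm, dirDeriv, hd]
    rfl

lemma mem_inChart_of_eventuallyEq_zero {p : X} (hp : p ∈ e.source)
    (h0 : chartCoeff e π =ᶠ[𝓝 (e p)] 0) (η : C2 →L[ℂ] ℂ) :
    (e p, η) ∈ inChart π.charVariety e := by
  rw [mem_inChart_iff he π hp]
  obtain ⟨G, hG, hG0, hdG⟩ := exists_linear_germ (e p) η
  refine ⟨G, hG, hG0, hdG, Or.inl (inChar_H0_of_eq_zero hG0 ?_)⟩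
  rw [(chartCoords he hp).bivec_eq (π.germAt p), germAt_coord, (chartGerm_eq_zero_iff he hp _).2 h0,
    zero_smul]

lemma isReduced_zeroStalk_of_ne_zero {p : X} (hp : p ∈ e.source)
    (h0 : chartCoeff e π (e p) ≠ 0) : IsReduced (π.ZeroStalk p) := by
  have hu : IsUnit (chartGerm he hp (chartCoeff e π) (holNear_chartCoeff he π hp)) :=
    isUnit_of_evalAt_ne_zero h0
  have : Subsingleton (π.ZeroStalk p) := by
    rw [Ideal.Quotient.subsingleton_iff, zeroIdeal_eq he π hp, Ideal.span_singleton_eq_top]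
    exact hu
  exact isReduced_of_subsingleton

lemma mem_inChart_iff_of_ne_zero {p : X} (hp : p ∈ e.source) (h0 : chartCoeff e π (e p) ≠ 0)
    (η : C2 →L[ℂ] ℂ) : (e p, η) ∈ inChart π.charVariety e ↔ η = 0 := by
  rw [mem_inChart_iff_isConormalCovector he π hp (fun h => h0 h.self_of_nhds)
    (isReduced_zeroStalk_of_ne_zero he π hp h0)]
  constructor
  · rintro ⟨h1, h2, -⟩
    refine ContinuousLinearMap.coe_injective
      ((EuclideanSpace.basisFun (Fin 2) ℂ).toBasis.ext fun i => ?_)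
    fin_cases i
    · simpa using (mul_eq_zero.1 h1).resolve_left h0
    · simpa using (mul_eq_zero.1 h2).resolve_left h0
  · rintro rfl
    simp [IsConormalCovector]

lemma chartGerm_dvd_iff {p : X} (hp : p ∈ e.source) {F A : C2 → ℂ} (hF : HolNear F (e p))
    (hA : HolNear A (e p)) :
    chartGerm he hp F hF ∣ chartGerm he hp A hA ↔ HolDvd F A (e p) := by
  constructor
  · rintro ⟨b, hb⟩
    obtain ⟨B, hB, rfl⟩ := exists_chartGerm he hp b
    exact ⟨B, hB, (chartGerm_eq_iff he hp hA (hF.mul hB)).1 hb⟩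
  · rintro ⟨B, hB, h⟩
    exact ⟨chartGerm he hp B hB, (chartGerm_eq_iff he hp hA (hF.mul hB)).2 h⟩

lemma isReduced_zeroStalk_iff {p : X} (hp : p ∈ e.source) : IsReduced (π.ZeroStalk p) ↔
    ∀ a, HolNear a (e p) → HolDvd (chartCoeff e π) (fun x => a x ^ 2) (e p) →
      HolDvd (chartCoeff e π) a (e p) := by
  have hF := holNear_chartCoeff he π hp
  have hmk {A : C2 → ℂ} (hA : HolNear A (e p)) :
      Ideal.Quotient.mk (π.zeroIdeal p) (chartGerm he hp A hA) = 0 ↔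
        HolDvd (chartCoeff e π) A (e p) := by
    rw [Ideal.Quotient.eq_zero_iff_mem, zeroIdeal_eq he π hp, Ideal.mem_span_singleton,
      chartGerm_dvd_iff]
  have hsq {A : C2 → ℂ} (hA : HolNear A (e p)) :
      chartGerm he hp A hA ^ 2 = chartGerm he hp (fun x => A x ^ 2) (hA.pow 2) := rfl
  constructor
  · intro h a ha hd
    rw [← hmk (ha.pow 2), ← hsq ha, map_pow] at hd
    exact (hmk ha).1 (pow_eq_zero_iff two_ne_zero |>.1 hd)
  · refine fun h => (isReduced_iff_pow_one_lt 2 one_lt_two).2 fun x hx => ?_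
    obtain ⟨a, rfl⟩ := Ideal.Quotient.mk_surjective x
    obtain ⟨A, hA, rfl⟩ := exists_chartGerm he hp a
    rw [← map_pow, hsq, hmk] at hx
    exact (hmk hA).2 (h A hA hx)

end Fibers

end PoissonSurface

end

noncomputable section

namespace PoissonSurface

section Conormal

open Set Filter

/-! ## The conormal variety of a reduced curve is Lagrangian -/

lemma C2_eq (x : C2) :
    x = x 0 • EuclideanSpace.single 0 (1 : ℂ) + x 1 • EuclideanSpace.single 1 (1 : ℂ) := by
  ext i; fin_cases i <;> simp

lemma functional_ext {ℓ m : C2 →L[ℂ] ℂ}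
    (h0 : ℓ (EuclideanSpace.single 0 1) = m (EuclideanSpace.single 0 1))
    (h1 : ℓ (EuclideanSpace.single 1 1) = m (EuclideanSpace.single 1 1)) : ℓ = m := by
  ext x
  rw [C2_eq x]
  simp only [map_add, map_smul, h0, h1]

lemma eq_zero_of_forall_functional {x : C2} (h : ∀ η : C2 →L[ℂ] ℂ, η x = 0) : x = 0 := by
  ext i
  exact h (EuclideanSpace.proj i)

lemma tstar_zero_smul (u : TstarC2) : (0 : ℂ) • u = 0 := zero_smul ℂ u

lemma covector_zero_smul (η : C2 →L[ℂ] ℂ) : (0 : ℂ) • η = 0 := zero_smul ℂ η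

lemma exists_eq_smul_of_wedge {ℓ m : C2 →L[ℂ] ℂ} (hℓ : ℓ ≠ 0)
    (h : ℓ (EuclideanSpace.single 0 1) * m (EuclideanSpace.single 1 1) -
      ℓ (EuclideanSpace.single 1 1) * m (EuclideanSpace.single 0 1) = 0) :
    ∃ s : ℂ, m = s • ℓ := by
  by_cases h0 : ℓ (EuclideanSpace.single 0 1) = 0
  · have h1 : ℓ (EuclideanSpace.single 1 1) ≠ 0 := fun h1 => hℓ (functional_ext (by simpa) (by simpa))
    refine ⟨m (EuclideanSpace.single 1 1) / ℓ (EuclideanSpace.single 1 1), functional_ext ?_ ?_⟩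
    · rw [h0] at h
      simp only [zero_mul, zero_sub, neg_eq_zero, mul_eq_zero, h1, false_or] at h
      simp [h0, h]
    · simp [h1]
  · refine ⟨m (EuclideanSpace.single 0 1) / ℓ (EuclideanSpace.single 0 1), functional_ext ?_ ?_⟩
    · simp [h0]
    · simp only [smul_apply, smul_eq_mul]
      field_simp
      linear_combination h

lemma exists_eq_smul_of_ker {ℓ : C2 →L[ℂ] ℂ} (hℓ : ℓ ≠ 0) {k : C2} (hk : k ≠ 0) (hℓk : ℓ k = 0) :
    (∀ x, ℓ x = 0 → ∃ a : ℂ, x = a • k) ∧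
      ∀ m : C2 →L[ℂ] ℂ, m k = 0 → ∃ b : ℂ, m = b • ℓ := by
  obtain ⟨u, μ, h1, h2, h3⟩ := exists_ker_basis hℓ
  have hμ : μ k ≠ 0 := by
    intro h
    apply hk
    rw [h3 k hℓk, h, zero_smul]
  have hu : u = (μ k)⁻¹ • k := by
    nth_rewrite 2 [h3 k hℓk]
    rw [smul_smul, inv_mul_cancel₀ hμ, one_smul]
  constructor
  · intro x hx
    refine ⟨μ x * (μ k)⁻¹, ?_⟩
    rw [mul_smul, ← hu]
    exact h3 x hx
  · intro m hm
    obtain ⟨w, hw⟩ : ∃ w, ℓ w ≠ 0 := by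
      by_contra! hcon
      exact hℓ (by ext x; simp [hcon])
    refine ⟨m w / ℓ w, ?_⟩
    ext x
    have h4 : ℓ (x - (ℓ x / ℓ w) • w) = 0 := by simp [hw]
    have h5 : m (x - (ℓ x / ℓ w) • w) = 0 := by
      rw [h3 _ h4, hu]
      simp [hm]
    simp only [map_sub, map_smul, smul_eq_mul, sub_eq_zero] at h5
    rw [h5, smul_apply, smul_eq_mul]
    ring

lemma IsConormalCovector.of_zero (f : C2 → ℂ) (c : C2) : IsConormalCovector f c 0 := by
  simp [IsConormalCovector]

lemma IsConormalCovector.of_smul {f : C2 → ℂ} {c : C2} (h : f c = 0) (s : ℂ) :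
    IsConormalCovector f c (s • fderiv ℂ f c) := by
  refine ⟨by simp [h], by simp [h], ?_⟩
  simp only [smul_apply, smul_eq_mul]
  ring

lemma IsConormalCovector.eq_zero {f : C2 → ℂ} {c : C2} {η : C2 →L[ℂ] ℂ}
    (h : IsConormalCovector f c η) (hη : η ≠ 0) : f c = 0 := by
  by_contra hf
  exact hη (functional_ext (by simpa [hf] using h.1) (by simpa [hf] using h.2.1))

/-- The conormal variety of a function `f` on an open set `U`. -/
def conormalVariety (f : C2 → ℂ) (U : Set C2) : Set TstarC2 :=
  {y | y.1 ∈ U ∧ IsConormalCovector f y.1 y.2}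

lemma isAnalyticSubset_conormalVariety {f : C2 → ℂ} {U : Set C2} (hU : IsOpen U)
    (hf : DifferentiableOn ℂ f U) : IsAnalyticSubset (U ×ˢ univ) (conormalVariety f U) := by
  refine ⟨fun y hy => ⟨hy.1, trivial⟩, fun x hx => ⟨U ×ˢ univ, hU.prod isOpen_univ, hx, subset_rfl,
    3, ![fun y => f y.1 * y.2 (EuclideanSpace.single 0 1),
      fun y => f y.1 * y.2 (EuclideanSpace.single 1 1),
      fun y => fderiv ℂ f y.1 (EuclideanSpace.single 0 1) * y.2 (EuclideanSpace.single 1 1) -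
        fderiv ℂ f y.1 (EuclideanSpace.single 1 1) * y.2 (EuclideanSpace.single 0 1)],
    ?_, ?_⟩⟩
  · have h1 : DifferentiableOn ℂ (fun y : TstarC2 => f y.1) (U ×ˢ univ) :=
      hf.comp differentiableOn_fst fun y hy => hy.1
    have h2 (v : C2) : DifferentiableOn ℂ (fun y : TstarC2 => fderiv ℂ f y.1 v) (U ×ˢ univ) :=
      (DifferentiableOn.fderiv_apply hU hf v).comp differentiableOn_fst fun y hy => hy.1
    have h3 (v : C2) : DifferentiableOn ℂ (fun y : TstarC2 => y.2 v) (U ×ˢ univ) := by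
      fun_prop
    intro i
    fin_cases i
    · exact h1.mul (h3 _)
    · exact h1.mul (h3 _)
    · exact ((h2 _).mul (h3 _)).sub ((h2 _).mul (h3 _))
  · intro y hy
    simp only [conormalVariety, mem_ofPred_eq, hy.1, true_and, Fin.forall_fin_succ]
    simp [IsConormalCovector]

/-- The germ of `f` at `c` is nonzero and generates a radical ideal. -/
structure IsReducedGerm (f : C2 → ℂ) (c : C2) : Prop where
  ne_zero : ¬ f =ᶠ[𝓝 c] 0
  dvd : ∀ a, HolNear a c → HolDvd f (fun x => a x ^ 2) c → HolDvd f a c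

/-- A reduced function does not vanish to second order along a curve. -/
lemma IsReducedGerm.not_vanish {f : C2 → ℂ} {κ : ℂ → C2} (hκ : HolNear κ 0)
    (h0 : deriv κ 0 ≠ 0) (hf : HolNear f (κ 0)) (hred : IsReducedGerm f (κ 0))
    (h : ∀ᶠ t in 𝓝 0, f (κ t) = 0) (hd : ∀ᶠ t in 𝓝 0, fderiv ℂ f (κ t) = 0) : False := by
  obtain ⟨g, u, hg, hu, hg0, hfgu⟩ := hκ.exists_eq_sq_mul h0 hf h hd
  -- If `f = g² u`, then `(g u)² = f u`, so `g u = f b` by reducedness. Hence `f (1 - g b) = 0`,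
  -- which is absurd because `g` vanishes at the point.
  obtain ⟨b, hb, hgub⟩ := hred.dvd (fun x => g x * u x) (hg.mul hu) ⟨u, hu, by
    filter_upwards [hfgu] with x hx
    rw [hx]; ring⟩
  have h1 := hf.eventuallyEq_zero_of_mul ((holNear_const 1 _).sub (hg.mul hb)) hred.ne_zero (by
    filter_upwards [hfgu, hgub] with x h1 h2
    linear_combination h1 + g x * h2)
  have h2 := h1.self_of_nhds
  simp [hg0] at h2

section RegularPoint

variable {f : C2 → ℂ} {U : Set C2} {Φ : OpenPartialHomeomorph TstarC2 TstarC2}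
  {T' : Submodule ℂ TstarC2}

/-- The Liouville form vanishes on the regular part of the conormal variety. -/
lemma liouville_eq_zero (hf : ∀ c ∈ U, HolNear f c) (hred : ∀ c ∈ U, IsReducedGerm f c)
    (hΦ : DifferentiableOn ℂ Φ.symm Φ.target)
    (hS : ∀ y ∈ Φ.source, y ∈ conormalVariety f U ↔ Φ y ∈ T') {y u : TstarC2}
    (hy : y ∈ Φ.target) (hyT : y ∈ T') (hu : u ∈ T') :
    (Φ.symm y).2 (fderiv ℂ (fun y => (Φ.symm y).1) y u) = 0 := by
  by_contra hne
  have hA : HolNear (fun y => (Φ.symm y).1) y := by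
    filter_upwards [holNear_of_differentiableOn Φ.open_target hΦ hy] with z hz using hz.fst
  have hB : HolNear (fun y => (Φ.symm y).2) y := by
    filter_upwards [holNear_of_differentiableOn Φ.open_target hΦ hy] with z hz using hz.snd
  -- The base projection of a straight line in the flattened variety. A nonzero Liouville form makes
  -- it an immersed curve, carrying nonzero conormal covectors.
  set κ : ℂ → C2 := fun t => (Φ.symm (y + t • u)).1 with hκd
  have hκ : HolNear κ 0 := hA.line u
  have hlim := tendsto_line y u
  have hderiv : ∀ᶠ t : ℂ in 𝓝 0, HasDerivAt κ
      (fderiv ℂ (fun y => (Φ.symm y).1) (y + t • u) u) t := by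
    filter_upwards [hlim.eventually hA] with t ht
    exact DifferentiableAt.hasDerivAt_line ht
  have hκ0 : κ 0 = (Φ.symm y).1 := by simp [κ, tstar_zero_smul]
  have hd0 : deriv κ 0 = fderiv ℂ (fun y => (Φ.symm y).1) y u := by
    have := hderiv.self_of_nhds.deriv
    simpa [tstar_zero_smul] using this
  have hmem : ∀ᶠ t : ℂ in 𝓝 0, Φ.symm (y + t • u) ∈ conormalVariety f U := by
    filter_upwards [hlim.eventually (Φ.open_target.mem_nhds hy)] with t ht
    rw [hS _ (Φ.map_target ht), Φ.right_inv ht]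
    exact T'.add_mem hyT (T'.smul_mem t hu)
  have hne' : ∀ᶠ t : ℂ in 𝓝 0,
      (Φ.symm (y + t • u)).2 (fderiv ℂ (fun y => (Φ.symm y).1) (y + t • u) u) ≠ 0 := by
    have hc : ContinuousAt (fun z => (Φ.symm z).2 (fderiv ℂ (fun y => (Φ.symm y).1) z u)) y :=
      hB.continuousAt.clm_apply (hA.fderiv_apply u).continuousAt
    exact hlim.eventually (hc.eventually_ne hne)
  have hU0 : κ 0 ∈ U := by
    rw [hκ0]
    have := hmem.self_of_nhds.1
    simpa [tstar_zero_smul] using this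
  have hz : ∀ᶠ t in 𝓝 0, f (κ t) = 0 := by
    filter_upwards [hmem, hne'] with t h1 h2
    exact h1.2.eq_zero fun h => h2 (by rw [h]; rfl)
  refine IsReducedGerm.not_vanish hκ ?_ (hf _ hU0) (hred _ hU0) hz ?_
  · intro h
    rw [hd0] at h
    exact hne (by rw [h, map_zero])
  · filter_upwards [hmem, hne', hderiv, eventually_eventually_nhds.2 hz,
      hκ.continuousAt.eventually (hf _ hU0)] with t h1 h2 h3 h4 h5
    have hθ : (Φ.symm (y + t • u)).2 ≠ 0 := fun h => h2 (by rw [h]; rfl)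
    -- Here `df = s θ` with `θ(κ') ≠ 0`, while `df(κ') = 0` because `f ∘ κ = 0`. So `s = 0` and `df`
    -- vanishes along `κ`.
    obtain ⟨s, hs⟩ := exists_eq_smul_of_wedge hθ (m := fderiv ℂ f (κ t))
      (by linear_combination -h1.2.2.2)
    have h6 : HasDerivAt (fun t => f (κ t)) (fderiv ℂ f (κ t)
      (fderiv ℂ (fun y => (Φ.symm y).1) (y + t • u) u)) t := h5.hasFDerivAt.comp_hasDerivAt t h3
    have h7 := h6.unique ((hasDerivAt_const t (0 : ℂ)).congr_of_eventuallyEq h4)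
    rw [hs, smul_apply, smul_eq_mul] at h7
    rw [hs, (mul_eq_zero.1 h7).resolve_right h2]
    exact covector_zero_smul _

/-- The symplectic form vanishes on the regular part of the conormal variety. -/
lemma canonicalForm_eq_zero (hf : ∀ c ∈ U, HolNear f c) (hred : ∀ c ∈ U, IsReducedGerm f c)
    (hΦ : DifferentiableOn ℂ Φ.symm Φ.target)
    (hS : ∀ y ∈ Φ.source, y ∈ conormalVariety f U ↔ Φ y ∈ T') {y u v : TstarC2}
    (hy : y ∈ Φ.target) (hyT : y ∈ T') (hu : u ∈ T') (hv : v ∈ T') :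
    canonicalForm (fderiv ℂ Φ.symm y u) (fderiv ℂ Φ.symm y v) = 0 := by
  have hψ := holNear_of_differentiableOn Φ.open_target hΦ hy
  set A : TstarC2 → C2 := fun y => (Φ.symm y).1 with hAd
  set B : TstarC2 → (C2 →L[ℂ] ℂ) := fun y => (Φ.symm y).2 with hBd
  have hA : HolNear A y := by filter_upwards [hψ] with z hz using hz.fst
  have hB : HolNear B y := by filter_upwards [hψ] with z hz using hz.snd
  have hDA (u : TstarC2) : fderiv ℂ A y u = (fderiv ℂ Φ.symm y u).1 := by
    rw [(hψ.differentiableAt.hasFDerivAt.fst).fderiv]; rfl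
  have hDB (u : TstarC2) : fderiv ℂ B y u = (fderiv ℂ Φ.symm y u).2 := by
    rw [(hψ.differentiableAt.hasFDerivAt.snd).fderiv]; rfl
  have hsymm : IsSymmSndFDerivAt ℂ A y :=
    (hA.contDiffAt 2).isSymmSndFDerivAt (by simp)
  -- The symplectic form is the exterior derivative of the Liouville form: differentiate its
  -- vanishing on `v` in the direction `u` and antisymmetrize, the second derivative of `A` being
  -- symmetric.
  have key {u v : TstarC2} (hu : u ∈ T') (hv : v ∈ T') :
      fderiv ℂ B y u (fderiv ℂ A y v) + B y (fderiv ℂ (fderiv ℂ A) y u v) = 0 := by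
    have hz : ∀ᶠ t : ℂ in 𝓝 0, B (y + t • u) (fderiv ℂ A (y + t • u) v) = 0 := by
      filter_upwards [(tendsto_line y u).eventually (Φ.open_target.mem_nhds hy)] with t ht
      exact liouville_eq_zero hf hred hΦ hS ht (T'.add_mem hyT (T'.smul_mem t hu)) hv
    have h1 : HasDerivAt (fun t : ℂ => B (y + t • u)) (fderiv ℂ B y u) 0 := by
      have := DifferentiableAt.hasDerivAt_line (f := B) (c := y) (v := u) (t := 0)
        (by simpa [tstar_zero_smul] using hB.differentiableAt)
      simpa [tstar_zero_smul] using this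
    have hdA : DifferentiableAt ℂ (fderiv ℂ A) y :=
      ((hA.contDiffAt 2).fderiv_right (m := 1) (by norm_num)).differentiableAt (by norm_num)
    have h2 : HasDerivAt (fun t : ℂ => fderiv ℂ A (y + t • u)) (fderiv ℂ (fderiv ℂ A) y u) 0 := by
      have := DifferentiableAt.hasDerivAt_line (f := fderiv ℂ A) (c := y) (v := u) (t := 0)
        (by simpa [tstar_zero_smul] using hdA)
      simpa [tstar_zero_smul] using this
    have h3 := h1.clm_apply (h2.clm_apply (hasDerivAt_const (0 : ℂ) v))
    have h4 := h3.unique ((hasDerivAt_const (0 : ℂ) (0 : ℂ)).congr_of_eventuallyEq hz)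
    simpa [tstar_zero_smul] using h4
  have e1 := key hu hv
  have e2 := key hv hu
  rw [hsymm.eq v u] at e2
  rw [canonicalForm, ← hDA, ← hDA, ← hDB, ← hDB]
  linear_combination e1 - e2

/-- Velocities of curves in a submanifold are tangent vectors. -/
lemma mem_tangent_of_curve {S : Set TstarC2} {x : TstarC2} (hx : x ∈ Φ.source)
    (hΦ : DifferentiableOn ℂ Φ Φ.source) (hS : ∀ y ∈ Φ.source, y ∈ S ↔ Φ y ∈ T')
    {γ : ℂ → TstarC2} {w : TstarC2} (h0 : γ 0 = x) (hγ : HasDerivAt γ w 0)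
    (hmem : ∀ᶠ t in 𝓝 0, γ t ∈ S) : fderiv ℂ Φ x w ∈ T' := by
  subst h0
  have h1 : HasDerivAt (fun t => Φ (γ t)) (fderiv ℂ Φ (γ 0) w) 0 :=
    ((hΦ.differentiableAt (Φ.open_source.mem_nhds hx)).hasFDerivAt).comp_hasDerivAt 0 hγ
  have h2 : ∀ᶠ t in 𝓝 0, Φ (γ t) ∈ T' := by
    filter_upwards [hmem, hγ.continuousAt.eventually (Φ.open_source.mem_nhds hx)] with t h2 h3
    exact (hS _ h3).1 h2
  refine T'.closed_of_finiteDimensional.mem_of_tendsto h1.tendsto_slope ?_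
  filter_upwards [nhdsWithin_le_nhds h2] with t ht
  rw [slope_def_module]
  exact T'.smul_mem _ (T'.sub_mem ht h2.self_of_nhds)

end RegularPoint

/-- The conormal variety of a reduced function is Lagrangian. -/
theorem isLagrangianIn_conormalVariety {f : C2 → ℂ} {U : Set C2} (hU : IsOpen U)
    (hf : ∀ c ∈ U, HolNear f c) (hred : ∀ c ∈ U, IsReducedGerm f c) :
    IsLagrangianIn (U ×ˢ univ) (conormalVariety f U) := by
  refine ⟨isAnalyticSubset_conormalVariety hU
    fun c hc => (hf c hc).differentiableAt.differentiableWithinAt, ?_⟩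
  rintro ⟨x, θ⟩ T ⟨hxS, Φ, T', hx, hΦ, hΦ', hS, rfl⟩ u
  have hmem (w : TstarC2) : w ∈ T'.comap (fderiv ℂ Φ (x, θ) : TstarC2 →ₗ[ℂ] TstarC2) ↔
      fderiv ℂ Φ (x, θ) w ∈ T' := Iff.rfl
  have hcurve {γ : ℂ → TstarC2} {w : TstarC2} (h0 : γ 0 = (x, θ)) (hγ : HasDerivAt γ w 0)
      (h : ∀ᶠ t in 𝓝 0, γ t ∈ conormalVariety f U) :
      w ∈ T'.comap (fderiv ℂ Φ (x, θ) : TstarC2 →ₗ[ℂ] TstarC2) :=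
    mem_tangent_of_curve hx hΦ hS h0 hγ h
  constructor
  · intro hu v hv
    rw [hmem] at hu hv
    have h1 := canonicalForm_eq_zero hf hred hΦ' hS (Φ.map_source hx) ((hS _ hx).1 hxS) hu hv
    have h2 (w : TstarC2) : fderiv ℂ Φ.symm (Φ (x, θ)) (fderiv ℂ Φ (x, θ) w) = w := by
      have h3 : HasFDerivAt (fun y => Φ.symm (Φ y)) ((fderiv ℂ Φ.symm (Φ (x, θ))).comp
          (fderiv ℂ Φ (x, θ))) (x, θ) :=
        HasFDerivAt.comp _ (hΦ'.differentiableAt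
          (Φ.open_target.mem_nhds (Φ.map_source hx))).hasFDerivAt
          (hΦ.differentiableAt (Φ.open_source.mem_nhds hx)).hasFDerivAt
      have h4 : HasFDerivAt (fun y => Φ.symm (Φ y)) (ContinuousLinearMap.id ℂ TstarC2) (x, θ) :=
        (hasFDerivAt_id _).congr_of_eventuallyEq (by
          filter_upwards [Φ.open_source.mem_nhds hx] with y hy using Φ.left_inv hy)
      exact congrArg (fun L : TstarC2 →L[ℂ] TstarC2 => L w) (h3.unique h4)
    rwa [h2, h2] at h1
  · intro hu
    have hxU : ∀ᶠ y in 𝓝 x, y ∈ U := hU.mem_nhds hxS.1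
    by_cases hθ : θ = 0
    · subst hθ
      -- The zero section lies in the variety, and its tangent directions already form a Lagrangian
      -- subspace.
      have h1 (v : C2) : ((v, 0) : TstarC2) ∈
          T'.comap (fderiv ℂ Φ (x, 0) : TstarC2 →ₗ[ℂ] TstarC2) := by
        refine hcurve (γ := fun t => (x + t • v, 0)) (by simp) ?_ ?_
        · have : HasDerivAt (fun t : ℂ => x + t • v) v 0 := by
            simpa using ((hasDerivAt_id (0 : ℂ)).smul_const v).const_add x
          exact this.prodMk (hasDerivAt_const _ _)
        · filter_upwards [(tendsto_line x v).eventually hxU] with t ht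
          exact ⟨ht, IsConormalCovector.of_zero _ _⟩
      have h2 : u.2 = 0 := by
        ext v
        have := hu _ (h1 v)
        simpa [canonicalForm] using this
      have h3 : u = (u.1, 0) := Prod.ext rfl h2
      rw [h3]; exact h1 _
    · have hfx : f x = 0 := hxS.2.eq_zero hθ
      have hline (η : C2 →L[ℂ] ℂ) : HasDerivAt (fun t : ℂ => (x, θ + t • η)) ((0, η) : TstarC2) 0 := by
        have : HasDerivAt (fun t : ℂ => θ + t • η) η 0 := by
          simpa using ((hasDerivAt_id (0 : ℂ)).smul_const η).const_add θ
        exact (hasDerivAt_const _ _).prodMk this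
      by_cases hdf : fderiv ℂ f x = 0
      · have h1 (η : C2 →L[ℂ] ℂ) : ((0, η) : TstarC2) ∈
            T'.comap (fderiv ℂ Φ (x, θ) : TstarC2 →ₗ[ℂ] TstarC2) := by
          refine hcurve (by simp [covector_zero_smul]) (hline η) (Eventually.of_forall fun t => ⟨hxS.1, ?_⟩)
          simp [IsConormalCovector, hfx, hdf]
        have h2 : u.1 = 0 := eq_zero_of_forall_functional fun η => by
          have := hu _ (h1 η)
          simpa [canonicalForm] using this
        have h3 : u = (0, u.2) := Prod.ext h2 rfl
        rw [h3]; exact h1 _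
      · obtain ⟨s, rfl⟩ := exists_eq_smul_of_wedge hdf hxS.2.2.2
        obtain ⟨κ, τ, hκ, hτ, hκ0, -, hfκ, hdκ, -⟩ := (hf x hxS.1).exists_parametrization hfx hdf
        -- At a smooth point of the curve two tangent vectors suffice: scaling of the conormal
        -- covector, and motion along the curve with covector `s df`.
        have h1 : ((0, fderiv ℂ f x) : TstarC2) ∈
            T'.comap (fderiv ℂ Φ (x, s • fderiv ℂ f x) : TstarC2 →ₗ[ℂ] TstarC2) := by
          refine hcurve (by simp [covector_zero_smul]) (hline _) (Eventually.of_forall fun t => ⟨hxS.1, ?_⟩)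
          have h2 : s • fderiv ℂ f x + t • fderiv ℂ f x = (s + t) • fderiv ℂ f x := by module
          change IsConormalCovector f x (s • fderiv ℂ f x + t • fderiv ℂ f x)
          rw [h2]
          exact IsConormalCovector.of_smul hfx _
        set k := deriv κ 0
        have hκd : HasDerivAt κ k 0 := hκ.differentiableAt.hasDerivAt
        have hddf : DifferentiableAt ℂ (fderiv ℂ f) (κ 0) := by
          rw [hκ0]
          exact (((hf x hxS.1).contDiffAt 2).fderiv_right (m := 1)
            (by norm_num)).differentiableAt (by norm_num)
        set m := s • fderiv ℂ (fderiv ℂ f) (κ 0) k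
        have h2 : ((k, m) : TstarC2) ∈
            T'.comap (fderiv ℂ Φ (x, s • fderiv ℂ f x) : TstarC2 →ₗ[ℂ] TstarC2) := by
          refine hcurve (γ := fun t => (κ t, s • fderiv ℂ f (κ t))) (by simp [hκ0]) ?_ ?_
          · exact hκd.prodMk ((hddf.hasFDerivAt.comp_hasDerivAt 0 hκd).const_smul s)
          · have hκU : ∀ᶠ t in 𝓝 0, κ t ∈ U :=
              hκ.continuousAt.eventually (by rwa [hκ0])
            filter_upwards [hκU, hfκ] with t h3 h4
            exact ⟨h3, IsConormalCovector.of_smul h4 s⟩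
        have hker : fderiv ℂ f x k = 0 := by
          have h3 : HasDerivAt (fun t => f (κ t)) (fderiv ℂ f (κ 0) k) 0 := by
            refine HasFDerivAt.comp_hasDerivAt 0 ?_ hκd
            rw [hκ0]; exact (hf x hxS.1).differentiableAt.hasFDerivAt
          have := h3.unique ((hasDerivAt_const (0 : ℂ) (0 : ℂ)).congr_of_eventuallyEq hfκ)
          rwa [hκ0] at this
        obtain ⟨hk1, hk2⟩ := exists_eq_smul_of_ker hdf hdκ hker
        have e1 := hu _ h1
        have e2 := hu _ h2
        simp only [canonicalForm, map_zero, zero_sub, neg_eq_zero] at e1 e2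
        obtain ⟨a, ha⟩ := hk1 _ e1
        obtain ⟨b, hb⟩ := hk2 (u.2 - a • m) (by
          rw [ha, map_smul, smul_eq_mul] at e2
          simpa using e2)
        have h3 : u = a • ((k, m) : TstarC2) + b • ((0, fderiv ℂ f x) : TstarC2) := by
          refine Prod.ext ?_ ?_
          · simp [ha]
          · simp [← hb]
        rw [h3]
        exact Submodule.add_mem _ (Submodule.smul_mem _ _ h2) (Submodule.smul_mem _ _ h1)

end Conormal

end PoissonSurface

end

noncomputable section

namespace PoissonSurface

section Main

open Set Filter

/-! ## Holonomic Poisson surfaces -/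

/-- The set contains an open piece, so its tangent space at a point is everything, on which the
symplectic form is nonzero. -/
lemma not_isLagrangianIn_of_fibers {S : Set TstarC2} {Ω : Set TstarC2} {c : C2}
    (h : ∀ᶠ y in 𝓝 c, ∀ η, (y, η) ∈ S) : ¬ IsLagrangianIn Ω S := by
  intro hL
  obtain ⟨N, hN, hNo, hc⟩ := eventually_nhds_iff.1 h
  have hNs : IsOpen (N ×ˢ (univ : Set (C2 →L[ℂ] ℂ))) := hNo.prod isOpen_univ
  have hreg : IsRegularPoint S (c, 0) ⊤ := by
    refine ⟨hN c hc 0, OpenPartialHomeomorph.ofSet _ hNs, ⊤, ⟨hc, trivial⟩, ?_, ?_, ?_, ?_⟩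
    · exact differentiableOn_id
    · exact differentiableOn_id
    · rintro ⟨y, η⟩ hy
      exact ⟨fun _ => trivial, fun _ => hN y hy.1 η⟩
    · rfl
  have h1 := (hL.2 _ _ hreg ((0, EuclideanSpace.proj 0) : TstarC2)).1 trivial
    ((EuclideanSpace.single 0 1, 0) : TstarC2) trivial
  simp [canonicalForm] at h1

lemma not_isLagrangianIn_of_curve {S : Set TstarC2} {Ω : Set TstarC2} {q : C2} {g : C2 → ℂ}
    (hg : HolNear g q) (hgq : g q = 0) (hdg : fderiv ℂ g q ≠ 0)
    (h : ∀ᶠ y in 𝓝 q, ∀ η, η ≠ 0 → ((y, η) ∈ S ↔ g y = 0)) : ¬ IsLagrangianIn Ω S := by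
  intro hL
  obtain ⟨N, hN, hNo, hq⟩ := eventually_nhds_iff.1 h
  obtain ⟨Ψ, hqΨ, hΨ, hd, hd'⟩ := hg.exists_straighten hdg
  set ℓ := fderiv ℂ g q with hℓ
  obtain ⟨k, μ, hμ, hℓk, -⟩ := exists_ker_basis hdg
  let Ψ' := Ψ.restrOpen N hNo
  have hΨ's : Ψ'.source = Ψ.source ∩ N := Ψ.restrOpen_source N hNo
  have hΨ't : Ψ'.target ⊆ Ψ.target := fun y hy => by
    have := Ψ'.map_target hy
    rw [hΨ's] at this
    have h2 := Ψ.map_source this.1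
    have h3 : Ψ (Ψ.symm y) = y := Ψ'.right_inv hy
    have h4 : Ψ (Ψ.symm y) ∈ Ψ.target := h2
    rwa [h3] at h4
  have hO : IsOpen {η : C2 →L[ℂ] ℂ | η ≠ 0} := isOpen_ne
  -- Away from the zero section the set is the full cotangent bundle restricted to the curve.
  -- Straightening the base alone turns it into the hyperplane `ℓ = 0`.
  let Φ : OpenPartialHomeomorph TstarC2 TstarC2 := Ψ'.prod (OpenPartialHomeomorph.ofSet _ hO)
  let T' : Submodule ℂ TstarC2 := LinearMap.ker
    ((ℓ ∘L ContinuousLinearMap.fst ℂ C2 (C2 →L[ℂ] ℂ) : TstarC2 →L[ℂ] ℂ) : TstarC2 →ₗ[ℂ] ℂ)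
  have hT' (v : TstarC2) : v ∈ T' ↔ ℓ v.1 = 0 := Iff.rfl
  have hsrc {y : C2} {η : C2 →L[ℂ] ℂ} : (y, η) ∈ Φ.source ↔ (y ∈ Ψ.source ∧ y ∈ N) ∧ η ≠ 0 := by
    change y ∈ Ψ'.source ∧ η ≠ 0 ↔ _
    rw [hΨ's]; rfl
  have hΦd : DifferentiableOn ℂ Φ Φ.source := by
    rintro ⟨y, η⟩ hy
    have h1 : DifferentiableAt ℂ Ψ y := hd.differentiableAt
      (Ψ.open_source.mem_nhds (hsrc.1 hy).1.1)
    have h2 : DifferentiableAt ℂ (fun v : TstarC2 => (Ψ v.1, v.2)) (y, η) :=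
      (h1.comp (y, η) differentiableAt_fst).prodMk differentiableAt_snd
    exact h2.differentiableWithinAt
  have hΦd' : DifferentiableOn ℂ Φ.symm Φ.target := by
    rintro ⟨y, η⟩ hy
    have h1 : DifferentiableAt ℂ Ψ.symm y := hd'.differentiableAt
      (Ψ.open_target.mem_nhds (hΨ't hy.1))
    have h2 : DifferentiableAt ℂ (fun v : TstarC2 => (Ψ.symm v.1, v.2)) (y, η) :=
      (h1.comp (y, η) differentiableAt_fst).prodMk differentiableAt_snd
    exact h2.differentiableWithinAt
  have hreg : IsRegularPoint S (q, μ) (T'.comap (fderiv ℂ Φ (q, μ) : TstarC2 →ₗ[ℂ] TstarC2)) := by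
    have hμ0 : μ ≠ 0 := by
      rintro rfl
      simp at hμ
    refine ⟨(hN q hq μ hμ0).2 hgq, Φ, T', hsrc.2 ⟨⟨hqΨ, hq⟩, hμ0⟩, hΦd, hΦd', ?_, rfl⟩
    rintro ⟨y, η⟩ hy
    rw [hsrc] at hy
    rw [hN y hy.1.2 η hy.2, hT']
    change g y = 0 ↔ ℓ (Ψ y) = 0
    rw [hΨ]
  have hmem (w : TstarC2) : w ∈ T'.comap (fderiv ℂ Φ (q, μ) : TstarC2 →ₗ[ℂ] TstarC2) ↔
      ℓ w.1 = 0 := by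
    have h1 : HasFDerivAt Ψ (fderiv ℂ Ψ q) q :=
      (hd.differentiableAt (Ψ.open_source.mem_nhds hqΨ)).hasFDerivAt
    have h2 : HasFDerivAt (fun v : TstarC2 => (Ψ v.1, v.2))
        (((fderiv ℂ Ψ q).comp (ContinuousLinearMap.fst ℂ C2 (C2 →L[ℂ] ℂ))).prod
          (ContinuousLinearMap.snd ℂ C2 (C2 →L[ℂ] ℂ))) (q, μ) :=
      (HasFDerivAt.comp (q, μ) h1 hasFDerivAt_fst).prodMk hasFDerivAt_snd
    have h3 : fderiv ℂ Φ (q, μ) = _ := h2.fderiv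
    have h4 : ℓ.comp (fderiv ℂ Ψ q) = ℓ := by
      have h5 : HasFDerivAt (fun x => ℓ (Ψ x)) (ℓ.comp (fderiv ℂ Ψ q)) q :=
        ℓ.hasFDerivAt.comp q h1
      rw [funext hΨ] at h5
      exact h5.unique hg.differentiableAt.hasFDerivAt
    change ℓ (fderiv ℂ Φ (q, μ) w).1 = 0 ↔ ℓ w.1 = 0
    rw [h3]
    change ℓ.comp (fderiv ℂ Ψ q) w.1 = 0 ↔ ℓ w.1 = 0
    rw [h4]
  -- Both `(0, μ)` and `(k, 0)` are tangent, but their symplectic pairing is `μ(k) = 1`.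
  have h1 := (hL.2 _ _ hreg ((0, μ) : TstarC2)).1 ((hmem _).2 (map_zero ℓ))
    ((k, 0) : TstarC2) ((hmem _).2 hℓk)
  simp [canonicalForm, hμ] at h1

variable {X : Type*} [TopologicalSpace X] [ChartedSpace C2 X] [IsManifold 𝓘(ℂ, C2) ω X]
  {π : PoissonStructure X}

lemma not_eventuallyEq_zero_of_dense (hD : Dense {x : X | π.bivector x ≠ 0})
    {e : OpenPartialHomeomorph X C2} (he : e ∈ atlas C2 X) {p : X} (hp : p ∈ e.source) :
    ¬ chartCoeff e π =ᶠ[𝓝 (e p)] 0 := by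
  intro h
  have h1 : ∀ᶠ x in 𝓝 p, π.bivector x = 0 := by
    filter_upwards [(e.continuousAt hp).eventually h, e.open_source.mem_nhds hp] with x h1 h2
    exact (bivector_eq_zero_iff he π h2).2 h1
  obtain ⟨x, h2, h3⟩ := (mem_closure_iff_frequently.1 (hD p)).and_eventually h1 |>.exists
  exact h2 h3

lemma PoissonStructure.IsLogSymplectic.isHolonomic (h : π.IsLogSymplectic) : π.IsHolonomic := by
  intro e he
  have hp {c : C2} (hc : c ∈ e.target) : e.symm c ∈ e.source ∧ e (e.symm c) = c :=
    ⟨e.map_target hc, e.right_inv hc⟩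
  have h0 (c : C2) (hc : c ∈ e.target) : ¬ chartCoeff e π =ᶠ[𝓝 c] 0 := by
    have := not_eventuallyEq_zero_of_dense h.1 he (hp hc).1
    rwa [(hp hc).2] at this
  have hS : inChart π.charVariety e = conormalVariety (chartCoeff e π) e.target := by
    ext ⟨c, η⟩
    by_cases hc : c ∈ e.target
    · have h1 := mem_inChart_iff_isConormalCovector he π (hp hc).1
        (by rw [(hp hc).2]; exact h0 c hc) (h.2 _) η
      rw [(hp hc).2] at h1
      rw [h1]
      exact ⟨fun h => ⟨hc, h⟩, fun h => h.2⟩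
    · exact ⟨fun h => absurd h.1 hc, fun h => absurd h.1 hc⟩
  rw [hS]
  refine isLagrangianIn_conormalVariety e.open_target (fun c hc => ?_) fun c hc => ⟨h0 c hc, ?_⟩
  · have := holNear_chartCoeff he π (hp hc).1
    rwa [(hp hc).2] at this
  · have := (isReduced_zeroStalk_iff he π (hp hc).1).1 (h.2 _)
    rwa [(hp hc).2] at this

/-- Were `π` zero on an open set, the degree zero cohomology would put all covectors over that set
in the characteristic variety. -/
lemma PoissonStructure.IsHolonomic.dense (h : π.IsHolonomic) :
    Dense {x : X | π.bivector x ≠ 0} := by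
  intro p
  rw [mem_closure_iff_frequently]
  intro hcon
  have he := chart_mem_atlas C2 p
  have hp := mem_chart_source C2 p
  set e := chartAt C2 p
  have h1 : ∀ᶠ c in 𝓝 (e p), chartCoeff e π c = 0 := by
    filter_upwards [eventually_symm hp hcon, e.open_target.mem_nhds (e.map_source hp)] with c h1 h2
    have h3 := (bivector_eq_zero_iff he π (e.map_target h2)).1 (not_not.1 h1)
    rwa [e.right_inv h2] at h3
  refine not_isLagrangianIn_of_fibers (c := e p) ?_ (h e he)
  filter_upwards [eventually_eventually_nhds.2 h1, e.open_target.mem_nhds (e.map_source hp)]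
    with c h2 h3 η
  have h4 := mem_inChart_of_eventuallyEq_zero he π (e.map_target h3)
    (by rw [e.right_inv h3]; exact h2) η
  rwa [e.right_inv h3] at h4

/-- A failure of reducedness yields a nearby smooth curve that is locally the zero set of `f` and on
which `df = 0`. Over it the characteristic variety contains full fibres, and off it only the zero
section. -/
lemma PoissonStructure.IsHolonomic.isReduced (h : π.IsHolonomic) (p : X) :
    IsReduced (π.ZeroStalk p) := by
  have he := chart_mem_atlas C2 p
  have hp := mem_chart_source C2 p
  set e := chartAt C2 p
  rw [isReduced_zeroStalk_iff he π hp]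
  rintro a ha ⟨b, -, hab⟩
  by_contra hdvd
  have hf := holNear_chartCoeff he π hp
  have hfr := exists_multiple_component hf ha (not_eventuallyEq_zero_of_dense h.dense he hp)
    hab hdvd
  obtain ⟨q, ⟨g, hg, hgq, hdg, hz, hd⟩, hq⟩ :=
    (hfr.and_eventually (e.open_target.mem_nhds (e.map_source hp))).exists
  refine not_isLagrangianIn_of_curve hg hgq hdg ?_ (h e he)
  filter_upwards [hz, hd, e.open_target.mem_nhds hq] with y h1 h2 h3 η hη
  have h4 := e.map_target h3
  have h5 := e.right_inv h3
  constructor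
  · intro h6
    by_contra h7
    have h8 := mem_inChart_iff_of_ne_zero he π h4 (by rw [h5]; exact fun h => h7 (h1.1 h)) η
    rw [h5] at h8
    exact hη (h8.1 h6)
  · intro h6
    have h8 := mem_inChart_of_singular he π h4 (by rw [h5]; exact h1.2 h6)
      (by rw [h5]; exact h2 h6) η
    rwa [h5] at h8

end Main

end PoissonSurface

end

theorem mainTheorem7 {X : Type*} [TopologicalSpace X] [T2Space X] [SecondCountableTopology X]
    [ChartedSpace PoissonSurface.C2 X] [IsManifold 𝓘(ℂ, PoissonSurface.C2) ω X]
    (π : PoissonSurface.PoissonStructure X) :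
    π.IsHolonomic ↔ π.IsLogSymplectic :=
  ⟨fun h => ⟨h.dense, h.isReduced⟩, fun h => h.isHolonomic⟩
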